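/- Let $d\ge 2$, let $e_1,\dots,e_d$ be the standard basis of $\mathbb{Z}^d$, let $\mathcal{M}$ be the set of probability measures on $\{e\in\mathbb{Z}^d:|e|=1\}$ and let $\Omega=\mathcal{M}^{\mathbb{Z}^d}$ be the space of environments $\omega=(\omega(x,e))$. Write $d(x,y)$ for the $\ell^1$-distance and $\mathcal{F}_\Lambda=\sigma(\omega_x:x\in\Lambda)$. Let $P$ be a probability measure on $\Omega$ such that * $P$ is invariant under the shifts of $\mathbb{Z}^d$; * $P$ is uniformly elliptic: there is $\kappa\in(0,\frac1{2d})$ such that $P$-a.s. $\omega(o,e)>\kappa$ for all unit vectors $e$; * for some $r\ge1$, $P$ is $r$-Markov: for every finite $V\subset\mathbb{Z}^d$, $P$-a.s. $P((\omega_x)_{x\in V}\in\cdot\mid\mathcal{F}_{V^c})=P((\omega_x)_{x\in V}\in\cdot\mid\mathcal{F}_{\partial_rV})$, where $\partial_rV=\{x\notin V: d(x,V)\le r\}$; * with the same $r$ there are constants $\gamma>0$ and $C<\infty$ such that for all finite $\Delta\subset V\subset\mathbb{Z}^d$ with $d(\Delta,V^c)\ge r$ and all $A\subset V^c$, $$\frac{\mathrm{d}P((\omega_x)_{x\in\Delta}\in\cdot\mid\eta)}{\mathrm{d}P((\omega_x)_{x\in\Delta}\in\cdot\mid\eta')}\le\exp\Big(C\sum_{x\in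 A,\,y\in\Delta}e^{-\gamma d(x,y)}\Big)$$ for all $\eta,\eta'$ that agree on $V^c\setminus A$ and lie in a set of configurations of full measure in $\mathcal{M}^{V^c}$ (which may depend on $\Delta,V,A$). Here $P(\,\cdot\mid\eta)$ is the regular conditional law given $(\omega_x)_{x\in V^c}=\eta$. Let $P_\omega^x$ be the law of the Markov chain $(X_n)$ on $\mathbb{Z}^d$ with $X_0=x$ and jump probabilities $\omega(y,e)$ from $y$ to $y+e$, let $\mathbf{P}=P\otimes P_\omega^o$, and $A_{\pm e_1}=\{\lim_n X_n\cdot(\pm e_1)=\infty\}$. Let $\bar{\mathbf P}=P\otimes Q\otimes P^o_{\omega,\epsilon}$, where under $Q$ the coins $\epsilon=(\epsilon_{i,x})_{i\ge0,\,x\in\mathbb{Z}^d}$ are i.i.d. with $Q(\epsilon_{i,x}=1)=d\kappa=1-Q(\epsilon_{i,x}=0)$, and $P^o_{\omega,\epsilon}$ is the law of the Markov chain started at $o$ that at time $n$ jumps from $z$ to $z+e$ with probability $\frac{1_{\epsilon_{n,z}=1}}{2d}+\frac{1_{\epsilon_{n,z}=0}}{1-d\kappa}\big[\omega(z,e)-\frac\kappa2\big]$.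 For a constant $c$ let $$R=R^{(c)}=\inf\Big\{n\ge0:\ \#\{0\le i\le n: (X_i-X_0)\cdot e_1=j\}>c(j+1)^2\text{ for some integer }j\ge0\Big\}\wedge\inf\{n\ge1:X_n\cdot e_1\le X_0\cdot e_1\}.$$ For $L\in\mathbb{N}$ put $R_0=0$ and, for $k\ge0$, let $S_{k+1}$ be the least $n\ge R_k$ with $n\ge L$ such that $X_{n-L}\cdot e_1>X_m\cdot e_1$ for all $m<n-L$, and $\epsilon_{n-i,X_{n-i}}=1$, $X_{n-i+1}-X_{n-i}=e_1$ for all $1\le i\le L$; let $R_{k+1}=S_{k+1}+R\circ\theta_{S_{k+1}}$, where $\theta_n$ is the time shift of the path. Let $\tau_1=\tau_1^{(c,L)}=S_K$ with $K=\inf\{k\ge1:S_k<\infty,\ R_k=\infty\}$ (infima over empty sets, and hence $\tau_1$ if there is no such $k$, are $\infty$). When $\mathbf{P}(R^{(c)}=\infty)>0$, let $\hat{\mathbf P}=\bar{\mathbf P}(\,\cdot\mid R^{(c)}=\infty)$. **Theorem.** There exist deterministic $v_{e_1},v_{-e_1}\ge0$, with $v_{e_1}=0$ if $\mathbf{P}(A_{e_1})=0$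 and $v_{-e_1}=0$ if $\mathbf{P}(A_{-e_1})=0$, such that $\mathbf{P}$-almost surely $$\lim_{n\to\infty}\frac{X_n\cdot e_1}{n}=v_{e_1}1_{A_{e_1}}-v_{-e_1}1_{A_{-e_1}}.$$ Moreover, if $v_{e_1}>0$, then $\mathbf{P}(A_{e_1}\cup A_{-e_1})=1$, there is a constant $c$ with $\mathbf{P}(R^{(c)}=\infty)>0$, and for every such $c$ one has $E_{\hat{\mathbf P}}\,\tau_1^{(c,L)}<\infty$ for all sufficiently large $L$. -/

import Mathlib

open MeasureTheory ProbabilityTheory Filter Topology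
open scoped ENNReal

namespace RWRE

/-! ### Sites, directions, environments -/

/-- The lattice `ℤ^d`. -/
abbrev Site (d : ℕ) := Fin d → ℤ

/-- The `2d` unit vectors of `ℤ^d`: the pair `(i, s)` stands for `s • e_i`, with `s = 1` or
`s = -1`. -/
abbrev Dir (d : ℕ) := Fin d × ℤˣ

/-- The unit vector of `ℤ^d` encoded by a direction. -/
def Dir.vec {d : ℕ} (e : Dir d) : Site d := Pi.single e.1 (e.2 : ℤ)

/-- The `ℓ¹`-distance on `ℤ^d`. -/
def dist1 {d : ℕ} (x y : Site d) : ℕ := ∑ i, (x i - y i).natAbs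

/-- The space of probability measures on the set of unit vectors of `ℤ^d`. -/
abbrev SiteLaw (d : ℕ) := ↥(stdSimplex ℝ (Dir d))

/-- Environments: `ω x e` is the probability of a jump from `x` to `x + e`. -/
abbrev Env (d : ℕ) := Site d → SiteLaw d

/-- Infinite sequences of sites. -/
abbrev WalkPath (d : ℕ) := ℕ → Site d

instance (d : ℕ) : StandardBorelSpace (SiteLaw d) :=
  (isClosed_stdSimplex ℝ (Dir d)).measurableSet.standardBorel

/-- The uniform distribution on the unit vectors. -/
noncomputable def uniformLaw (d : ℕ) [NeZero d] : SiteLaw d :=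
  ⟨fun _ => 1 / (2 * d), fun _ => by positivity, by
    have h : (d : ℝ) ≠ 0 := Nat.cast_ne_zero.2 (NeZero.ne d)
    simp [Finset.card_univ]
    field_simp⟩

noncomputable instance (d : ℕ) [NeZero d] : Nonempty (SiteLaw d) := ⟨uniformLaw d⟩

/-! ### Assumptions on the law of the environment -/

/-- The shift of an environment by `y`. -/
def shiftEnv {d : ℕ} (y : Site d) (ω : Env d) : Env d := fun x => ω (x + y)

/-- `P` is invariant under all shifts of `ℤ^d`. -/
def IsShiftInvariant {d : ℕ} (P : Measure (Env d)) : Prop :=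
  ∀ y : Site d, P.map (shiftEnv y) = P

/-- The open interval `(0, 1/(2d))`, in which the ellipticity constants live. -/
abbrev EllipticityConst (d : ℕ) := ↥(Set.Ioo (0 : ℝ) (1 / (2 * d)))

/-- `P` is uniformly elliptic with constant `κ`. -/
def IsUniformlyElliptic {d : ℕ} (P : Measure (Env d)) (κ : EllipticityConst d) : Prop :=
  ∀ᵐ ω ∂P, ∀ e : Dir d, (κ : ℝ) < ω 0 e

/-- The `r`-boundary of a set of sites. -/
def rBoundary {d : ℕ} (r : ℕ) (V : Set (Site d)) : Set (Site d) :=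
  {x | x ∉ V ∧ ∃ y ∈ V, dist1 x y ≤ r}

/-- The restriction `(ω_x)_{x ∈ Λ}` of an environment to `Λ`. -/
def restr {d : ℕ} (Λ : Set (Site d)) (ω : Env d) : Λ → SiteLaw d := fun x => ω x

/-- The `σ`-field generated by the environment in `Λ`. -/
@[reducible] def envSigma {d : ℕ} (Λ : Set (Site d)) : MeasurableSpace (Env d) :=
  MeasurableSpace.comap (restr Λ) inferInstance

/-- `P` is `r`-Markov. -/
def IsRMarkov {d : ℕ} (r : ℕ) (P : Measure (Env d)) : Prop :=
  ∀ V : Set (Site d), V.Finite → ∀ B : Set (V → SiteLaw d), MeasurableSet B →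
    P⟦restr V ⁻¹' B | envSigma Vᶜ⟧ =ᵐ[P] P⟦restr V ⁻¹' B | envSigma (rBoundary r V)⟧

/-- The regular conditional law of the environment in `Δ` given the environment in `Λ`,
as a kernel `η ↦ P((ω_x)_{x ∈ Δ} ∈ · | η)`. -/
noncomputable def condLaw {d : ℕ} [NeZero d] (P : Measure (Env d)) [IsProbabilityMeasure P]
    (Δ Λ : Set (Site d)) : Kernel (Λ → SiteLaw d) (Δ → SiteLaw d) :=
  condDistrib (restr Δ) (restr Λ) P

/-- The mixing condition for given parameters. The bound on the density
`dP((ω_x)_{x ∈ Δ} ∈ · | η) / dP((ω_x)_{x ∈ Δ} ∈ · | η')` by a constant `c` is written as the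
inequality `P((ω_x)_{x ∈ Δ} ∈ · | η) ≤ c P((ω_x)_{x ∈ Δ} ∈ · | η')` between measures. It holds for
all `η`, `η'` in a set of configurations of full measure that agree off `A`; this does not depend
on the version of the conditional law. For `γ > 0` the series converges. -/
def MixesWith {d : ℕ} [NeZero d] (P : Measure (Env d)) [IsProbabilityMeasure P]
    (r : ℕ) (γ C : ℝ) : Prop :=
  ∀ Δ V : Finset (Site d), Δ ⊆ V → (∀ x ∈ Δ, ∀ y ∉ V, r ≤ dist1 x y) →
    ∀ A : Set (Site d), A ⊆ (V : Set (Site d))ᶜ →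
      ∃ G : Set (↥(V : Set (Site d))ᶜ → SiteLaw d),
        (∀ᵐ ω ∂P, restr (V : Set (Site d))ᶜ ω ∈ G) ∧
        ∀ η ∈ G, ∀ η' ∈ G,
          (∀ x : ↥(V : Set (Site d))ᶜ, (x : Site d) ∉ A → η x = η' x) →
          condLaw P (Δ : Set (Site d)) (V : Set (Site d))ᶜ η ≤
            ENNReal.ofReal
                (Real.exp (C * ∑ y ∈ Δ, ∑' x : A, Real.exp (-γ * dist1 (x : Site d) y))) •
              condLaw P (Δ : Set (Site d)) (V : Set (Site d))ᶜ η'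

/-- For some `r ≥ 1`, `P` is an `r`-Markov environment that satisfies the mixing condition. -/
def IsStrongMixing {d : ℕ} [NeZero d] (P : Measure (Env d)) [IsProbabilityMeasure P] : Prop :=
  ∃ r : ℕ, 1 ≤ r ∧ IsRMarkov r P ∧ ∃ γ : ℝ, 0 < γ ∧ ∃ C : ℝ, MixesWith P r γ C

/-! ### The walk -/

/-- The law of `z + e`, where `e` has law `p`. -/
noncomputable def stepLaw {d : ℕ} (p : SiteLaw d) (z : Site d) : Measure (Site d) :=
  ∑ e : Dir d, ENNReal.ofReal (p e) • Measure.dirac (z + e.vec)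

instance {d : ℕ} (p : SiteLaw d) (z : Site d) : IsProbabilityMeasure (stepLaw p z) := by
  refine ⟨?_⟩
  simp only [stepLaw, Measure.coe_finsetSum, Measure.coe_smul, Finset.sum_apply, Pi.smul_apply,
    measure_univ, smul_eq_mul, mul_one]
  have h : ∑ e, p e = 1 := p.2.2
  rw [← ENNReal.ofReal_sum_of_nonneg (f := fun e => p e) (fun e _ => p.2.1 e), h, ENNReal.ofReal_one]

/-- The transition kernel at time `n` in the time-dependent environment `q`: given the path up to
time `n`, the next site has law `stepLaw (q n z) z`, where `z` is the current site. -/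
noncomputable def stepKernel {d : ℕ} (q : ℕ → Env d) (n : ℕ) :
    Kernel ((i : Finset.Iic n) → Site d) (Site d) where
  toFun h := stepLaw (q n (h ⟨n, Finset.mem_Iic.2 le_rfl⟩)) (h ⟨n, Finset.mem_Iic.2 le_rfl⟩)
  measurable' := Measurable.of_discrete

instance {d : ℕ} (q : ℕ → Env d) (n : ℕ) : IsMarkovKernel (stepKernel q n) :=
  ⟨fun _ => inferInstanceAs (IsProbabilityMeasure (stepLaw _ _))⟩

/-- The law on path space of the Markov chain in the time-dependent environment `q` that starts
at `x`. -/
noncomputable def pathLaw {d : ℕ} (x : Site d) (q : ℕ → Env d) : Measure (WalkPath d) :=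
  Kernel.trajMeasure (X := fun _ => Site d) (Measure.dirac x) (stepKernel q)

instance {d : ℕ} (x : Site d) (q : ℕ → Env d) : IsProbabilityMeasure (pathLaw x q) :=
  inferInstanceAs (IsProbabilityMeasure (Kernel.trajMeasure _ _))

lemma measurable_stepLaw_apply {d : ℕ} (z : Site d) (s : Set (Site d)) :
    Measurable fun p : SiteLaw d => stepLaw p z s := by
  simp only [stepLaw, Measure.coe_finsetSum, Measure.coe_smul, Finset.sum_apply, Pi.smul_apply,
    smul_eq_mul]
  refine Finset.measurable_sum _ fun e _ => Measurable.mul_const ?_ _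
  exact ENNReal.measurable_ofReal.comp ((measurable_pi_apply e).comp measurable_subtype_coe)

lemma pathLaw_init {d : ℕ} (x : Site d) (q : ℕ → Env d)
    (a : (i : Finset.Iic 0) → Site d) :
    (pathLaw x q).map (Preorder.frestrictLe 0) {a} =
      if x = a ⟨0, Finset.mem_Iic.2 le_rfl⟩ then 1 else 0 := by
  have h : (pathLaw x q).map (Preorder.frestrictLe 0) =
      (Measure.dirac x).map
        (MeasurableEquiv.piUnique (fun _ : Finset.Iic 0 => Site d)).symm := by
    rw [pathLaw, Kernel.trajMeasure, Measure.map_comp _ _ (by fun_prop),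
      Kernel.traj_map_frestrictLe, Kernel.partialTraj_self, Measure.id_comp]
  rw [h, Measure.map_dirac' (MeasurableEquiv.measurable _),
    Measure.dirac_apply' _ (measurableSet_singleton _), Set.indicator_apply]
  refine if_congr ⟨fun h => ?_, fun h => ?_⟩ rfl rfl
  · rw [← Set.mem_singleton_iff.1 h]; rfl
  · refine Set.mem_singleton_iff.2 (funext fun i => ?_)
    rw [Subsingleton.elim i ⟨0, Finset.mem_Iic.2 le_rfl⟩, ← h]; rfl

lemma pathLaw_succ {d : ℕ} (x : Site d) (q : ℕ → Env d) (n : ℕ)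
    (a : (i : Finset.Iic (n + 1)) → Site d) :
    (pathLaw x q).map (Preorder.frestrictLe (n + 1)) {a} =
      (pathLaw x q).map (Preorder.frestrictLe n)
          {Preorder.frestrictLe₂ (π := fun _ => Site d) n.le_succ a} *
        stepLaw (q n (a ⟨n, Finset.mem_Iic.2 n.le_succ⟩)) (a ⟨n, Finset.mem_Iic.2 n.le_succ⟩)
          {a ⟨n + 1, Finset.mem_Iic.2 le_rfl⟩} := by
  set b := Preorder.frestrictLe₂ (π := fun _ => Site d) n.le_succ a with hb
  set z := a ⟨n + 1, Finset.mem_Iic.2 le_rfl⟩ with hz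
  have h := Kernel.map_frestrictLe_trajMeasure_compProd_eq_map_trajMeasure
    (X := fun _ => Site d) (κ := stepKernel q) (μ₀ := Measure.dirac x) (a := n)
  have h1 := congrArg (fun μ => μ ({b} ×ˢ {z})) h
  rw [Measure.compProd_apply_prod (measurableSet_singleton _) (measurableSet_singleton _),
    lintegral_singleton, Measure.map_apply (by fun_prop)
      ((measurableSet_singleton _).prod (measurableSet_singleton _))] at h1
  rw [mul_comm, Measure.map_apply (by fun_prop) (measurableSet_singleton _)]
  refine Eq.trans (congrArg _ ?_) h1.symm
  ext X
  simp only [Set.mem_preimage, Set.mem_singleton_iff, Set.mem_prod]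
  constructor
  · intro hX
    rw [hb, hz, ← hX]
    exact ⟨rfl, rfl⟩
  · rintro ⟨h2, h3⟩
    funext i
    rcases (Finset.mem_Iic.1 i.2).lt_or_eq with hi | hi
    · exact congrFun h2 ⟨i, Finset.mem_Iic.2 (Nat.lt_succ_iff.1 hi)⟩
    · obtain ⟨i, hi'⟩ := i
      subst hi
      exact h3

lemma measurable_pathLaw {d : ℕ} (x : Site d) : Measurable (pathLaw x) := by
  have key : ∀ (n : ℕ) (a : (i : Finset.Iic n) → Site d),
      Measurable fun q => (pathLaw x q).map (Preorder.frestrictLe n) {a} := by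
    intro n
    induction n with
    | zero => intro a; simp only [pathLaw_init]; exact measurable_const
    | succ n ih =>
      intro a
      simp only [pathLaw_succ]
      refine (ih _).mul ?_
      exact (measurable_stepLaw_apply _ _).comp
        ((measurable_pi_apply _).comp (measurable_pi_apply n))
  have key' : ∀ (n : ℕ) (T : Set ((i : Finset.Iic n) → Site d)),
      Measurable fun q => (pathLaw x q).map (Preorder.frestrictLe n) T := by
    intro n T
    have h : ∀ q, (pathLaw x q).map (Preorder.frestrictLe n) T =
        ∑' a : T, (pathLaw x q).map (Preorder.frestrictLe n) {(a : (i : Finset.Iic n) → Site d)} :=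
      fun q => by
        rw [← measure_biUnion (Set.to_countable T) (fun a _ b _ hab => by simpa using hab)
          (fun a _ => measurableSet_singleton a), Set.biUnion_of_singleton]
    simp only [h]
    exact Measurable.tsum fun a => key n a
  refine Measurable.measure_of_isPiSystem_of_isProbabilityMeasure
    (S := measurableCylinders fun _ : ℕ => Site d)
    generateFrom_measurableCylinders.symm isPiSystem_measurableCylinders ?_
  intro s hs
  obtain ⟨I, S, hS, rfl⟩ := (mem_measurableCylinders s).1 hs
  have hI : I ⊆ Finset.Iic (I.sup id) := fun i hi => Finset.mem_Iic.2 (Finset.le_sup (f := id) hi)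
  convert key' (I.sup id) (Finset.restrict₂ (π := fun _ => Site d) hI ⁻¹' S) using 2 with q
  rw [Measure.map_apply (by fun_prop) (hS.preimage (by fun_prop))]
  rfl

/-- The quenched law `P_ω^x` of the random walk in the environment `ω`. -/
noncomputable def quenched {d : ℕ} (x : Site d) : Kernel (Env d) (WalkPath d) where
  toFun ω := pathLaw x fun _ => ω
  measurable' := (measurable_pathLaw x).comp (measurable_pi_lambda _ fun _ => measurable_id)

instance {d : ℕ} (x : Site d) : IsMarkovKernel (quenched x) :=
  ⟨fun ω => inferInstanceAs (IsProbabilityMeasure (pathLaw x fun _ => ω))⟩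

/-- The joint law `P ⊗ P_ω^o` of the environment and of the walk started at the origin. -/
noncomputable def annealed {d : ℕ} (P : Measure (Env d)) : Measure (Env d × WalkPath d) :=
  P ⊗ₘ quenched 0

/-! ### The walk with coins -/

/-- A family of coins: `ε (i, x)` tells whether the coin with index `(i, x)` shows `1`. -/
abbrev Coins (d : ℕ) := ℕ × Site d → Bool

lemma EllipticityConst.mul_mem {d : ℕ} [NeZero d] (κ : EllipticityConst d) :
    (d * κ : ℝ) ∈ Set.Ioo (0 : ℝ) 1 := by
  have hd : (0 : ℝ) < d := Nat.cast_pos.2 (NeZero.pos d)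
  refine ⟨mul_pos hd κ.2.1, ?_⟩
  have h := mul_lt_mul_of_pos_left κ.2.2 hd
  have h2 : (d : ℝ) * (1 / (2 * d)) = 1 / 2 := by field_simp
  linarith

/-- The law `Q` of i.i.d. coins that show `1` with probability `dκ`. -/
noncomputable def coinLaw {d : ℕ} [NeZero d] (κ : EllipticityConst d) : Measure (Coins d) :=
  Measure.infinitePi fun _ =>
    bernoulliMeasure true false ⟨d * κ, Set.Ioo_subset_Icc_self κ.mul_mem⟩

instance {d : ℕ} [NeZero d] (κ : EllipticityConst d) : IsProbabilityMeasure (coinLaw κ) := by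
  unfold coinLaw; infer_instance

open Classical in
/-- The jump law `(p - κ/2) / (1 - dκ)` of the walk at a site where the coin shows `0`. If
`p e < κ/2` for some `e`, which has probability zero in a uniformly elliptic environment, it is
`p` by convention. -/
noncomputable def residualLaw {d : ℕ} [NeZero d] (κ : EllipticityConst d) (p : SiteLaw d) :
    SiteLaw d :=
  if h : ∀ e, (κ : ℝ) / 2 ≤ p e then
    ⟨fun e => (p e - κ / 2) / (1 - d * κ),
      fun e => div_nonneg (sub_nonneg.2 (h e)) (sub_nonneg.2 κ.mul_mem.2.le), by
        have h1 : (1 - d * κ : ℝ) ≠ 0 := (sub_pos.2 κ.mul_mem.2).ne'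
        have h2 : ∑ e, p e = 1 := p.2.2
        rw [← Finset.sum_div, Finset.sum_sub_distrib, h2, div_eq_one_iff_eq h1]
        simp [Finset.card_univ]
        ring⟩
  else p

/-- The time-dependent environment seen by the walk with coins: at time `n` and site `z` the jump
is uniform if `ε (n, z) = 1`, and has the residual law otherwise. -/
noncomputable def coinEnv {d : ℕ} [NeZero d] (κ : EllipticityConst d) (w : Env d × Coins d) :
    ℕ → Env d :=
  fun n z => if w.2 (n, z) = true then uniformLaw d else residualLaw κ (w.1 z)

lemma measurable_residualLaw {d : ℕ} [NeZero d] (κ : EllipticityConst d) :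
    Measurable (residualLaw κ) := by
  have he : ∀ e : Dir d, Measurable fun p : SiteLaw d => p e :=
    fun e => (measurable_pi_apply e).comp measurable_subtype_coe
  have hs : MeasurableSet {p : SiteLaw d | ∀ e, (κ : ℝ) / 2 ≤ p e} := by
    rw [Set.ofPred_forall]
    exact MeasurableSet.iInter fun e => measurableSet_le measurable_const (he e)
  refine Measurable.subtype_mk (f := fun p => (residualLaw κ p : Dir d → ℝ))
    (measurable_pi_lambda _ fun e => ?_) (h := fun p => (residualLaw κ p).2)
  have h : (fun p : SiteLaw d => (residualLaw κ p : Dir d → ℝ) e) =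
      fun p => if p ∈ {p : SiteLaw d | ∀ e, (κ : ℝ) / 2 ≤ p e} then
        (p e - κ / 2) / (1 - d * κ) else p e := by
    funext p
    by_cases hp : ∀ e, (κ : ℝ) / 2 ≤ p e
    · rw [residualLaw, dif_pos hp, if_pos (Set.mem_ofPred.2 hp)]
      rfl
    · rw [residualLaw, dif_neg hp, if_neg (fun h => hp (Set.mem_ofPred.1 h))]
  rw [h]
  exact Measurable.ite hs (((he e).sub_const _).div_const _) (he e)

lemma measurable_coinEnv {d : ℕ} [NeZero d] (κ : EllipticityConst d) :
    Measurable (coinEnv κ) := by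
  refine measurable_pi_lambda _ fun n => measurable_pi_lambda _ fun z => ?_
  refine Measurable.ite ?_ measurable_const ?_
  · have h : Measurable fun w : Env d × Coins d => w.2 (n, z) :=
      (measurable_pi_apply (n, z)).comp measurable_snd
    exact h (measurableSet_singleton true)
  · exact (measurable_residualLaw κ).comp ((measurable_pi_apply z).comp measurable_fst)

/-- The law `P_{ω,ε}^x` of the walk with coins. -/
noncomputable def coinQuenched {d : ℕ} [NeZero d] (κ : EllipticityConst d) (x : Site d) :
    Kernel (Env d × Coins d) (WalkPath d) where
  toFun w := pathLaw x (coinEnv κ w)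
  measurable' := (measurable_pathLaw x).comp (measurable_coinEnv κ)

instance {d : ℕ} [NeZero d] (κ : EllipticityConst d) (x : Site d) :
    IsMarkovKernel (coinQuenched κ x) :=
  ⟨fun w => inferInstanceAs (IsProbabilityMeasure (pathLaw x (coinEnv κ w)))⟩

/-- The joint law `P ⊗ Q ⊗ P_{ω,ε}^o` of the environment, the coins and the walk. -/
noncomputable def tripleLaw {d : ℕ} [NeZero d] (P : Measure (Env d)) (κ : EllipticityConst d) :
    Measure ((Env d × Coins d) × WalkPath d) :=
  (P.prod (coinLaw κ)) ⊗ₘ coinQuenched κ 0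

/-! ### Escape events and regeneration times in the direction `e_1` -/

/-- The scalar product of a site with the first basis vector `e_1`. -/
def level {d : ℕ} [NeZero d] (x : Site d) : ℤ := x 0

/-- The event that `X_n · e_1` tends to `∞`. -/
def escapesUp (d : ℕ) [NeZero d] : Set (WalkPath d) :=
  {X | Tendsto (fun n => level (X n)) atTop atTop}

/-- The event that `X_n · (-e_1)` tends to `∞`. -/
def escapesDown (d : ℕ) [NeZero d] : Set (WalkPath d) :=
  {X | Tendsto (fun n => -level (X n)) atTop atTop}

/-- The path after time `n`. -/
def shiftPath {d : ℕ} (n : ℕ) (X : WalkPath d) : WalkPath d := fun i => X (n + i)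

/-- The infimum in `ℕ ∪ {∞}` of the set of times with a given property. -/
noncomputable def firstTime (p : ℕ → Prop) : ℕ∞ := ⨅ (n : ℕ) (_ : p n), (n : ℕ∞)

/-- The first time `D ≥ 1` at which the walk is not above its initial level. -/
noncomputable def backtrackTime {d : ℕ} [NeZero d] (X : WalkPath d) : ℕ∞ :=
  firstTime fun n => 1 ≤ n ∧ level (X n) ≤ level (X 0)

/-- The first time at which, for some `j ≥ 0`, the walk has visited the `j`-th level above its
initial level more than `c (j + 1) ^ 2` times. -/
noncomputable def crowdTime {d : ℕ} [NeZero d] (c : ℝ) (X : WalkPath d) : ℕ∞ :=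
  firstTime fun n => ∃ j : ℕ,
    c * ((j : ℝ) + 1) ^ 2 <
      (((Finset.range (n + 1)).filter fun i => level (X i) = level (X 0) + j).card : ℝ)

/-- The stopping time `R`. -/
noncomputable def stopR {d : ℕ} [NeZero d] (c : ℝ) (X : WalkPath d) : ℕ∞ :=
  min (crowdTime c X) (backtrackTime X)

/-- At time `n - L` the walk is above all its previous levels, and its next `L` steps, which lead
to time `n`, are all equal to `e_1` and taken with coins that show `1`. -/
def IsFreshRun {d : ℕ} [NeZero d] (L : ℕ) (ε : Coins d) (X : WalkPath d) (n : ℕ) : Prop :=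
  L ≤ n ∧ (∀ m, m < n - L → level (X m) < level (X (n - L))) ∧
    ∀ i, 1 ≤ i → i ≤ L →
      ε (n - i, X (n - i)) = true ∧ X (n - i + 1) - X (n - i) = Pi.single 0 1

/-- The first time `n ≥ ρ` that ends a fresh run: this is `S_{k+1}` if `ρ = R_k`. -/
noncomputable def nextS {d : ℕ} [NeZero d] (L : ℕ) (ε : Coins d) (X : WalkPath d) (ρ : ℕ∞) : ℕ∞ :=
  firstTime fun n => ρ ≤ n ∧ IsFreshRun L ε X n

/-- The times `R_k`: `R_0 = 0` and `R_{k+1} = S_{k+1} + R ∘ θ_{S_{k+1}}`, which is `∞` if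
`S_{k+1} = ∞`. -/
noncomputable def timeR {d : ℕ} [NeZero d] (c : ℝ) (L : ℕ) (ε : Coins d) (X : WalkPath d) : ℕ → ℕ∞
  | 0 => 0
  | k + 1 =>
    nextS L ε X (timeR c L ε X k) +
      stopR c (shiftPath (nextS L ε X (timeR c L ε X k)).toNat X)

/-- The times `S_k`, `k ≥ 1`, with the index shifted by one: `timeS c L ε X k` is `S_{k+1}`. -/
noncomputable def timeS {d : ℕ} [NeZero d] (c : ℝ) (L : ℕ) (ε : Coins d) (X : WalkPath d) (k : ℕ) :
    ℕ∞ :=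
  nextS L ε X (timeR c L ε X k)

open Classical in
/-- The first regeneration time `τ_1 = S_K`, where `K` is the least `k ≥ 1` with `S_k < ∞` and
`R_k = ∞`; it is `∞` if there is no such `k`. -/
noncomputable def regenTime {d : ℕ} [NeZero d] (c : ℝ) (L : ℕ) (ε : Coins d) (X : WalkPath d) : ℕ∞ :=
  if h : ∃ k : ℕ, timeS c L ε X k < ⊤ ∧ timeR c L ε X (k + 1) = ⊤ then
    timeS c L ε X (Nat.find h)
  else ⊤

/-- The law `P ⊗ Q ⊗ P_{ω,ε}^o` conditioned on the event `{R = ∞}`. -/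
noncomputable def regenLaw {d : ℕ} [NeZero d] (P : Measure (Env d)) (κ : EllipticityConst d)
    (c : ℝ) : Measure ((Env d × Coins d) × WalkPath d) :=
  ProbabilityTheory.cond (tripleLaw P κ) {w | stopR c w.2 = ⊤}

end RWRE

open RWRE

set_option linter.unusedSectionVars false

/-! A step of the walk together with its coin is a letter, and the process becomes a random sequence
of letters. Integrating out the coins, a letter at a site with law p has weight κ/2 if it is marked
and p(e) − κ/2 otherwise, so marked letters ignore the environment (`letterLaw_cyl`). The mixing
condition turns into a statement about words: if the past stays below a level, and the future starts
l levels above it and is observed only before R, the two are independent up to a factor D(l) → 1.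
The bound c(j+1)² on visits to the j-th level is summable against the exponential decay of the
correlations, so D does not depend on the length of the future (`MixesWith.exists_decoupling`,
`isMixingWalk_of_cyl`). From there on only the notion `IsMixingWalk` is used, and the direction −e₁
follows from it by reflection.

Suppose R = ∞ has positive probability for some c. After a record followed by L marked steps e₁, the
future on R = ∞ is almost independent of the past (`fresh_mixing`). Each attempt then succeeds with
probability bounded below, so a walk that is unbounded above regenerates and tends to ∞; by
ellipticity any other walk tends to −∞. Conditioned on R = ∞, both the time increments and the level
increments between regenerations are independent and identically distributed up to a factor D(L)²
(`regen_mixing`, `isAlmostIID`). A renewal argument bounds the mean level gain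
(`lintegral_gain_lt_top`). A strong law by stochastic domination (`ae_eventually_sum_le`) confines
the speed between w_L/D(L)⁴ and w_L D(L)⁴, where w_L is mean gain over mean time. Letting L → ∞
yields a deterministic v (`exists_speed`). If v > 0, then w_L > 0, so the mean regeneration time is
finite.

Suppose instead that R < ∞ almost surely for every c. If the level M were reached within time AM,
then most levels would be neither crowded nor slow to leave, and by pigeonhole a long stretch
without violation would start just above each of them (`many_longStretch`). The scales of these
stretches are chosen successively so that such a stretch has conditional probability at most 1/8;
having half of all levels of this kind is then exponentially unlikely
(`measure_many_longStretch_le`). Borel–Cantelli shows that there is no positive speed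
(`ae_eventually_height_le_div`).

Hence a positive speed in direction e₁ forces R = ∞ with positive probability for some c. The speeds
obtained for different c agree, since they are limits along the same paths (`exists_velocity`). -/

namespace RWRE

/-! ### Sequences over a countable alphabet: cylinders and comparison of measures -/

section Sequences

variable {S : Type*}

/-- The set of sequences that agree with `ξ` up to time `n`. -/
def cyl (n : ℕ) (ξ : ℕ → S) : Set (ℕ → S) := {η | ∀ i < n, η i = ξ i}

/-- The sequence after time `n`. -/
def shiftSeq (n : ℕ) (ξ : ℕ → S) : ℕ → S := fun i => ξ (n + i)

/-- The set `A` depends on the first `n` letters only. -/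
def Determined (n : ℕ) (A : Set (ℕ → S)) : Prop := ∀ ξ ∈ A, cyl n ξ ⊆ A

/-- The sequence that follows `ξ` up to time `n` and then `η`. -/
def glue (n : ℕ) (ξ η : ℕ → S) : ℕ → S := fun i => if i < n then ξ i else η (i - n)

lemma mem_cyl_self (n : ℕ) (ξ : ℕ → S) : ξ ∈ cyl n ξ := fun _ _ => rfl

lemma cyl_anti {m n : ℕ} (h : m ≤ n) (ξ : ℕ → S) : cyl n ξ ⊆ cyl m ξ :=
  fun _ hη i hi => hη i (hi.trans_le h)

lemma cyl_eq_of_mem {m n : ℕ} (h : m ≤ n) {ξ η : ℕ → S} (hη : η ∈ cyl n ξ) :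
    cyl m η = cyl m ξ := by
  ext ζ
  exact ⟨fun hζ i hi => (hζ i hi).trans (hη i (hi.trans_le h)),
    fun hζ i hi => (hζ i hi).trans (hη i (hi.trans_le h)).symm⟩

lemma mem_cyl_symm {n : ℕ} {ξ η : ℕ → S} (h : η ∈ cyl n ξ) : ξ ∈ cyl n η :=
  fun i hi => (h i hi).symm

lemma Determined.mono {m n : ℕ} (h : m ≤ n) {A : Set (ℕ → S)} (hA : Determined m A) :
    Determined n A := fun ξ hξ => (cyl_anti h ξ).trans (hA ξ hξ)

lemma Determined.inter {n : ℕ} {A B : Set (ℕ → S)} (hA : Determined n A) (hB : Determined n B) :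
    Determined n (A ∩ B) := fun ξ hξ _ hη => ⟨hA ξ hξ.1 hη, hB ξ hξ.2 hη⟩

lemma determined_cyl (n : ℕ) (ξ : ℕ → S) : Determined n (cyl n ξ) := fun _ hη =>
  (cyl_eq_of_mem le_rfl hη).subset

lemma shiftSeq_mem_cyl {n m : ℕ} {ξ η : ℕ → S} (h : η ∈ cyl (n + m) ξ) :
    shiftSeq n η ∈ cyl m (shiftSeq n ξ) := fun i hi => h (n + i) (by omega)

@[simp] lemma shiftSeq_zero (ξ : ℕ → S) : shiftSeq 0 ξ = ξ := by
  funext i; simp [shiftSeq]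

lemma shiftSeq_shiftSeq (n m : ℕ) (ξ : ℕ → S) :
    shiftSeq m (shiftSeq n ξ) = shiftSeq (n + m) ξ := by
  funext i; simp [shiftSeq, add_assoc]

lemma glue_mem_cyl (n : ℕ) (ξ η : ℕ → S) : glue n ξ η ∈ cyl n ξ := fun i hi => by simp [glue, hi]

@[simp] lemma shiftSeq_glue (n : ℕ) (ξ η : ℕ → S) : shiftSeq n (glue n ξ η) = η := by
  funext i; simp [glue, shiftSeq]

lemma cyl_glue (n m : ℕ) (ξ η : ℕ → S) :
    cyl (n + m) (glue n ξ η) = cyl n ξ ∩ shiftSeq n ⁻¹' cyl m η := by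
  ext ζ
  constructor
  · intro h
    refine ⟨fun i hi => ?_, fun i hi => ?_⟩
    · rw [h i (by omega), glue_mem_cyl n ξ η i hi]
    · have := h (n + i) (by omega)
      simp only [glue] at this
      rw [if_neg (by omega), Nat.add_sub_cancel_left] at this
      exact this
  · rintro ⟨h1, h2⟩ i hi
    by_cases hin : i < n
    · rw [h1 i hin, glue_mem_cyl n ξ η i hin]
    · have h3 := h2 (i - n) (by omega)
      simp only [shiftSeq] at h3
      rw [Nat.add_sub_cancel' (by omega)] at h3
      rw [h3]; simp [glue, hin]

variable [Countable S] [MeasurableSpace S] [MeasurableSingletonClass S]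

lemma measurable_shiftSeq (n : ℕ) : Measurable (shiftSeq n : (ℕ → S) → ℕ → S) :=
  measurable_pi_lambda _ fun _ => measurable_pi_apply _

/-- The first `n` letters. -/
def firstLetters (n : ℕ) (ξ : ℕ → S) : Fin n → S := fun i => ξ i

lemma measurable_firstLetters (n : ℕ) : Measurable (firstLetters n : (ℕ → S) → Fin n → S) :=
  measurable_pi_lambda _ fun _ => measurable_pi_apply _

lemma firstLetters_eq_iff {n : ℕ} {ξ η : ℕ → S} :
    firstLetters n η = firstLetters n ξ ↔ η ∈ cyl n ξ :=
  ⟨fun h i hi => congrFun h ⟨i, hi⟩, fun h => funext fun i => h i i.2⟩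

lemma Determined.measurableSet {n : ℕ} {A : Set (ℕ → S)} (hA : Determined n A) :
    MeasurableSet A := by
  have : A = firstLetters n ⁻¹' (firstLetters n '' A) := by
    refine (Set.subset_preimage_image _ _).antisymm ?_
    rintro η ⟨ξ, hξ, h⟩
    exact hA ξ hξ (firstLetters_eq_iff.1 h.symm)
  rw [this]
  exact measurable_firstLetters n (Set.to_countable _).measurableSet

lemma measurableSet_cyl (n : ℕ) (ξ : ℕ → S) : MeasurableSet (cyl n ξ) :=
  (determined_cyl n ξ).measurableSet

/-- Comparison of two measures on a set that is a union of cylinders whose lengths are given by a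
stopping rule. -/
lemma measure_le_of_stopping {μ ν : Measure (ℕ → S)} {A : Set (ℕ → S)} (σ : (ℕ → S) → ℕ)
    (hA : ∀ ξ ∈ A, ∀ η ∈ cyl (σ ξ) ξ, η ∈ A ∧ σ η = σ ξ)
    (h : ∀ ξ ∈ A, μ (cyl (σ ξ) ξ) ≤ ν (cyl (σ ξ) ξ)) : μ A ≤ ν A := by
  set C : Set (Set (ℕ → S)) := (fun ξ => cyl (σ ξ) ξ) '' A with hC
  have hcount : C.Countable := by
    refine Set.Countable.mono (s₂ := Set.range fun p : (n : ℕ) × (Fin n → S) =>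
      firstLetters p.1 ⁻¹' {p.2}) ?_ (Set.countable_range _)
    rintro _ ⟨ξ, _, rfl⟩
    refine ⟨⟨σ ξ, firstLetters (σ ξ) ξ⟩, ?_⟩
    ext η
    exact firstLetters_eq_iff
  have hU : A = ⋃₀ C := by
    ext ξ
    constructor
    · intro hξ
      exact ⟨_, ⟨ξ, hξ, rfl⟩, mem_cyl_self _ _⟩
    · rintro ⟨_, ⟨η, hη, rfl⟩, hξ⟩
      exact (hA η hη ξ hξ).1
  -- Two stopping cylinders with a common point have the same length, namely the stopping rule at
  -- that point, and so coincide.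
  have hdisj : C.PairwiseDisjoint id := by
    rintro _ ⟨ξ, hξ, rfl⟩ _ ⟨η, hη, rfl⟩ hne
    refine Set.disjoint_left.2 fun ζ h1 h2 => hne ?_
    have e1 := (hA ξ hξ ζ h1).2
    have e2 := (hA η hη ζ h2).2
    change cyl (σ ξ) ξ = cyl (σ η) η
    rw [← cyl_eq_of_mem le_rfl h1, ← cyl_eq_of_mem le_rfl h2, ← e1, ← e2]
  have hmeas : ∀ c ∈ C, MeasurableSet c := by
    rintro _ ⟨ξ, _, rfl⟩
    exact measurableSet_cyl _ _
  rw [hU, measure_sUnion hcount hdisj hmeas, measure_sUnion hcount hdisj hmeas]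
  refine ENNReal.tsum_le_tsum ?_
  rintro ⟨_, ξ, hξ, rfl⟩
  exact h ξ hξ

lemma measure_le_of_determined {μ ν : Measure (ℕ → S)} {A : Set (ℕ → S)} {n : ℕ}
    (hA : Determined n A) (h : ∀ ξ ∈ A, μ (cyl n ξ) ≤ ν (cyl n ξ)) : μ A ≤ ν A :=
  measure_le_of_stopping (fun _ => n) (fun ξ hξ _ hη => ⟨hA ξ hξ hη, rfl⟩) h

/-- For the product of discrete topologies an open set is a union of stopping cylinders: stop at the
shortest cylinder contained in it. Outer regularity of the finite measure ν then passes from open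
sets to all sets. -/
lemma measure_le_of_cyl {μ ν : Measure (ℕ → S)} [IsFiniteMeasure ν]
    (h : ∀ n ξ, μ (cyl n ξ) ≤ ν (cyl n ξ)) : μ ≤ ν := by
  classical
  let _ : TopologicalSpace S := ⊥
  have : DiscreteTopology S := ⟨rfl⟩
  have : BorelSpace S := ⟨by
    rw [borel_eq_top_of_discrete]
    refine top_unique fun s _ => (Set.to_countable s).measurableSet⟩
  have hopen : ∀ U : Set (ℕ → S), IsOpen U → μ U ≤ ν U := by
    intro U hU
    have hex : ∀ ξ ∈ U, ∃ n, cyl n ξ ⊆ U := by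
      intro ξ hξ
      obtain ⟨I, u, hI, hu⟩ := isOpen_pi_iff.1 hU ξ hξ
      refine ⟨I.sup id + 1, fun η hη => hu fun i hi => ?_⟩
      rw [hη i (Nat.lt_succ_of_le (Finset.le_sup (f := id) hi))]
      exact (hI i hi).2
    refine measure_le_of_stopping (A := U)
      (fun ξ => if h : ∃ n, cyl n ξ ⊆ U then Nat.find h else 0) (fun ξ hξ η hη => ?_)
      fun ξ _ => h _ _
    rw [dif_pos (hex ξ hξ)] at hη
    have hηU : η ∈ U := Nat.find_spec (hex ξ hξ) hη
    refine ⟨hηU, ?_⟩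
    rw [dif_pos (hex ξ hξ), dif_pos (hex η hηU), Nat.find_eq_iff]
    refine ⟨?_, fun m hm => ?_⟩
    · rw [cyl_eq_of_mem le_rfl hη]; exact Nat.find_spec (hex ξ hξ)
    · rw [cyl_eq_of_mem hm.le hη]; exact Nat.find_min (hex ξ hξ) hm
  refine Measure.le_iff.2 fun B _ => ?_
  rw [Set.measure_eq_iInf_isOpen B ν]
  refine le_iInf₂ fun U hBU => le_iInf fun hU => (measure_mono hBU).trans (hopen U hU)

lemma lintegral_eq_of_cyl {μ ν : Measure (ℕ → S)} {n : ℕ} {a : ℝ≥0∞}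
    (h : ∀ ξ, μ (cyl n ξ) = a * ν (cyl n ξ)) {f : (ℕ → S) → ℝ≥0∞}
    (hf : ∀ ξ, ∀ η ∈ cyl n ξ, f η = f ξ) : ∫⁻ ξ, f ξ ∂μ = a * ∫⁻ ξ, f ξ ∂ν := by
  rcases isEmpty_or_nonempty (ℕ → S) with hE | ⟨⟨ξ₀⟩⟩
  · simp [lintegral_of_isEmpty]
  set g : (Fin n → S) → ℝ≥0∞ := fun v => f fun i => if hi : i < n then v ⟨i, hi⟩ else ξ₀ i
  have hg : f = g ∘ firstLetters n := by
    funext ξ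
    exact (hf ξ _ fun i hi => by simp [firstLetters, hi]).symm
  have hgm : Measurable g := measurable_from_top.mono (fun s _ => (Set.to_countable s).measurableSet)
    le_rfl
  have hmap : μ.map (firstLetters n) = a • ν.map (firstLetters n) := by
    refine Measure.ext_of_singleton fun v => ?_
    have hv : firstLetters n ⁻¹' {v} =
        cyl n fun i => if hi : i < n then v ⟨i, hi⟩ else ξ₀ i := by
      ext ξ
      rw [← firstLetters_eq_iff]
      have : firstLetters n (fun i => if hi : i < n then v ⟨i, hi⟩ else ξ₀ i) = v := by
        funext i; simp [firstLetters]
      rw [this]; rfl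
    rw [Measure.smul_apply, Measure.map_apply (measurable_firstLetters n) (measurableSet_singleton _),
      Measure.map_apply (measurable_firstLetters n) (measurableSet_singleton _), hv, h, smul_eq_mul]
  rw [hg]
  simp only [Function.comp]
  rw [← lintegral_map hgm (measurable_firstLetters n), hmap, lintegral_smul_measure,
    lintegral_map hgm (measurable_firstLetters n), smul_eq_mul]

end Sequences

end RWRE

namespace RWRE

/-! ### First times -/

lemma le_firstTime_iff {p : ℕ → Prop} {n : ℕ} : (n : ℕ∞) ≤ firstTime p ↔ ∀ m < n, ¬ p m := by
  simp only [firstTime, le_iInf_iff, Nat.cast_le]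
  exact ⟨fun h m hm hp => absurd (h m hp) (by omega), fun h m hp => by
    by_contra hlt
    exact h m (by omega) hp⟩

lemma firstTime_le_iff {p : ℕ → Prop} {n : ℕ} : firstTime p ≤ n ↔ ∃ m ≤ n, p m := by
  rw [← not_lt]
  have : ((n : ℕ∞) < firstTime p) ↔ ((n + 1 : ℕ) : ℕ∞) ≤ firstTime p := by
    push_cast
    exact (ENat.add_one_le_iff (ENat.natCast_ne_top n)).symm
  rw [this, le_firstTime_iff]
  push Not
  exact ⟨fun ⟨m, h1, h2⟩ => ⟨m, by omega, h2⟩, fun ⟨m, h1, h2⟩ => ⟨m, by omega, h2⟩⟩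

lemma firstTime_eq_top_iff {p : ℕ → Prop} : firstTime p = ⊤ ↔ ∀ n, ¬ p n := by
  simp only [firstTime, iInf_eq_top, ENat.natCast_ne_top]

lemma firstTime_eq_coe_iff {p : ℕ → Prop} {n : ℕ} :
    firstTime p = n ↔ p n ∧ ∀ m < n, ¬ p m := by
  constructor
  · intro h
    have h1 := le_firstTime_iff.1 h.ge
    obtain ⟨m, hm, hp⟩ := firstTime_le_iff.1 h.le
    have : m = n := by
      by_contra hne
      exact h1 m (by omega) hp
    exact ⟨this ▸ hp, h1⟩
  · rintro ⟨h1, h2⟩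
    exact le_antisymm (firstTime_le_iff.2 ⟨n, le_rfl, h1⟩) (le_firstTime_iff.2 h2)

lemma firstTime_congr {p p' : ℕ → Prop} (h : ∀ n, p n ↔ p' n) : firstTime p = firstTime p' := by
  have : p = p' := funext fun n => propext (h n)
  rw [this]

lemma min_firstTime (p p' : ℕ → Prop) :
    min (firstTime p) (firstTime p') = firstTime fun n => p n ∨ p' n := by
  refine eq_of_forall_le_iff fun a => ?_
  induction a using ENat.recTopCoe with
  | top => simp only [top_le_iff, min_eq_top, firstTime_eq_top_iff, not_or, forall_and]
  | coe n => simp only [le_min_iff, le_firstTime_iff, not_or, forall_and]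

/-! ### Letters -/

/-- A step of the walk together with the coin that is used for it. -/
structure Letter (d : ℕ) where
  /-- the direction of the step -/
  dir : Dir d
  /-- the coin -/
  mark : Bool

/-- Letters are pairs. -/
def Letter.equiv (d : ℕ) : Letter d ≃ Dir d × Bool where
  toFun a := (a.dir, a.mark)
  invFun p := ⟨p.1, p.2⟩
  left_inv _ := rfl
  right_inv _ := rfl

instance (d : ℕ) : Finite (Letter d) := Finite.of_equiv _ (Letter.equiv d).symm
noncomputable instance (d : ℕ) : Fintype (Letter d) := Fintype.ofFinite _
instance (d : ℕ) : MeasurableSpace (Letter d) := ⊤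
instance (d : ℕ) : DiscreteMeasurableSpace (Letter d) := ⟨fun _ => trivial⟩

/-! ### Paths and heights of letter sequences -/

section Walk

variable {d : ℕ} [NeZero d]

/-- The marked step `e_1`. -/
def upLetter (d : ℕ) [NeZero d] : Letter d := ⟨(0, 1), true⟩

/-- The walk with given steps that starts at the origin. -/
def path (ξ : ℕ → Letter d) : WalkPath d := fun n => ∑ i ∈ Finset.range n, (ξ i).dir.vec

/-- The coins given by the marks of the letters. -/
def coins (ξ : ℕ → Letter d) : Coins d := fun p => (ξ p.1).mark

/-- The level of the walk. -/
def height (ξ : ℕ → Letter d) (n : ℕ) : ℤ := level (path ξ n)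

@[simp] lemma path_zero (ξ : ℕ → Letter d) : path ξ 0 = 0 := by simp [path]

lemma path_succ (ξ : ℕ → Letter d) (n : ℕ) : path ξ (n + 1) = path ξ n + (ξ n).dir.vec := by
  simp [path, Finset.sum_range_succ]

lemma path_add (ξ : ℕ → Letter d) (n i : ℕ) :
    path ξ (n + i) = path ξ n + path (shiftSeq n ξ) i := by
  simp [path, Finset.sum_range_add, shiftSeq]

lemma path_congr {n : ℕ} {ξ η : ℕ → Letter d} (h : η ∈ cyl n ξ) {i : ℕ} (hi : i ≤ n) :
    path η i = path ξ i :=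
  Finset.sum_congr rfl fun j hj => by rw [h j ((Finset.mem_range.1 hj).trans_le hi)]

@[simp] lemma height_zero (ξ : ℕ → Letter d) : height ξ 0 = 0 := by simp [height, level]

lemma height_succ (ξ : ℕ → Letter d) (n : ℕ) :
    height ξ (n + 1) = height ξ n + level (ξ n).dir.vec := by
  simp [height, path_succ, level]

lemma height_shift (ξ : ℕ → Letter d) (n i : ℕ) :
    height (shiftSeq n ξ) i = height ξ (n + i) - height ξ n := by
  simp [height, path_add, level]

lemma height_congr {n : ℕ} {ξ η : ℕ → Letter d} (h : η ∈ cyl n ξ) {i : ℕ} (hi : i ≤ n) :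
    height η i = height ξ i := by rw [height, path_congr h hi, height]

lemma level_vec_abs_le (e : Dir d) : |level e.vec| ≤ 1 := by
  obtain ⟨i, s⟩ := e
  simp only [level, Dir.vec]
  by_cases h : i = 0
  · subst h
    rcases Int.units_eq_one_or s with rfl | rfl <;> simp
  · rw [Pi.single_eq_of_ne (Ne.symm h)]; simp

lemma level_upLetter : level (upLetter d).dir.vec = 1 := by
  simp [level, Dir.vec, upLetter]

lemma height_succ_le (ξ : ℕ → Letter d) (n : ℕ) : height ξ (n + 1) ≤ height ξ n + 1 := by
  rw [height_succ]; linarith [(abs_le.1 (level_vec_abs_le (ξ n).dir)).2]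

lemma height_add_le (ξ : ℕ → Letter d) (n i : ℕ) : height ξ (n + i) ≤ height ξ n + i := by
  induction i with
  | zero => simp
  | succ i ih => rw [← add_assoc]; push_cast; linarith [height_succ_le ξ (n + i)]

lemma height_le (ξ : ℕ → Letter d) (n : ℕ) : height ξ n ≤ n := by
  simpa using height_add_le ξ 0 n

lemma height_run {ξ : ℕ → Letter d} {n L : ℕ} (h : ∀ i < L, ξ (n + i) = upLetter d) {i : ℕ}
    (hi : i ≤ L) : height ξ (n + i) = height ξ n + i := by
  induction i with
  | zero => simp
  | succ i ih =>
    rw [← add_assoc, height_succ, ih (by omega), h i (by omega), level_upLetter]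
    push_cast; ring

/-- Between two times, every intermediate level is visited on the way up. -/
lemma exists_height_eq {ξ : ℕ → Letter d} {a b : ℕ} (hab : a ≤ b) {l : ℤ} (ha : height ξ a ≤ l)
    (hb : l ≤ height ξ b) : ∃ i, a ≤ i ∧ i ≤ b ∧ height ξ i = l := by
  induction b, hab using Nat.le_induction with
  | base => exact ⟨a, le_rfl, le_rfl, le_antisymm ha hb⟩
  | succ b hab ih =>
    by_cases h : l ≤ height ξ b
    · obtain ⟨i, h1, h2, h3⟩ := ih h
      exact ⟨i, h1, by omega, h3⟩
    · exact ⟨b + 1, by omega, le_rfl, by have := height_succ_le ξ b; omega⟩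

/-! ### The stopping time `R` -/

/-- The stopping time `R` for the walk with given letters. -/
noncomputable def stopTime (c : ℝ) (ξ : ℕ → Letter d) : ℕ∞ := stopR c (path ξ)

/-- The time `k` is a violation: some level is crowded or the walk has come back. -/
def Violation (c : ℝ) (ξ : ℕ → Letter d) (k : ℕ) : Prop :=
  (∃ j : ℕ, c * ((j : ℝ) + 1) ^ 2 <
      (((Finset.range (k + 1)).filter fun i => height ξ i = j).card : ℝ)) ∨
    1 ≤ k ∧ height ξ k ≤ 0

lemma stopTime_eq_firstTime (c : ℝ) (ξ : ℕ → Letter d) :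
    stopTime c ξ = firstTime (Violation c ξ) := by
  rw [stopTime, stopR, crowdTime, backtrackTime, min_firstTime]
  refine firstTime_congr fun n => ?_
  have h0 : level (path ξ 0) = 0 := by simp [level]
  simp only [Violation, h0, zero_add, height]
  exact Iff.rfl

lemma stopR_shiftPath (c : ℝ) (ξ : ℕ → Letter d) (n : ℕ) :
    stopR c (shiftPath n (path ξ)) = stopTime c (shiftSeq n ξ) := by
  rw [stopTime_eq_firstTime, stopR, crowdTime, backtrackTime, min_firstTime]
  refine firstTime_congr fun k => ?_
  have h : ∀ i, level (path (shiftSeq n ξ) i) = level (path ξ (n + i)) - level (path ξ n) :=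
    height_shift ξ n
  simp only [Violation, h, shiftPath, add_zero, height, sub_eq_iff_eq_add', sub_nonpos]

lemma violation_congr {c : ℝ} {k : ℕ} {ξ η : ℕ → Letter d} (h : η ∈ cyl k ξ) :
    Violation c η k ↔ Violation c ξ k := by
  have h1 : ∀ i ≤ k, height η i = height ξ i := fun i hi => height_congr h hi
  have h2 : ∀ j : ℕ, ((Finset.range (k + 1)).filter fun i => height η i = j) =
      (Finset.range (k + 1)).filter fun i => height ξ i = j := fun j =>
    Finset.filter_congr fun i hi => by rw [h1 i (by simpa [Nat.lt_succ_iff] using hi)]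
  simp only [Violation, h1 k le_rfl, h2]

lemma le_stopTime_iff {c : ℝ} {n : ℕ} {ξ : ℕ → Letter d} :
    (n : ℕ∞) ≤ stopTime c ξ ↔ ∀ m < n, ¬ Violation c ξ m := by
  rw [stopTime_eq_firstTime, le_firstTime_iff]

lemma stopTime_eq_top_iff {c : ℝ} {ξ : ℕ → Letter d} :
    stopTime c ξ = ⊤ ↔ ∀ m, ¬ Violation c ξ m := by
  rw [stopTime_eq_firstTime, firstTime_eq_top_iff]

lemma determined_le_stopTime (c : ℝ) (n : ℕ) :
    Determined n {ξ : ℕ → Letter d | (n : ℕ∞) ≤ stopTime c ξ} := by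
  intro ξ hξ η hη
  rw [Set.mem_ofPred, le_stopTime_iff] at *
  exact fun m hm => (violation_congr (cyl_anti hm.le _ hη)).not.2 (hξ m hm)

lemma determined_stopTime_eq (c : ℝ) (n : ℕ) :
    Determined n {ξ : ℕ → Letter d | stopTime c ξ = n} := by
  intro ξ hξ η hη
  rw [Set.mem_ofPred, stopTime_eq_firstTime, firstTime_eq_coe_iff] at *
  exact ⟨(violation_congr hη).2 hξ.1,
    fun m hm => (violation_congr (cyl_anti hm.le _ hη)).not.2 (hξ.2 m hm)⟩

/-- The event `R = ∞`. -/
def noStop (c : ℝ) : Set (ℕ → Letter d) := {ξ | stopTime c ξ = ⊤}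

lemma noStop_eq_iInter (c : ℝ) :
    noStop c = ⋂ n : ℕ, {ξ : ℕ → Letter d | (n : ℕ∞) ≤ stopTime c ξ} := by
  ext ξ
  simp only [noStop, Set.mem_ofPred, Set.mem_iInter, stopTime_eq_top_iff, le_stopTime_iff]
  exact ⟨fun h n m _ => h m, fun h m => h (m + 1) m (by omega)⟩

lemma measurableSet_noStop (c : ℝ) : MeasurableSet (noStop c : Set (ℕ → Letter d)) := by
  rw [noStop_eq_iInter]
  exact MeasurableSet.iInter fun n => (determined_le_stopTime c n).measurableSet

/-- Time 0 is already a visit to level 0, and for c < 1 it exceeds the allowance of that level. -/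
lemma one_le_of_stopTime_pos {c : ℝ} {ξ : ℕ → Letter d} (h : 1 ≤ stopTime c ξ) : 1 ≤ c := by
  have h0 := (le_stopTime_iff (n := 1)).1 (by exact_mod_cast h) 0 (by omega)
  by_contra hc
  refine h0 (Or.inl ⟨0, ?_⟩)
  simp only [zero_add, Finset.range_one, Finset.filter_singleton, height_zero]
  simp; linarith

lemma height_pos_of_le_stopTime {c : ℝ} {ξ : ℕ → Letter d} {n i : ℕ} (h : (n : ℕ∞) ≤ stopTime c ξ)
    (hi : i < n) (h1 : 1 ≤ i) : 0 < height ξ i := by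
  by_contra hneg
  exact le_stopTime_iff.1 h i hi (Or.inr ⟨h1, by omega⟩)

/-- If there is no violation before a time at which the walk is at a new maximum, and none after
it for the walk restarted at this time, then there is none at all. -/
lemma stopTime_eq_top_of_record {c : ℝ} {ξ : ℕ → Letter d} {n : ℕ}
    (h1 : (n : ℕ∞) ≤ stopTime c ξ) (h2 : ∀ m < n, height ξ m < height ξ n)
    (h3 : stopTime c (shiftSeq n ξ) = ⊤) : stopTime c ξ = ⊤ := by
  have hc : 1 ≤ c := one_le_of_stopTime_pos (h3 ▸ le_top)
  rw [stopTime_eq_top_iff] at *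
  intro k hk
  rw [le_stopTime_iff] at h1
  rcases lt_or_ge k n with hkn | hkn
  · exact h1 k hkn hk
  obtain ⟨i, rfl⟩ := Nat.exists_eq_add_of_le hkn
  have hmin : ∀ i, height ξ n ≤ height ξ (n + i) := by
    intro i
    rcases Nat.eq_zero_or_pos i with rfl | hi
    · simp
    have := mt Or.inr (h3 i)
    rw [height_shift] at this
    by_contra hlt
    exact this ⟨hi, by omega⟩
  rcases hk with ⟨j, hj⟩ | ⟨hk1, hk2⟩
  · rcases lt_or_ge (j : ℤ) (height ξ n) with hlt | hge
    · -- all visits are before time `n`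
      have hn : 1 ≤ n := by
        by_contra h0
        obtain rfl : n = 0 := by omega
        simp at hlt
        omega
      refine h1 (n - 1) (by omega) (Or.inl ⟨j, hj.trans_le ?_⟩)
      refine Nat.cast_le.2 (Finset.card_le_card fun m hm => ?_)
      rw [Finset.mem_filter, Finset.mem_range] at hm ⊢
      refine ⟨?_, hm.2⟩
      by_contra hmn
      obtain ⟨l, rfl⟩ := Nat.exists_eq_add_of_le (show n ≤ m by omega)
      have := hmin l
      omega
    -- A level at or above the record is visited only from time n on. In the restarted walk its
    -- index j' is at most j, so its allowance is no larger and the violation would persist there.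
    · obtain ⟨j', hj'⟩ := Int.eq_ofNat_of_zero_le (show 0 ≤ (j : ℤ) - height ξ n by omega)
      have hn0 : 0 ≤ height ξ n := by
        rcases Nat.eq_zero_or_pos n with rfl | hn
        · simp
        · have := h2 0 hn
          simp at this; omega
      refine h3 i (Or.inl ⟨j', lt_of_le_of_lt ?_ (hj.trans_le (Nat.cast_le.2 ?_))⟩)
      · have : (j' : ℝ) ≤ j := by
          have : (j' : ℤ) ≤ j := by omega
          exact_mod_cast this
        gcongr
      · refine Finset.card_le_card_of_injOn (fun m => m - n) ?_ ?_
        · intro m hm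
          have hm' := Finset.mem_filter.1 (Finset.mem_coe.1 hm)
          rw [Finset.mem_range] at hm'
          have hmn : n ≤ m := by
            by_contra hlt
            have := h2 m (by omega)
            omega
          refine Finset.mem_coe.2 (Finset.mem_filter.2
            ⟨Finset.mem_range.2 (by change m - n < i + 1; omega), ?_⟩)
          rw [height_shift, Nat.add_sub_cancel' hmn]
          omega
        · intro m hm m' hm' he
          have hge' : ∀ m, m ∈ (Finset.range (n + i + 1)).filter (fun i => height ξ i = j) →
              n ≤ m := by
            intro m hm
            by_contra hlt
            have := h2 m (by omega)
            have := (Finset.mem_filter.1 hm).2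
            omega
          have := hge' m hm
          have := hge' m' hm'
          simp only at he
          omega
  · have := hmin i
    rcases Nat.eq_zero_or_pos n with rfl | hn
    · have := mt Or.inr (h3 i)
      rw [height_shift] at this
      simp at this hk1 hk2
      have := this hk1
      omega
    · have := h2 0 hn
      simp at this
      omega

/-- At a new maximum there is no violation. -/
lemma le_stopTime_succ_of_record {c : ℝ} (hc : 1 ≤ c) {ξ : ℕ → Letter d} {n : ℕ}
    (h1 : (n : ℕ∞) ≤ stopTime c ξ) (h2 : ∀ m < n, height ξ m < height ξ n) :
    ((n + 1 : ℕ) : ℕ∞) ≤ stopTime c ξ := by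
  rw [le_stopTime_iff] at *
  intro m hm hv
  rcases Nat.lt_succ_iff_lt_or_eq.1 hm with hm | rfl
  · exact h1 m hm hv
  rcases hv with ⟨j, hj⟩ | ⟨hk1, hk2⟩
  · have hc' : (1 : ℝ) ≤ c * ((j : ℝ) + 1) ^ 2 := by
      have : (1 : ℝ) ≤ ((j : ℝ) + 1) ^ 2 := one_le_pow₀ (by linarith [(Nat.cast_nonneg j : (0:ℝ) ≤ j)])
      nlinarith
    -- The level of the record has just one visit, which c(j+1)² ≥ 1 allows; every other level has
    -- the same count as at time m − 1.
    by_cases hjm : height ξ m = j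
    · have : ((Finset.range (m + 1)).filter fun i => height ξ i = j) ⊆ {m} := by
        intro i hi
        rw [Finset.mem_filter, Finset.mem_range] at hi
        rw [Finset.mem_singleton]
        by_contra hne
        have := h2 i (by omega)
        omega
      have := Finset.card_le_card this
      have h3 : (((Finset.range (m + 1)).filter fun i => height ξ i = j).card : ℝ) ≤ 1 := by
        exact_mod_cast this
      linarith
    · rcases Nat.eq_zero_or_pos m with rfl | hm0
      · have : ((Finset.range (0 + 1)).filter fun i => height ξ i = j) = ∅ := by
          refine Finset.filter_eq_empty_iff.2 fun i hi => ?_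
          simp at hi
          subst hi
          exact hjm
        rw [this] at hj
        simp at hj
        linarith
      refine h1 (m - 1) (by omega) (Or.inl ⟨j, hj.trans_le (Nat.cast_le.2 (Finset.card_le_card ?_))⟩)
      intro i hi
      rw [Finset.mem_filter, Finset.mem_range] at hi ⊢
      refine ⟨?_, hi.2⟩
      by_contra hne
      obtain rfl : i = m := by omega
      exact hjm hi.2
  · have := h2 0 (by omega)
    simp at this
    omega

/-- Heights are nonnegative and each level receives a bounded number of visits, so only finitely
many times are spent below any given level. -/
lemma tendsto_height_of_noStop {c : ℝ} {ξ : ℕ → Letter d} (h : stopTime c ξ = ⊤) :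
    Tendsto (height ξ) atTop atTop := by
  rw [stopTime_eq_top_iff] at h
  refine tendsto_atTop.2 fun b => ?_
  -- finitely many visits to every level below `b`
  have hpos : ∀ n, 0 ≤ height ξ n := by
    intro n
    rcases Nat.eq_zero_or_pos n with rfl | hn
    · simp
    · by_contra hlt
      exact h n (Or.inr ⟨hn, by omega⟩)
  have hfin : ∀ j : ℕ, {n | height ξ n = j}.Finite := by
    intro j
    by_contra hinf
    obtain ⟨N, hN⟩ := exists_nat_gt (c * ((j : ℝ) + 1) ^ 2)
    obtain ⟨t, ht, htN⟩ := (show {n | height ξ n = j}.Infinite from hinf).exists_subset_card_eq N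
    refine h (t.sup id) (Or.inl ⟨j, hN.trans_le (Nat.cast_le.2 ?_)⟩)
    rw [← htN]
    refine Finset.card_le_card fun i hi => Finset.mem_filter.2 ⟨?_, ht hi⟩
    exact Finset.mem_range.2 (Nat.lt_succ_of_le (Finset.le_sup (f := id) hi))
  have hfin2 : {n | height ξ n < b}.Finite := by
    refine ((Set.finite_Iio b.toNat).biUnion fun j _ => hfin j).subset fun n hn => ?_
    obtain ⟨j, hj⟩ := Int.eq_ofNat_of_zero_le (hpos n)
    rw [Set.mem_ofPred] at hn
    refine Set.mem_biUnion (x := j) ?_ hj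
    rw [Set.mem_Iio]
    omega
  rw [← Nat.cofinite_eq_atTop]
  filter_upwards [hfin2.compl_mem_cofinite] with n hn
  simpa using hn

end Walk

end RWRE

/-! ### Mixing walks: decoupling after fresh runs and consequences of ellipticity -/

namespace RWRE

variable {d : ℕ} [NeZero d]

/-- The law of a marked walk such that every marked letter has conditional probability `q`, and
such that the future of the walk before the time `R` is almost independent of its past if the
future starts far above the past. -/
structure IsMixingWalk (q : ℝ≥0∞) (μ : Measure (ℕ → Letter d)) : Prop where
  isProbabilityMeasure : IsProbabilityMeasure μ
  pos : 0 < q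
  lt_one : q < 1
  elliptic : ∀ (ξ : ℕ → Letter d) (n : ℕ), (ξ n).mark = true →
    μ (cyl (n + 1) ξ) = q * μ (cyl n ξ)
  -- The first bound discards the t letters between past and future, whatever they are, and is
  -- one-sided; it serves the case R < ∞. The other two keep these letters, which must then be
  -- marked, and give the two-sided comparison needed for regenerations.
  mixing : ∀ c : ℝ, 1 ≤ c → ∃ (D : ℕ → ℝ) (r : ℕ), (∀ l, 1 < D l) ∧ Tendsto D atTop (𝓝 1) ∧
    ∀ (l : ℕ), r ≤ l → ∀ (ξ : ℕ → Letter d) (n t m : ℕ) (a : ℤ), (∀ i < n, height ξ i < a) →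
      a + l ≤ height ξ (n + t) → (m : ℕ∞) ≤ stopTime c (shiftSeq (n + t) ξ) →
      μ (cyl (n + t + m) ξ) ≤
          ENNReal.ofReal (D l) * (μ (cyl n ξ) * μ (cyl m (shiftSeq (n + t) ξ))) ∧
        ((∀ i, n ≤ i → i < n + t → (ξ i).mark = true) →
          μ (cyl (n + t + m) ξ) ≤
            ENNReal.ofReal (D l) * (μ (cyl (n + t) ξ) * μ (cyl m (shiftSeq (n + t) ξ))) ∧
          μ (cyl (n + t) ξ) * μ (cyl m (shiftSeq (n + t) ξ)) ≤
            ENNReal.ofReal (D l) * μ (cyl (n + t + m) ξ))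

/-- At time `n - L` the walk is at a new maximum, and the next `L` letters are the marked
step `e_1`. -/
def Fresh (L : ℕ) (ξ : ℕ → Letter d) (n : ℕ) : Prop :=
  L ≤ n ∧ (∀ m < n - L, height ξ m < height ξ (n - L)) ∧
    ∀ i, n - L ≤ i → i < n → ξ i = upLetter d

lemma Fresh.congr {L n : ℕ} {ξ η : ℕ → Letter d} (h : Fresh L ξ n) (hη : η ∈ cyl n ξ) :
    Fresh L η n := by
  refine ⟨h.1, fun m hm => ?_, fun i h1 h2 => (hη i h2).trans (h.2.2 i h1 h2)⟩
  rw [height_congr hη (by omega), height_congr hη (by omega)]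
  exact h.2.1 m hm

lemma fresh_congr_iff {L n : ℕ} {ξ η : ℕ → Letter d} (hη : η ∈ cyl n ξ) :
    Fresh L η n ↔ Fresh L ξ n := ⟨fun h => h.congr (mem_cyl_symm hη), fun h => h.congr hη⟩

lemma Fresh.height_add {L n : ℕ} {ξ : ℕ → Letter d} (h : Fresh L ξ n) {i : ℕ} (hi : i ≤ L) :
    height ξ (n - L + i) = height ξ (n - L) + i :=
  height_run (fun i hi => h.2.2 _ (by omega) (by have := h.1; omega)) hi

lemma Fresh.record {L n : ℕ} {ξ : ℕ → Letter d} (h : Fresh L ξ n) {m : ℕ} (hm : m < n) :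
    height ξ m < height ξ n := by
  have h1 := h.1
  have h2 := h.height_add le_rfl
  rw [Nat.sub_add_cancel h1] at h2
  rcases lt_or_ge m (n - L) with h3 | h3
  · have := h.2.1 m h3; omega
  · obtain ⟨i, rfl⟩ := Nat.exists_eq_add_of_le h3
    rw [h.height_add (by omega), h2]
    omega

/-- Decoupling controls only words along which R has not yet occurred. On R = ∞ this suffices: the
event is the decreasing limit of the events that R is at least n + m, and each of these is a union
of such words. -/
lemma compare_noStop {c : ℝ} {μ ν : Measure (ℕ → Letter d)} [IsFiniteMeasure μ] [IsFiniteMeasure ν]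
    (h : ∀ (m : ℕ) ζ, (m : ℕ∞) ≤ stopTime c ζ → μ (cyl m ζ) ≤ ν (cyl m ζ)) :
    μ.restrict (noStop c) ≤ ν.restrict (noStop c) := by
  refine measure_le_of_cyl fun n ξ => ?_
  rw [Measure.restrict_apply (measurableSet_cyl _ _), Measure.restrict_apply (measurableSet_cyl _ _)]
  have hA : cyl n ξ ∩ noStop c =
      ⋂ m : ℕ, cyl n ξ ∩ {ζ : ℕ → Letter d | ((n + m : ℕ) : ℕ∞) ≤ stopTime c ζ} := by
    rw [← Set.inter_iInter, noStop_eq_iInter]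
    congr 1
    refine Set.Subset.antisymm (Set.subset_iInter fun m => Set.iInter_subset _ _)
      (Set.subset_iInter fun m => (Set.iInter_subset _ m).trans fun ζ hζ => ?_)
    exact le_trans (by exact_mod_cast (by omega : m ≤ n + m)) (Set.mem_ofPred.1 hζ)
  have hanti : Antitone fun m : ℕ =>
      cyl n ξ ∩ {ζ : ℕ → Letter d | ((n + m : ℕ) : ℕ∞) ≤ stopTime c ζ} := fun m m' hm =>
    Set.inter_subset_inter_right _ fun ζ hζ =>
      le_trans (by exact_mod_cast (by omega : n + m ≤ n + m')) (Set.mem_ofPred.1 hζ)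
  have hdet : ∀ m : ℕ, Determined (n + m)
      (cyl n ξ ∩ {ζ : ℕ → Letter d | ((n + m : ℕ) : ℕ∞) ≤ stopTime c ζ}) := fun m =>
    ((determined_cyl n ξ).mono (by omega)).inter (determined_le_stopTime c _)
  rw [hA]
  refine le_of_tendsto_of_tendsto'
    (tendsto_measure_iInter_atTop (fun m => (hdet m).measurableSet.nullMeasurableSet) hanti
      ⟨0, measure_ne_top _ _⟩)
    (tendsto_measure_iInter_atTop (fun m => (hdet m).measurableSet.nullMeasurableSet) hanti
      ⟨0, measure_ne_top _ _⟩) fun m => ?_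
  exact measure_le_of_determined (hdet m) fun ζ hζ => h _ _ hζ.2

namespace IsMixingWalk

variable {q : ℝ≥0∞} {μ : Measure (ℕ → Letter d)}

/-- `D` is a rate of mixing for the constant `c`, valid from gap `r` on. -/
def IsRate (μ : Measure (ℕ → Letter d)) (c : ℝ) (D : ℕ → ℝ) (r : ℕ) : Prop :=
  (∀ l, 1 < D l) ∧ Tendsto D atTop (𝓝 1) ∧
    ∀ (l : ℕ), r ≤ l → ∀ (ξ : ℕ → Letter d) (n t m : ℕ) (a : ℤ), (∀ i < n, height ξ i < a) →
      a + l ≤ height ξ (n + t) → (m : ℕ∞) ≤ stopTime c (shiftSeq (n + t) ξ) →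
      μ (cyl (n + t + m) ξ) ≤
          ENNReal.ofReal (D l) * (μ (cyl n ξ) * μ (cyl m (shiftSeq (n + t) ξ))) ∧
        ((∀ i, n ≤ i → i < n + t → (ξ i).mark = true) →
          μ (cyl (n + t + m) ξ) ≤
            ENNReal.ofReal (D l) * (μ (cyl (n + t) ξ) * μ (cyl m (shiftSeq (n + t) ξ))) ∧
          μ (cyl (n + t) ξ) * μ (cyl m (shiftSeq (n + t) ξ)) ≤
            ENNReal.ofReal (D l) * μ (cyl (n + t + m) ξ))

lemma exists_isRate (h : IsMixingWalk q μ) {c : ℝ} (hc : 1 ≤ c) : ∃ D r, IsRate μ c D r :=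
  h.mixing c hc

lemma cyl_inter_shift (n m : ℕ) (ξ ζ : ℕ → Letter d) :
    shiftSeq n ⁻¹' cyl m ζ ∩ cyl n ξ = cyl (n + m) (glue n ξ ζ) := by
  rw [cyl_glue, Set.inter_comm]

/-- After a fresh run, the future is almost independent of the past on `R = ∞`. -/
lemma fresh_mixing [IsProbabilityMeasure μ] {c : ℝ} {D : ℕ → ℝ} {r : ℕ} (hD : IsRate μ c D r)
    {L : ℕ} (hL : r ≤ L) {ξ : ℕ → Letter d} {N : ℕ} (hf : Fresh L ξ N)
    {B : Set (ℕ → Letter d)} (hB : MeasurableSet B) (hBR : B ⊆ noStop c) :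
    μ (cyl N ξ ∩ shiftSeq N ⁻¹' B) ≤ ENNReal.ofReal (D L) * (μ (cyl N ξ) * μ B) ∧
      μ (cyl N ξ) * μ B ≤ ENNReal.ofReal (D L) * μ (cyl N ξ ∩ shiftSeq N ⁻¹' B) := by
  set ν : Measure (ℕ → Letter d) := (μ.restrict (cyl N ξ)).map (shiftSeq N) with hν
  have hνB : ∀ B, MeasurableSet B → ν B = μ (shiftSeq N ⁻¹' B ∩ cyl N ξ) := fun B hB => by
    rw [hν, Measure.map_apply (measurable_shiftSeq N) hB,
      Measure.restrict_apply (measurable_shiftSeq N hB)]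
  have key : ∀ (m : ℕ) (ζ : ℕ → Letter d), (m : ℕ∞) ≤ stopTime c ζ →
      ν (cyl m ζ) ≤ ENNReal.ofReal (D L) * (μ (cyl N ξ) * μ (cyl m ζ)) ∧
        μ (cyl N ξ) * μ (cyl m ζ) ≤ ENNReal.ofReal (D L) * ν (cyl m ζ) := by
    intro m ζ hm
    rw [hνB _ (measurableSet_cyl _ _), cyl_inter_shift]
    have hN : N - L + L = N := Nat.sub_add_cancel hf.1
    have hg := glue_mem_cyl N ξ ζ
    have hf' := hf.congr hg
    have h2 := hf'.height_add le_rfl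
    -- The past ends at time N − L, the middle piece is the run itself, and the gap is exactly L
    -- levels. The run consists of marked letters, so the two-sided bound applies.
    have := (hD.2.2 L hL (glue N ξ ζ) (N - L) L m (height (glue N ξ ζ) (N - L)) hf'.2.1 h2.ge
      (by rw [hN, shiftSeq_glue]; exact hm)).2
      (fun i h1 h2 => by rw [hf'.2.2 i h1 (by omega)]; rfl)
    rw [hN, shiftSeq_glue, cyl_eq_of_mem le_rfl hg] at this
    exact this
  have e1 : ν.restrict (noStop c) ≤
      ((ENNReal.ofReal (D L) * μ (cyl N ξ)) • μ).restrict (noStop c) := by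
    have : IsFiniteMeasure ((ENNReal.ofReal (D L) * μ (cyl N ξ)) • μ) :=
      Measure.smul_finite _ (ENNReal.mul_ne_top ENNReal.ofReal_ne_top (measure_ne_top _ _))
    refine compare_noStop fun m ζ hm => ?_
    rw [Measure.smul_apply, smul_eq_mul, mul_assoc]
    exact (key m ζ hm).1
  have e2 : (μ (cyl N ξ) • μ).restrict (noStop c) ≤
      (ENNReal.ofReal (D L) • ν).restrict (noStop c) := by
    have : IsFiniteMeasure (μ (cyl N ξ) • μ) := Measure.smul_finite _ (measure_ne_top _ _)
    have : IsFiniteMeasure (ENNReal.ofReal (D L) • ν) :=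
      Measure.smul_finite _ ENNReal.ofReal_ne_top
    refine compare_noStop fun m ζ hm => ?_
    rw [Measure.smul_apply, smul_eq_mul, Measure.smul_apply, smul_eq_mul]
    exact (key m ζ hm).2
  have e1 := e1 B
  have e2 := e2 B
  rw [Measure.restrict_eq_self _ hBR, Measure.restrict_eq_self _ hBR, Measure.smul_apply,
    smul_eq_mul] at e1 e2
  rw [Measure.smul_apply, smul_eq_mul] at e2
  rw [hνB B hB, Set.inter_comm, mul_assoc] at e1
  rw [hνB B hB, Set.inter_comm] at e2
  exact ⟨e1, e2⟩

lemma measure_cyl_inter_letter (h : IsMixingWalk q μ) {s : Letter d} (hs : s.mark = true) (n : ℕ)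
    (ξ : ℕ → Letter d) : μ (cyl n ξ ∩ {η | η n = s}) = q * μ (cyl n ξ) := by
  have h1 : cyl n ξ ∩ {η | η n = s} = cyl (n + 1) (glue n ξ fun _ => s) := by
    rw [cyl_glue]
    congr 1
    ext η
    simp only [Set.mem_ofPred, Set.mem_preimage, cyl, shiftSeq]
    exact ⟨fun h i hi => by obtain rfl : i = 0 := by omega
                            simpa using h, fun h => by simpa using h 0 (by omega)⟩
  rw [h1, h.elliptic _ _ (by simp [glue, hs]), cyl_eq_of_mem le_rfl (glue_mem_cyl n ξ _)]

lemma measure_determined_inter_letter (h : IsMixingWalk q μ) {s : Letter d} (hs : s.mark = true)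
    {n : ℕ} {A : Set (ℕ → Letter d)} (hA : Determined n A) :
    μ (A ∩ {η | η n = s}) = q * μ A := by
  have hm : MeasurableSet {η : ℕ → Letter d | η n = s} :=
    measurableSet_eq_fun (measurable_pi_apply n) measurable_const
  have key : ∀ ξ, (μ.restrict {η | η n = s}) (cyl n ξ) = (q • μ) (cyl n ξ) := fun ξ => by
    rw [Measure.restrict_apply (measurableSet_cyl _ _), h.measure_cyl_inter_letter hs]; rfl
  rw [← Measure.restrict_apply hA.measurableSet]
  exact le_antisymm (measure_le_of_determined hA fun ξ _ => (key ξ).le)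
    (measure_le_of_determined (μ := q • μ) hA fun ξ _ => (key ξ).ge)

/-- Each prescribed marked letter costs exactly a factor q, whatever the past, so a run of L of them
costs q ^ L. -/
lemma measure_determined_inter_run (h : IsMixingWalk q μ) {s : Letter d} (hs : s.mark = true)
    {n : ℕ} {A : Set (ℕ → Letter d)} (hA : Determined n A) (L : ℕ) :
    μ (A ∩ {η | ∀ i < L, η (n + i) = s}) = q ^ L * μ A := by
  induction L with
  | zero => simp
  | succ L ih =>
    have h1 : A ∩ {η | ∀ i < L + 1, η (n + i) = s} =
        (A ∩ {η | ∀ i < L, η (n + i) = s}) ∩ {η | η (n + L) = s} := by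
      ext η
      simp only [Set.mem_inter_iff, Set.mem_ofPred, Nat.lt_succ_iff_lt_or_eq, or_imp, forall_and,
        forall_eq, and_assoc]
    rw [h1, h.measure_determined_inter_letter hs, ih, pow_succ']
    · ring
    · refine (hA.mono (by omega)).inter fun ξ hξ η hη i hi => ?_
      rw [hη _ (by omega)]
      exact hξ i hi

/-- If events that depend on the past occur infinitely often, then at one of these times the next
letter is a given marked letter. -/
lemma ae_exists_letter (h : IsMixingWalk q μ) {s : Letter d} (hs : s.mark = true)
    {E : ℕ → Set (ℕ → Letter d)} (hE : ∀ n, Determined n (E n)) :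
    ∀ᵐ ξ ∂μ, (∃ᶠ n in atTop, ξ ∈ E n) → ∃ n, ξ ∈ E n ∧ ξ n = s := by
  classical
  have := h.isProbabilityMeasure
  have hq1 : (1 - q) ≠ 0 := (tsub_pos_of_lt h.lt_one).ne'
  have hqt : (1 - q) ≠ ⊤ := ne_top_of_le_ne_top ENNReal.one_ne_top tsub_le_self
  set b : ℝ≥0∞ := (1 - q)⁻¹ with hb
  have hb1 : 1 < b := by
    rw [hb, ENNReal.one_lt_inv]
    exact ENNReal.sub_lt_self ENNReal.one_ne_top one_ne_zero h.pos.ne'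
  -- A betting martingale: at each time i with ξ ∈ E i it is multiplied by 0 if the letter is s and
  -- by 1/(1 − q) otherwise, so its mean stays at most 1. Without a success it would grow to ∞
  -- whenever the events recur, which Fatou's lemma excludes almost surely.
  set M : ℕ → (ℕ → Letter d) → ℝ≥0∞ := fun n ξ =>
    ∏ i ∈ Finset.range n, if ξ ∈ E i then (if ξ i = s then 0 else b) else 1 with hM
  have hms : ∀ n, MeasurableSet {η : ℕ → Letter d | η n = s} := fun n =>
    measurableSet_eq_fun (measurable_pi_apply n) measurable_const
  have hMm : ∀ n, Measurable (M n) := fun n =>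
    Finset.measurable_prod _ fun i _ => Measurable.ite (hE i).measurableSet
      (Measurable.ite (hms i) measurable_const measurable_const) measurable_const
  have hMdet : ∀ n, ∀ ξ, ∀ η ∈ cyl n ξ, M n η = M n ξ := by
    intro n ξ η hη
    refine Finset.prod_congr rfl fun i hi => ?_
    have hi := Finset.mem_range.1 hi
    have e1 : η ∈ E i ↔ ξ ∈ E i := ⟨fun h => hE i _ h (mem_cyl_symm (cyl_anti hi.le _ hη)),
      fun h => hE i _ h (cyl_anti hi.le _ hη)⟩
    rw [hη i hi]
    simp only [e1]
  have hν : ∀ n ξ, (μ.restrict {η | η n = s}ᶜ) (cyl n ξ) = (1 - q) * μ (cyl n ξ) := by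
    intro n ξ
    rw [Measure.restrict_apply (measurableSet_cyl _ _), ← Set.sdiff_eq,
      ← Set.sdiff_inter_self_eq_sdiff, Set.inter_comm, measure_sdiff Set.inter_subset_left
      ((measurableSet_cyl _ _).inter (hms n)).nullMeasurableSet (measure_ne_top _ _),
      h.measure_cyl_inter_letter hs, ENNReal.sub_mul (fun _ _ => measure_ne_top _ _), one_mul]
  have hint : ∀ n, ∫⁻ ξ, M n ξ ∂μ ≤ 1 := by
    intro n
    induction n with
    | zero => simp [hM]
    | succ n ih =>
      refine le_trans (le_of_eq ?_) ih
      have hsplit : ∀ ξ, M (n + 1) ξ = (E n)ᶜ.indicator (M n) ξ +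
          b * ({η | η n = s}ᶜ.indicator ((E n).indicator (M n)) ξ) := by
        intro ξ
        rw [hM]
        simp only [Finset.prod_range_succ]
        by_cases h1 : ξ ∈ E n
        · by_cases h2 : ξ n = s
          · simp [h1, h2]
          · simp [h1, h2, mul_comm]
        · simp [h1, Set.indicator]
      have e2 : ∫⁻ ξ, {η | η n = s}ᶜ.indicator ((E n).indicator (M n)) ξ ∂μ =
          (1 - q) * ∫⁻ ξ, (E n).indicator (M n) ξ ∂μ := by
        rw [lintegral_indicator (hms n).compl]
        refine lintegral_eq_of_cyl (n := n) (hν n) fun ξ η hη => ?_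
        have e1 : η ∈ E n ↔ ξ ∈ E n := ⟨fun h => hE n _ h (mem_cyl_symm hη), fun h => hE n _ h hη⟩
        simp only [Set.indicator, e1, hMdet n ξ η hη]
      simp only [hsplit]
      rw [lintegral_add_left ((hMm n).indicator (hE n).measurableSet.compl),
        lintegral_const_mul _ (((hMm n).indicator (hE n).measurableSet).indicator (hms n).compl),
        e2, ← mul_assoc, hb, ENNReal.inv_mul_cancel hq1 hqt, one_mul,
        lintegral_indicator (hE n).measurableSet.compl, lintegral_indicator (hE n).measurableSet,
        add_comm, lintegral_add_compl _ (hE n).measurableSet]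
  have hlim : ∫⁻ ξ, liminf (fun n => M n ξ) atTop ∂μ ≤ 1 :=
    (lintegral_liminf_le hMm).trans (liminf_le_of_frequently_le' (Frequently.of_forall hint))
  filter_upwards [ae_lt_top (.liminf hMm) (hlim.trans_lt ENNReal.one_lt_top).ne] with ξ hξ hfreq
  by_contra hno
  push Not at hno
  refine hξ.ne ?_
  have hMξ : ∀ n, M n ξ = b ^ ((Finset.range n).filter fun i => ξ ∈ E i).card := by
    intro n
    rw [← Finset.prod_const, Finset.prod_filter]
    refine Finset.prod_congr rfl fun i _ => ?_
    by_cases h1 : ξ ∈ E i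
    · simp [h1, hno i h1]
    · simp [h1]
  have hcard : Tendsto (fun n => ((Finset.range n).filter fun i => ξ ∈ E i).card) atTop atTop := by
    refine tendsto_atTop_atTop_of_monotone (fun m n hmn => Finset.card_le_card
      (Finset.filter_subset_filter _ (Finset.range_mono hmn))) fun k => ?_
    obtain ⟨t, ht, htk⟩ := (Nat.frequently_atTop_iff_infinite.1 hfreq).exists_subset_card_eq k
    refine ⟨t.sup id + 1, htk ▸ Finset.card_le_card fun i hi => Finset.mem_filter.2 ⟨?_, ht hi⟩⟩
    exact Finset.mem_range.2 (Nat.lt_succ_of_le (Finset.le_sup (f := id) hi))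
  refine Tendsto.liminf_eq ?_
  simp only [hMξ]
  exact (ENNReal.tendsto_pow_atTop_nhds_top_iff.2 hb1).comp hcard

/-- Induction on the length: `ae_exists_letter` is applied to the event that a run of length N has
just ended, restricted to times after an arbitrary m. The restriction turns existence into
recurrence. -/
lemma ae_frequently_run (h : IsMixingWalk q μ) {s : Letter d} (hs : s.mark = true) (N : ℕ)
    {E : ℕ → Set (ℕ → Letter d)} (hE : ∀ n, Determined n (E n)) :
    ∀ᵐ ξ ∂μ, (∃ᶠ n in atTop, ξ ∈ E n) →
      ∃ᶠ n in atTop, ξ ∈ E n ∧ ∀ i < N, ξ (n + i) = s := by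
  induction N with
  | zero => simp
  | succ N ih =>
    set F : ℕ → ℕ → Set (ℕ → Letter d) := fun m n =>
      {ξ | m ≤ n ∧ N ≤ n ∧ ξ ∈ E (n - N) ∧ ∀ i < N, ξ (n - N + i) = s} with hF
    have hFd : ∀ m n, Determined n (F m n) := by
      rintro m n ξ ⟨h1, h2, h3, h4⟩ η hη
      exact ⟨h1, h2, hE _ _ h3 (cyl_anti (by omega) _ hη), fun i hi => by
        rw [hη _ (by omega)]; exact h4 i hi⟩
    filter_upwards [ih, ae_all_iff.2 fun m => h.ae_exists_letter hs (hFd m)] with ξ h1 h2 hfreq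
    rw [frequently_atTop]
    intro m
    obtain ⟨n, hn, hns⟩ := h2 (m + N) (by
      rw [frequently_atTop]
      intro a
      obtain ⟨n, hn, hn1, hn2⟩ := frequently_atTop.1 (h1 hfreq) (a + m)
      exact ⟨n + N, by omega, by omega, by omega, by simpa using hn1, by simpa using hn2⟩)
    obtain ⟨h3, h4, h5, h6⟩ := hn
    refine ⟨n - N, by omega, h5, fun i hi => ?_⟩
    rcases Nat.lt_succ_iff_lt_or_eq.1 hi with hi | rfl
    · exact h6 i hi
    · rwa [Nat.sub_add_cancel h4]

/-- The walk either is unbounded above or tends to `-∞`. -/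
lemma ae_unbounded_or_tendsto (h : IsMixingWalk q μ) :
    ∀ᵐ ξ ∂μ, (∀ b : ℤ, ∃ n, b ≤ height ξ n) ∨ Tendsto (fun n => -height ξ n) atTop atTop := by
  have hd : ∀ (j : ℤ) (n : ℕ), Determined n {ξ : ℕ → Letter d | height ξ n = j} :=
    fun j n ξ hξ η hη => by
      rw [Set.mem_ofPred, height_congr hη le_rfl]; exact hξ
  have := ae_all_iff.2 fun p : ℤ × ℕ => h.ae_frequently_run (s := upLetter d) rfl p.2 (hd p.1)
  filter_upwards [this] with ξ hξ
  by_contra hno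
  rw [not_or] at hno
  obtain ⟨h1, h2⟩ := hno
  push Not at h1
  obtain ⟨b, hb⟩ := h1
  rw [tendsto_atTop] at h2
  push Not at h2
  obtain ⟨a, ha⟩ := h2
  -- A walk that stays below b and does not tend to −∞ visits some level of a finite window
  -- infinitely often. From such a level j, a run of b − j steps upwards eventually occurs and
  -- reaches b.
  have hex : ∃ j ∈ Finset.Icc (-a) b, ∃ᶠ n in atTop, height ξ n = j := by
    by_contra hcon
    push Not at hcon
    refine ha ?_
    have : ∀ᶠ n in atTop, ∀ j ∈ Finset.Icc (-a) b, ¬ height ξ n = j :=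
      (Finset.eventually_all _).2 fun j hj => by simpa using hcon j hj
    filter_upwards [this] with n hn
    by_contra hlt
    exact hn _ (Finset.mem_Icc.2 ⟨by omega, (hb n).le⟩) rfl
  obtain ⟨j, -, hj⟩ := hex
  obtain ⟨n, hn, hrun⟩ := (hξ (j, (b - j).toNat) hj).exists
  have := height_run hrun le_rfl
  have := hb (n + (b - j).toNat)
  simp only at *
  omega

/-- If the walk is unbounded above, then there are fresh runs at arbitrarily late times. -/
lemma ae_frequently_fresh (h : IsMixingWalk q μ) (L : ℕ) :
    ∀ᵐ ξ ∂μ, (∀ b : ℤ, ∃ n, b ≤ height ξ n) → ∃ᶠ n in atTop, Fresh L ξ n := by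
  have hd : ∀ n, Determined n {ξ : ℕ → Letter d | ∀ m < n, height ξ m < height ξ n} :=
    fun n ξ hξ η hη m hm => by
      rw [height_congr hη le_rfl, height_congr hη hm.le]; exact hξ m hm
  filter_upwards [h.ae_frequently_run (s := upLetter d) rfl L hd] with ξ hξ hub
  have hfreq : ∃ᶠ n in atTop, ξ ∈ {ξ : ℕ → Letter d | ∀ m < n, height ξ m < height ξ n} := by
    classical
    rw [frequently_atTop]
    intro a
    have hex := hub (a : ℤ)
    have hspec := Nat.find_spec hex
    refine ⟨Nat.find hex, ?_, fun m hm => ?_⟩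
    · have := height_le ξ (Nat.find hex); omega
    · have := Nat.find_min hex hm; omega
  refine frequently_atTop.2 fun a => ?_
  obtain ⟨n, hna, hn, hrun⟩ := frequently_atTop.1 (hξ hfreq) a
  refine ⟨n + L, by omega, by omega, ?_, fun i h1 h2 => ?_⟩
  · simpa using hn
  · obtain ⟨k, rfl⟩ := Nat.exists_eq_add_of_le (show n ≤ i by omega)
    exact hrun k (by omega)

end IsMixingWalk

end RWRE

namespace RWRE

lemma measurableSet_of_stopping {S : Type*} [Countable S] [MeasurableSpace S]
    [MeasurableSingletonClass S] {A : Set (ℕ → S)} (σ : (ℕ → S) → ℕ)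
    (hA : ∀ ξ ∈ A, ∀ η ∈ cyl (σ ξ) ξ, η ∈ A ∧ σ η = σ ξ) : MeasurableSet A := by
  have : A = ⋃ n, A ∩ {ξ | σ ξ = n} := by
    ext ξ; simp
  rw [this]
  refine MeasurableSet.iUnion fun n => Determined.measurableSet (n := n) ?_
  rintro ξ ⟨h1, rfl⟩ η hη
  exact hA ξ h1 η hη

variable {d : ℕ} [NeZero d]

/-! ### Attempts and regeneration times in terms of letters -/

lemma vec_eq_iff {e : Dir d} : e.vec = Pi.single 0 1 ↔ e = (0, 1) := by
  constructor
  · obtain ⟨i, s⟩ := e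
    intro h
    simp only [Dir.vec] at h
    have h0 := congrFun h 0
    by_cases hi : i = 0
    · subst hi
      simp at h0
      rw [h0]
    · rw [Pi.single_eq_of_ne (Ne.symm hi)] at h0
      simp at h0
  · rintro rfl
    simp [Dir.vec]

lemma isFreshRun_iff {L : ℕ} {ε : Coins d} {ξ : ℕ → Letter d}
    (hε : ∀ n, ε (n, path ξ n) = (ξ n).mark) {n : ℕ} :
    IsFreshRun L ε (path ξ) n ↔ Fresh L ξ n := by
  have hl : ∀ i, (ε (i, path ξ i) = true ∧ path ξ (i + 1) - path ξ i = Pi.single 0 1) ↔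
      ξ i = upLetter d := by
    intro i
    rw [hε, path_succ, add_sub_cancel_left, vec_eq_iff]
    constructor
    · rintro ⟨h1, h2⟩
      rcases hξ : ξ i with ⟨a, b⟩
      rw [hξ] at h1 h2
      simp only at h1 h2
      rw [h1, h2, upLetter]
    · intro h
      rw [h]
      exact ⟨rfl, rfl⟩
  unfold IsFreshRun Fresh
  refine and_congr_right fun hLn => (and_congr Iff.rfl ⟨fun h i h1 h2 => ?_, fun h i h1 h2 => ?_⟩)
  · have := h (n - i) (by omega) (by omega)
    rw [show n - (n - i) = i by omega] at this
    exact (hl i).1 this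
  · exact (hl (n - i)).2 (h (n - i) (by omega) (by omega))

/-- The time at which the attempt with index `k` starts. -/
noncomputable def attempt (c : ℝ) (L : ℕ) (ξ : ℕ → Letter d) (k : ℕ) : ℕ∞ :=
  timeS c L (coins ξ) (path ξ) k

/-- The time at which the attempt with index `k - 1` ends. -/
noncomputable def attemptEnd (c : ℝ) (L : ℕ) (ξ : ℕ → Letter d) (k : ℕ) : ℕ∞ :=
  timeR c L (coins ξ) (path ξ) k

/-- The first regeneration time. -/
noncomputable def regen (c : ℝ) (L : ℕ) (ξ : ℕ → Letter d) : ℕ∞ :=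
  regenTime c L (coins ξ) (path ξ)

lemma coins_path (ξ : ℕ → Letter d) (n : ℕ) : coins ξ (n, path ξ n) = (ξ n).mark := rfl

lemma nextS_eq {L : ℕ} {ε : Coins d} {ξ : ℕ → Letter d}
    (hε : ∀ n, ε (n, path ξ n) = (ξ n).mark) (ρ : ℕ∞) :
    nextS L ε (path ξ) ρ = firstTime fun n => ρ ≤ n ∧ Fresh L ξ n :=
  firstTime_congr fun _ => and_congr Iff.rfl (isFreshRun_iff hε)

lemma timeR_eq_attemptEnd (c : ℝ) {L : ℕ} {ε : Coins d} {ξ : ℕ → Letter d}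
    (hε : ∀ n, ε (n, path ξ n) = (ξ n).mark) (k : ℕ) :
    timeR c L ε (path ξ) k = attemptEnd c L ξ k := by
  unfold attemptEnd
  induction k with
  | zero => rfl
  | succ k ih => rw [timeR, timeR, ih, nextS_eq hε, nextS_eq (coins_path ξ)]

lemma regenTime_eq_regen (c : ℝ) {L : ℕ} {ε : Coins d} {ξ : ℕ → Letter d}
    (hε : ∀ n, ε (n, path ξ n) = (ξ n).mark) : regenTime c L ε (path ξ) = regen c L ξ := by
  have h1 : timeR c L ε (path ξ) = timeR c L (coins ξ) (path ξ) :=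
    funext fun k => timeR_eq_attemptEnd c hε k
  have h2 : timeS c L ε (path ξ) = timeS c L (coins ξ) (path ξ) := by
    funext k
    rw [timeS, timeS, h1, nextS_eq hε, nextS_eq (coins_path ξ)]
  unfold regen regenTime
  revert h1 h2
  generalize timeR c L ε (path ξ) = R
  generalize timeS c L ε (path ξ) = S
  rintro rfl rfl
  rfl

section

variable {c : ℝ} {L : ℕ} {ξ η : ℕ → Letter d}

lemma attempt_eq_firstTime (c : ℝ) (L : ℕ) (ξ : ℕ → Letter d) (k : ℕ) :
    attempt c L ξ k = firstTime fun n => attemptEnd c L ξ k ≤ n ∧ Fresh L ξ n :=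
  nextS_eq (coins_path ξ) _

lemma attemptEnd_zero (c : ℝ) (L : ℕ) (ξ : ℕ → Letter d) : attemptEnd c L ξ 0 = 0 := rfl

lemma attemptEnd_succ (c : ℝ) (L : ℕ) (ξ : ℕ → Letter d) (k : ℕ) :
    attemptEnd c L ξ (k + 1) = attempt c L ξ k +
      stopTime c (shiftSeq (attempt c L ξ k).toNat ξ) := by
  rw [← stopR_shiftPath]; rfl

lemma attemptEnd_succ_of_eq {k n : ℕ} (h : attempt c L ξ k = n) :
    attemptEnd c L ξ (k + 1) = n + stopTime c (shiftSeq n ξ) := by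
  rw [attemptEnd_succ, h]; rfl

lemma attemptEnd_le_attempt (k : ℕ) : attemptEnd c L ξ k ≤ attempt c L ξ k := by
  rw [attempt_eq_firstTime]
  refine le_iInf₂ fun n hn => hn.1

lemma attempt_le_attemptEnd_succ (k : ℕ) : attempt c L ξ k ≤ attemptEnd c L ξ (k + 1) := by
  rw [attemptEnd_succ]; exact le_self_add

lemma attemptEnd_mono {j k : ℕ} (h : j ≤ k) : attemptEnd c L ξ j ≤ attemptEnd c L ξ k :=
  monotone_nat_of_le_succ
    (fun k => (attemptEnd_le_attempt k).trans (attempt_le_attemptEnd_succ k)) h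

lemma Fresh.of_attempt {k n : ℕ} (h : attempt c L ξ k = n) : Fresh L ξ n := by
  rw [attempt_eq_firstTime, firstTime_eq_coe_iff] at h
  exact h.1.2

/-- The stopping property of `attemptEnd` for the same index is a hypothesis, because the two
properties are established alternately along the recursion in k. -/
lemma attempt_congr_of {k : ℕ}
    (hR : ∀ (n : ℕ) (ξ η : ℕ → Letter d), η ∈ cyl n ξ → attemptEnd c L ξ k = n →
      attemptEnd c L η k = n) {n : ℕ} (hη : η ∈ cyl n ξ) (h : attempt c L ξ k = n) :
    attempt c L η k = n := by
  have hle : ∀ m ≤ n, (attemptEnd c L ξ k ≤ m ↔ attemptEnd c L η k ≤ m) := by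
    intro m hm
    constructor
    · intro hle
      obtain ⟨l, hl⟩ := ENat.ne_top_iff_exists.1 (ne_top_of_le_ne_top (ENat.natCast_ne_top m) hle)
      rw [← hl, Nat.cast_le] at hle
      rw [hR l ξ η (cyl_anti (hle.trans hm) _ hη) hl.symm]
      exact_mod_cast hle
    · intro hle
      obtain ⟨l, hl⟩ := ENat.ne_top_iff_exists.1 (ne_top_of_le_ne_top (ENat.natCast_ne_top m) hle)
      rw [← hl, Nat.cast_le] at hle
      rw [hR l η ξ (mem_cyl_symm (cyl_anti (hle.trans hm) _ hη)) hl.symm]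
      exact_mod_cast hle
  rw [attempt_eq_firstTime, firstTime_eq_coe_iff] at *
  refine ⟨⟨(hle n le_rfl).1 h.1.1, (fresh_congr_iff hη).2 h.1.2⟩, fun m hm hmm => h.2 m hm
    ⟨(hle m hm.le).2 hmm.1, (fresh_congr_iff (cyl_anti hm.le _ hη)).1 hmm.2⟩⟩

lemma attemptEnd_congr (k : ℕ) : ∀ (n : ℕ) (ξ η : ℕ → Letter d), η ∈ cyl n ξ →
    attemptEnd c L ξ k = n → attemptEnd c L η k = n := by
  induction k with
  | zero => intro n ξ η _ h; rw [attemptEnd_zero] at *; exact h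
  | succ k ih =>
    intro n ξ η hη h
    have hS : attempt c L ξ k ≠ ⊤ := ne_top_of_le_ne_top (h ▸ ENat.natCast_ne_top n)
      (attempt_le_attemptEnd_succ k)
    obtain ⟨s, hs⟩ := ENat.ne_top_iff_exists.1 hS
    have h1 := attemptEnd_succ_of_eq hs.symm
    rw [h1] at h
    have hst : stopTime c (shiftSeq s ξ) ≠ ⊤ := by
      intro htop; rw [htop] at h; exact ENat.natCast_ne_top n (by rw [← h]; simp)
    obtain ⟨m, hm⟩ := ENat.ne_top_iff_exists.1 hst
    rw [← hm] at h
    have hsm : s + m = n := by exact_mod_cast h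
    have h2 := attempt_congr_of ih (cyl_anti (show s ≤ n by omega) _ hη) hs.symm
    rw [attemptEnd_succ_of_eq h2]
    subst hsm
    have := determined_stopTime_eq c m _ hm.symm (shiftSeq_mem_cyl hη)
    rw [Set.mem_ofPred] at this
    rw [this]; push_cast; rfl

lemma determined_attempt_eq (c : ℝ) (L k n : ℕ) :
    Determined n {ξ : ℕ → Letter d | attempt c L ξ k = n} := fun _ hξ _ hη =>
  attempt_congr_of (attemptEnd_congr k) hη hξ

/-- The minimality of the index is automatic: after a successful attempt the end of the attempt is
⊤, and then so are all later starts. Hence no finite start can come after a success. -/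
lemma regen_eq_coe_iff {n : ℕ} :
    regen c L ξ = n ↔ (∃ k, attempt c L ξ k = n) ∧ stopTime c (shiftSeq n ξ) = ⊤ := by
  classical
  have hreg : regen c L ξ = if h : ∃ k : ℕ, attempt c L ξ k < ⊤ ∧ attemptEnd c L ξ (k + 1) = ⊤ then
      attempt c L ξ (Nat.find h) else ⊤ := by
    unfold regen regenTime attempt attemptEnd
    congr
  rw [hreg]
  constructor
  · intro h
    split_ifs at h with hex
    · refine ⟨⟨_, h⟩, ?_⟩
      have h2 := (Nat.find_spec hex).2
      rw [attemptEnd_succ_of_eq h] at h2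
      by_contra hne
      obtain ⟨m, hm⟩ := ENat.ne_top_iff_exists.1 hne
      rw [← hm] at h2
      exact ENat.natCast_ne_top (n + m) (by push_cast; exact h2)
    · exact absurd h (ENat.natCast_ne_top n).symm
  · rintro ⟨⟨k, hk⟩, htop⟩
    have hex : ∃ k : ℕ, attempt c L ξ k < ⊤ ∧ attemptEnd c L ξ (k + 1) = ⊤ :=
      ⟨k, hk ▸ ENat.natCast_lt_top n, by rw [attemptEnd_succ_of_eq hk, htop]; simp⟩
    rw [dif_pos hex, ← hk]
    congr 1
    rw [Nat.find_eq_iff]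
    refine ⟨⟨hk ▸ ENat.natCast_lt_top n, by rw [attemptEnd_succ_of_eq hk, htop]; simp⟩, ?_⟩
    rintro j hj ⟨h1, h2⟩
    have h3 : (⊤ : ℕ∞) ≤ attempt c L ξ k :=
      h2 ▸ (attemptEnd_mono (show j + 1 ≤ k by omega)).trans (attemptEnd_le_attempt k)
    rw [hk] at h3
    exact ENat.natCast_ne_top n (top_le_iff.1 h3)

lemma Fresh.of_regen {n : ℕ} (h : regen c L ξ = n) : Fresh L ξ n := by
  obtain ⟨⟨k, hk⟩, -⟩ := regen_eq_coe_iff.1 h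
  exact Fresh.of_attempt hk

lemma regen_congr {n : ℕ} (h : regen c L ξ = n) (hη : η ∈ cyl n ξ)
    (htop : stopTime c (shiftSeq n η) = ⊤) : regen c L η = n := by
  obtain ⟨⟨k, hk⟩, -⟩ := regen_eq_coe_iff.1 h
  exact regen_eq_coe_iff.2 ⟨⟨k, determined_attempt_eq c L k n ξ hk hη⟩, htop⟩

lemma regen_lt_top_of_attemptEnd {k : ℕ} (h1 : attempt c L ξ k < ⊤)
    (h2 : attemptEnd c L ξ (k + 1) = ⊤) : regen c L ξ ≤ attempt c L ξ k := by
  obtain ⟨n, hn⟩ := ENat.ne_top_iff_exists.1 h1.ne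
  rw [← hn]
  rw [attemptEnd_succ_of_eq hn.symm] at h2
  refine le_of_eq (regen_eq_coe_iff.2 ⟨⟨k, hn.symm⟩, ?_⟩)
  by_contra hne
  obtain ⟨m, hm⟩ := ENat.ne_top_iff_exists.1 hne
  rw [← hm] at h2
  exact ENat.natCast_ne_top (n + m) (by push_cast; exact h2)

/-- If a fresh run ends at time `n` and `R = ∞` afterwards, then the first regeneration does not
occur after `n`. -/
lemma regen_le_of_fresh {n : ℕ} (hf : Fresh L ξ n) (htop : stopTime c (shiftSeq n ξ) = ⊤) :
    regen c L ξ ≤ n := by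
  have hc : 1 ≤ c := one_le_of_stopTime_pos (htop ▸ le_top)
  -- As long as no attempt has succeeded, the ends of the attempts stay at or below n while they
  -- grow by at least 1 each time. This is impossible at k = n + 1.
  have key : ∀ k, regen c L ξ ≤ n ∨ (attemptEnd c L ξ k ≤ n ∧ (k : ℕ∞) ≤ attemptEnd c L ξ k) := by
    intro k
    induction k with
    | zero => exact Or.inr ⟨by rw [attemptEnd_zero]; simp, by simp⟩
    | succ k ih =>
      rcases ih with ih | ⟨ih1, ih2⟩
      · exact Or.inl ih
      have hS : attempt c L ξ k ≤ n := by
        rw [attempt_eq_firstTime]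
        exact firstTime_le_iff.2 ⟨n, le_rfl, ih1, hf⟩
      obtain ⟨s, hs⟩ := ENat.ne_top_iff_exists.1 (ne_top_of_le_ne_top (ENat.natCast_ne_top n) hS)
      rw [← hs, Nat.cast_le] at hS
      have hR := attemptEnd_succ_of_eq hs.symm
      rcases eq_or_ne (attemptEnd c L ξ (k + 1)) ⊤ with h | h
      · left
        refine (regen_lt_top_of_attemptEnd (hs ▸ ENat.natCast_lt_top s) h).trans ?_
        rw [← hs]; exact_mod_cast hS
      right
      have hst : stopTime c (shiftSeq s ξ) ≠ ⊤ := by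
        intro h'; rw [h'] at hR; exact h (by rw [hR]; simp)
      obtain ⟨m, hm⟩ := ENat.ne_top_iff_exists.1 hst
      rw [hR, ← hm]
      refine ⟨?_, ?_⟩
      -- An attempt still alive at the record time n would have no violation before n and none after
      -- it, hence would never end.
      · by_contra hlt
        have hlt' : n < s + m := by
          rw [not_le] at hlt; exact_mod_cast hlt
        refine hst (stopTime_eq_top_of_record (n := n - s) ?_ ?_ ?_)
        · rw [← hm]; exact_mod_cast (by omega)
        · intro i hi
          rw [height_shift, height_shift, Nat.add_sub_cancel' hS]
          have := hf.record (m := s + i) (by omega)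
          omega
        · rw [shiftSeq_shiftSeq, Nat.add_sub_cancel' hS]; exact htop
      · have hm1 : 1 ≤ m := by
          have := le_stopTime_succ_of_record (n := 0) hc (ξ := shiftSeq s ξ) (by simp)
            (fun m hm => absurd hm (by omega))
          rw [← hm] at this; exact_mod_cast this
        have h4 := ih2.trans (attemptEnd_le_attempt k)
        rw [← hs] at h4
        have h5 : k ≤ s := by exact_mod_cast h4
        exact_mod_cast (by omega : k + 1 ≤ s + m)
  rcases key (n + 1) with h | ⟨h1, h2⟩
  · exact h
  · have : ((n + 1 : ℕ) : ℕ∞) ≤ (n : ℕ∞) := h2.trans h1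
    exact absurd (by exact_mod_cast this : n + 1 ≤ n) (by omega)

lemma Fresh.of_shift {n m : ℕ} (h1 : ∀ i < n, height ξ i < height ξ n)
    (h2 : Fresh L (shiftSeq n ξ) m) : Fresh L ξ (n + m) := by
  obtain ⟨ha, hb, hc⟩ := h2
  have e : n + m - L = n + (m - L) := by omega
  have hge : height ξ n ≤ height ξ (n + (m - L)) := by
    rcases Nat.eq_zero_or_pos (m - L) with h | h
    · rw [h]; simp
    · have := hb 0 h
      rw [height_shift, height_shift] at this
      simp at this; exact this.le
  refine ⟨by omega, fun i hi => ?_, fun i hi1 hi2 => ?_⟩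
  · rw [e] at hi ⊢
    rcases lt_or_ge i n with hin | hin
    · exact (h1 i hin).trans_le hge
    · obtain ⟨j, rfl⟩ := Nat.exists_eq_add_of_le hin
      have := hb j (by omega)
      rw [height_shift, height_shift] at this
      omega
  · obtain ⟨j, rfl⟩ := Nat.exists_eq_add_of_le (show n ≤ i by omega)
    exact hc j (by omega) (by omega)

lemma Fresh.shift_of_le {n s : ℕ} (h : Fresh L ξ n) (hs : s + L ≤ n) :
    Fresh L (shiftSeq s ξ) (n - s) := by
  obtain ⟨ha, hb, hc⟩ := h
  refine ⟨by omega, fun i hi => ?_, fun i h1 h2 => hc (s + i) (by omega) (by omega)⟩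
  rw [height_shift, height_shift]
  have := hb (s + i) (by omega)
  rw [show s + (n - s - L) = n - L by omega]
  omega

end

/-! ### Iteration -/

/-- The sequence of letters after the first regeneration time. -/
noncomputable def afterRegen (c : ℝ) (L : ℕ) (ξ : ℕ → Letter d) : ℕ → Letter d :=
  shiftSeq (regen c L ξ).toNat ξ

/-- The letters after the regeneration time with index `k`. -/
noncomputable def iterRegen (c : ℝ) (L k : ℕ) (ξ : ℕ → Letter d) : ℕ → Letter d :=
  (afterRegen c L)^[k] ξ

/-- The regeneration time with index `k`. -/
noncomputable def regenTimes (c : ℝ) (L k : ℕ) (ξ : ℕ → Letter d) : ℕ :=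
  ∑ i ∈ Finset.range k, (regen c L (iterRegen c L i ξ)).toNat

/-- The first `k` regeneration times are finite. -/
def regenFinite (c : ℝ) (L k : ℕ) : Set (ℕ → Letter d) :=
  {ξ | ∀ i < k, regen c L (iterRegen c L i ξ) ≠ ⊤}

section

variable {c : ℝ} {L : ℕ} {ξ η : ℕ → Letter d}

lemma iterRegen_succ (k : ℕ) :
    iterRegen c L (k + 1) ξ = iterRegen c L k (afterRegen c L ξ) := rfl

lemma regenTimes_succ' (k : ℕ) : regenTimes c L (k + 1) ξ =
    (regen c L ξ).toNat + regenTimes c L k (afterRegen c L ξ) := by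
  rw [regenTimes, Finset.sum_range_succ', add_comm]; rfl

lemma iterRegen_eq_shiftSeq (k : ℕ) : iterRegen c L k ξ = shiftSeq (regenTimes c L k ξ) ξ := by
  induction k generalizing ξ with
  | zero => simp [iterRegen, regenTimes]
  | succ k ih => rw [iterRegen_succ, ih, regenTimes_succ', afterRegen, shiftSeq_shiftSeq]

lemma regenFinite_succ_iff (k : ℕ) :
    ξ ∈ regenFinite c L (k + 1) ↔ regen c L ξ ≠ ⊤ ∧ afterRegen c L ξ ∈ regenFinite c L k := by
  constructor
  · intro h
    exact ⟨h 0 (by omega), fun i hi => h (i + 1) (by omega)⟩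
  · rintro ⟨h1, h2⟩ i hi
    rcases i with _ | i
    · exact h1
    · exact h2 i (by omega)

lemma stopTime_afterRegen (h : regen c L ξ ≠ ⊤) : stopTime c (afterRegen c L ξ) = ⊤ := by
  obtain ⟨n, hn⟩ := ENat.ne_top_iff_exists.1 h
  have := (regen_eq_coe_iff.1 hn.symm).2
  rw [afterRegen, ← hn]; exact this

lemma stopTime_iterRegen {k : ℕ} (h : ξ ∈ regenFinite c L (k + 1)) :
    stopTime c (iterRegen c L (k + 1) ξ) = ⊤ := by
  have := h k (by omega)
  rw [iterRegen, Function.iterate_succ_apply']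
  exact stopTime_afterRegen this

lemma fresh_regenTimes {k : ℕ} (h : ξ ∈ regenFinite c L (k + 1)) :
    Fresh L ξ (regenTimes c L (k + 1) ξ) := by
  induction k generalizing ξ with
  | zero =>
    obtain ⟨n, hn⟩ := ENat.ne_top_iff_exists.1 (h 0 (by omega))
    have hn : (n : ℕ∞) = regen c L ξ := hn
    rw [regenTimes_succ', regenTimes, Finset.range_zero, Finset.sum_empty, add_zero, ← hn]
    exact Fresh.of_regen hn.symm
  | succ k ih =>
    obtain ⟨h1, h2⟩ := (regenFinite_succ_iff _).1 h
    obtain ⟨n, hn⟩ := ENat.ne_top_iff_exists.1 h1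
    have h3 := ih h2
    rw [regenTimes_succ', ← hn]
    have e : afterRegen c L ξ = shiftSeq n ξ := by rw [afterRegen, ← hn]; rfl
    rw [e] at h3 ⊢
    exact Fresh.of_shift (fun i hi => (Fresh.of_regen hn.symm).record hi) h3

/-- Replacing the future after a regeneration time by another one with `R = ∞` does not change the
regeneration times up to this time. -/
lemma regen_swap {k : ℕ} (h : ξ ∈ regenFinite c L k) (hη : η ∈ cyl (regenTimes c L k ξ) ξ)
    (htop : stopTime c (shiftSeq (regenTimes c L k ξ) η) = ⊤) :
    (∀ i < k, regen c L (iterRegen c L i η) = regen c L (iterRegen c L i ξ)) ∧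
      (stopTime c ξ = ⊤ → stopTime c η = ⊤) := by
  induction k generalizing ξ η with
  | zero => exact ⟨fun i hi => absurd hi (by omega), fun _ => by simpa [regenTimes] using htop⟩
  | succ k ih =>
    obtain ⟨h1, h2⟩ := (regenFinite_succ_iff _).1 h
    obtain ⟨n, hn⟩ := ENat.ne_top_iff_exists.1 h1
    have e : afterRegen c L ξ = shiftSeq n ξ := by rw [afterRegen, ← hn]; rfl
    have hT := regenTimes_succ' (c := c) (L := L) (ξ := ξ) k
    rw [← hn] at hT
    simp only [ENat.toNat_natCast] at hT
    rw [hT] at hη htop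
    rw [← shiftSeq_shiftSeq] at htop
    have hη2 := shiftSeq_mem_cyl hη
    rw [← e] at hη2
    obtain ⟨ih1, ih2⟩ := ih h2 hη2 htop
    -- The second conclusion of the induction hypothesis, applied after the first regeneration,
    -- gives R = ∞ there for η. This is what keeps n a regeneration time of η.
    have htop' := ih2 (stopTime_afterRegen h1)
    have hη' : η ∈ cyl n ξ := cyl_anti (by omega) _ hη
    have hreg := regen_congr hn.symm hη' htop'
    have e' : afterRegen c L η = shiftSeq n η := by rw [afterRegen, hreg]; rfl
    refine ⟨fun i hi => ?_, fun hξ => ?_⟩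
    · rcases i with _ | i
      · change regen c L η = regen c L ξ
        rw [hreg, hn]
      · rw [iterRegen_succ, iterRegen_succ, e']
        exact ih1 i (by omega)
    · refine stopTime_eq_top_of_record (n := n) ?_ (fun m hm => ?_) htop'
      · exact determined_le_stopTime c n ξ (by rw [Set.mem_ofPred, hξ]; exact le_top) hη'
      · exact ((Fresh.of_regen hn.symm).congr hη').record hm

lemma regenTimes_swap {k : ℕ} (h : ∀ i < k, regen c L (iterRegen c L i η) =
    regen c L (iterRegen c L i ξ)) {j : ℕ} (hj : j ≤ k) :
    regenTimes c L j η = regenTimes c L j ξ :=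
  Finset.sum_congr rfl fun i hi => by rw [h i ((Finset.mem_range.1 hi).trans_le hj)]

end

lemma measurable_regen (c : ℝ) (L : ℕ) : Measurable (regen c L : (ℕ → Letter d) → ℕ∞) := by
  have hn : ∀ n : ℕ, MeasurableSet (regen c L ⁻¹' {(n : ℕ∞)} : Set (ℕ → Letter d)) := by
    intro n
    have : (regen c L ⁻¹' {(n : ℕ∞)} : Set (ℕ → Letter d)) =
        (⋃ k, {ξ | attempt c L ξ k = n}) ∩ shiftSeq n ⁻¹' noStop c := by
      ext ξ
      simp only [Set.mem_preimage, Set.mem_singleton_iff, regen_eq_coe_iff, Set.mem_inter_iff,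
        Set.mem_iUnion, Set.mem_ofPred, noStop]
    rw [this]
    exact (MeasurableSet.iUnion fun k => (determined_attempt_eq c L k n).measurableSet).inter
      (measurable_shiftSeq n (measurableSet_noStop c))
  refine measurable_to_countable' fun x => ?_
  induction x using ENat.recTopCoe with
  | coe n => exact hn n
  | top =>
    have : (regen c L ⁻¹' {⊤} : Set (ℕ → Letter d)) = (⋃ n : ℕ, regen c L ⁻¹' {(n : ℕ∞)})ᶜ := by
      ext ξ
      simp only [Set.mem_preimage, Set.mem_singleton_iff, Set.mem_compl_iff, Set.mem_iUnion]
      rw [← not_iff_not, not_not, ← ne_eq, ENat.ne_top_iff_exists]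
      exact ⟨fun ⟨n, h⟩ => ⟨n, h.symm⟩, fun ⟨n, h⟩ => ⟨n, h.symm⟩⟩
    rw [this]
    exact (MeasurableSet.iUnion hn).compl

lemma measurable_afterRegen (c : ℝ) (L : ℕ) :
    Measurable (afterRegen c L : (ℕ → Letter d) → ℕ → Letter d) := by
  refine measurable_pi_lambda _ fun i => ?_
  have h1 : Measurable fun p : ℕ × (ℕ → Letter d) => p.2 (p.1 + i) :=
    measurable_from_prod_countable_right fun n => measurable_pi_apply (n + i)
  have h2 : Measurable fun x : ℕ∞ => x.toNat := measurable_from_top.mono le_top le_rfl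
  exact h1.comp ((h2.comp (measurable_regen c L)).prodMk measurable_id)

lemma measurable_iterRegen (c : ℝ) (L k : ℕ) :
    Measurable (iterRegen c L k : (ℕ → Letter d) → ℕ → Letter d) :=
  (measurable_afterRegen c L).iterate k

end RWRE

/-! ### Existence of regeneration times and near-independence across them -/

namespace RWRE

variable {d : ℕ} [NeZero d]

namespace IsMixingWalk

variable {q : ℝ≥0∞} {μ : Measure (ℕ → Letter d)} {c : ℝ} {D : ℕ → ℝ} {r L : ℕ}

/-- The mixing estimate after a random time at which a fresh run ends. -/
lemma stopping_mixing [IsProbabilityMeasure μ] (hD : IsRate μ c D r) (hL : r ≤ L)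
    {A : Set (ℕ → Letter d)} (σ : (ℕ → Letter d) → ℕ)
    (hA : ∀ ξ ∈ A, ∀ η ∈ cyl (σ ξ) ξ, η ∈ A ∧ σ η = σ ξ) (hf : ∀ ξ ∈ A, Fresh L ξ (σ ξ))
    {B : Set (ℕ → Letter d)} (hB : MeasurableSet B) (hBR : B ⊆ noStop c) :
    μ (A ∩ {ξ | shiftSeq (σ ξ) ξ ∈ B}) ≤ ENNReal.ofReal (D L) * (μ A * μ B) ∧
      μ A * μ B ≤ ENNReal.ofReal (D L) * μ (A ∩ {ξ | shiftSeq (σ ξ) ξ ∈ B}) := by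
  have hAm := measurableSet_of_stopping σ hA
  have hcyl : ∀ ξ ∈ A, (μ.restrict {ξ | shiftSeq (σ ξ) ξ ∈ B}) (cyl (σ ξ) ξ) =
      μ (cyl (σ ξ) ξ ∩ shiftSeq (σ ξ) ⁻¹' B) := by
    intro ξ hξ
    rw [Measure.restrict_apply (measurableSet_cyl _ _)]
    congr 1
    ext η
    refine and_congr_right fun hη => ?_
    rw [Set.mem_ofPred, (hA ξ hξ η hη).2]
    rfl
  rw [← Measure.restrict_apply hAm]
  constructor
  · have := measure_le_of_stopping (μ := μ.restrict {ξ | shiftSeq (σ ξ) ξ ∈ B})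
      (ν := (ENNReal.ofReal (D L) * μ B) • μ) σ hA fun ξ hξ => by
        rw [hcyl ξ hξ, Measure.smul_apply, smul_eq_mul, mul_assoc, mul_comm (μ B)]
        exact (fresh_mixing hD hL (hf ξ hξ) hB hBR).1
    rwa [Measure.smul_apply, smul_eq_mul, mul_assoc, mul_comm (μ B)] at this
  · have := measure_le_of_stopping (μ := μ B • μ)
      (ν := ENNReal.ofReal (D L) • μ.restrict {ξ | shiftSeq (σ ξ) ξ ∈ B}) σ hA fun ξ hξ => by
        rw [Measure.smul_apply, smul_eq_mul, Measure.smul_apply, smul_eq_mul, hcyl ξ hξ,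
          mul_comm (μ B)]
        exact (fresh_mixing hD hL (hf ξ hξ) hB hBR).2
    rwa [Measure.smul_apply, smul_eq_mul, Measure.smul_apply, smul_eq_mul,
      mul_comm (μ B)] at this

lemma IsRate.ofReal_pos (hD : IsRate μ c D r) (L : ℕ) : 1 < ENNReal.ofReal (D L) := by
  rw [← ENNReal.ofReal_one]
  exact (ENNReal.ofReal_lt_ofReal_iff (by linarith [hD.1 L])).2 (hD.1 L)

/-- An attempt starts at the end of a fresh run, so given its past it succeeds with probability at
least μ(R = ∞)/D(L). The ends of the attempts therefore stay finite with geometrically decaying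
probability. -/
lemma measure_attemptEnd_succ_le [IsProbabilityMeasure μ] (hD : IsRate μ c D r) (hL : r ≤ L)
    (k : ℕ) : μ {ξ | attemptEnd c L ξ (k + 1) ≠ ⊤} ≤
      (1 - μ (noStop c) / ENNReal.ofReal (D L)) * μ {ξ | attemptEnd c L ξ k ≠ ⊤} := by
  set A : Set (ℕ → Letter d) := {ξ | attempt c L ξ k ≠ ⊤} with hA
  set σ : (ℕ → Letter d) → ℕ := fun ξ => (attempt c L ξ k).toNat with hσ
  have hcl : ∀ ξ ∈ A, ∀ η ∈ cyl (σ ξ) ξ, η ∈ A ∧ σ η = σ ξ := by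
    intro ξ hξ η hη
    obtain ⟨n, hn⟩ := ENat.ne_top_iff_exists.1 hξ
    have hn : attempt c L ξ k = n := hn.symm
    have hσn : σ ξ = n := by simp [hσ, hn]
    rw [hσn] at hη ⊢
    have := determined_attempt_eq c L k n ξ hn hη
    rw [Set.mem_ofPred] at this
    exact ⟨by rw [hA, Set.mem_ofPred, this]; exact ENat.natCast_ne_top n, by simp [hσ, this]⟩
  have hf : ∀ ξ ∈ A, Fresh L ξ (σ ξ) := fun ξ hξ =>
    Fresh.of_attempt (k := k) (c := c) (ENat.natCast_toNat hξ).symm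
  have hmix := (stopping_mixing hD hL σ hcl hf (measurableSet_noStop c) subset_rfl).2
  have hAm := measurableSet_of_stopping σ hcl
  set E : Set (ℕ → Letter d) := A ∩ {ξ | shiftSeq (σ ξ) ξ ∈ noStop c} with hE
  have hD0 : ENNReal.ofReal (D L) ≠ 0 := (zero_lt_one.trans (hD.ofReal_pos L)).ne'
  have hEge : μ A * (μ (noStop c) / ENNReal.ofReal (D L)) ≤ μ E := by
    rw [← mul_div_assoc]
    exact ENNReal.div_le_of_le_mul' hmix
  have hsub : {ξ | attemptEnd c L ξ (k + 1) ≠ ⊤} ⊆ A \ E := by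
    intro ξ hξ
    have h1 : attempt c L ξ k ≠ ⊤ :=
      ne_top_of_le_ne_top hξ (attempt_le_attemptEnd_succ k)
    refine ⟨h1, fun h2 => hξ ?_⟩
    rw [attemptEnd_succ]
    have : stopTime c (shiftSeq (attempt c L ξ k).toNat ξ) = ⊤ := h2.2
    rw [this]; simp
  have hEm : MeasurableSet E := by
    have : E = ⋃ n, {ξ | attempt c L ξ k = (n : ℕ)} ∩ shiftSeq n ⁻¹' noStop c := by
      ext ξ
      simp only [hE, hA, hσ, Set.mem_inter_iff, Set.mem_ofPred, Set.mem_iUnion, Set.mem_preimage]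
      constructor
      · rintro ⟨h1, h2⟩
        exact ⟨_, (ENat.natCast_toNat h1).symm, h2⟩
      · rintro ⟨n, h1, h2⟩
        rw [h1]
        exact ⟨ENat.natCast_ne_top n, h2⟩
    rw [this]
    exact MeasurableSet.iUnion fun n => (determined_attempt_eq c L k n).measurableSet.inter
      (measurable_shiftSeq n (measurableSet_noStop c))
  calc μ {ξ | attemptEnd c L ξ (k + 1) ≠ ⊤} ≤ μ (A \ E) := measure_mono hsub
    _ = μ A - μ E := measure_sdiff Set.inter_subset_left hEm.nullMeasurableSet (measure_ne_top _ _)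
    _ ≤ μ A - μ A * (μ (noStop c) / ENNReal.ofReal (D L)) := tsub_le_tsub_left hEge _
    _ = (1 - μ (noStop c) / ENNReal.ofReal (D L)) * μ A := by
        rw [mul_comm _ (μ A), ENNReal.mul_sub (fun _ _ => measure_ne_top _ _), mul_one]
    _ ≤ _ := by
        gcongr
        intro ξ hξ
        exact ne_top_of_le_ne_top hξ (attemptEnd_le_attempt k)

lemma ae_exists_attemptEnd_eq_top [IsProbabilityMeasure μ] (hD : IsRate μ c D r) (hL : r ≤ L)
    (hρ : μ (noStop c) ≠ 0) : ∀ᵐ ξ ∂μ, ∃ k, attemptEnd c L ξ k = ⊤ := by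
  set θ : ℝ≥0∞ := 1 - μ (noStop c) / ENNReal.ofReal (D L) with hθ
  have hθ1 : θ < 1 := ENNReal.sub_lt_self ENNReal.one_ne_top one_ne_zero
    (ENNReal.div_pos hρ ENNReal.ofReal_ne_top).ne'
  have hle : ∀ k, μ {ξ | attemptEnd c L ξ k ≠ ⊤} ≤ θ ^ k := by
    intro k
    induction k with
    | zero => rw [pow_zero]; exact prob_le_one
    | succ k ih =>
      refine (measure_attemptEnd_succ_le hD hL k).trans ?_
      rw [pow_succ']
      gcongr
  rw [ae_iff]
  push Not
  refine le_antisymm (ge_of_tendsto' (ENNReal.tendsto_pow_atTop_nhds_zero_of_lt_one hθ1)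
    fun k => le_trans (measure_mono fun ξ hξ => ?_) (hle k)) zero_le
  exact hξ k

/-- If `R = ∞` has positive probability, then a walk that is unbounded above has a finite
regeneration time. -/
lemma ae_regen_ne_top (h : IsMixingWalk q μ) (hD : IsRate μ c D r) (hL : r ≤ L)
    (hρ : μ (noStop c) ≠ 0) :
    ∀ᵐ ξ ∂μ, (∀ b : ℤ, ∃ n, b ≤ height ξ n) → regen c L ξ ≠ ⊤ := by
  classical
  have := h.isProbabilityMeasure
  filter_upwards [ae_exists_attemptEnd_eq_top hD hL hρ, h.ae_frequently_fresh L] with ξ h1 h2 hub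
  have hspec := Nat.find_spec h1
  -- The end just before the first infinite one is finite. Since the walk is unbounded, a fresh run
  -- follows it, so the next attempt does start and its infinite end means success.
  obtain ⟨k, hk⟩ : ∃ k, Nat.find h1 = k + 1 := Nat.exists_eq_succ_of_ne_zero fun h0 => by
    rw [h0, attemptEnd_zero] at hspec; exact absurd hspec (by simp)
  have hne := Nat.find_min h1 (m := k) (by omega)
  rw [hk] at hspec
  obtain ⟨m, hm⟩ := ENat.ne_top_iff_exists.1 hne
  obtain ⟨n, hn, hf⟩ := frequently_atTop.1 (h2 hub) m
  have hS : attempt c L ξ k ≤ n := by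
    rw [attempt_eq_firstTime]
    refine firstTime_le_iff.2 ⟨n, le_rfl, ?_, hf⟩
    rw [← hm]; exact_mod_cast hn
  have hS' : attempt c L ξ k < ⊤ := hS.trans_lt (ENat.natCast_lt_top n)
  exact ne_top_of_le_ne_top hS'.ne (regen_lt_top_of_attemptEnd hS' hspec)

lemma tendsto_height_of_regen {ξ : ℕ → Letter d} (h : regen c L ξ ≠ ⊤) :
    Tendsto (height ξ) atTop atTop := by
  have h1 := tendsto_height_of_noStop (stopTime_afterRegen h)
  simp only [afterRegen] at h1
  set n := (regen c L ξ).toNat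
  have h2 : height (shiftSeq n ξ) = fun i => height ξ (n + i) - height ξ n :=
    funext fun i => height_shift ξ n i
  rw [h2] at h1
  have h3 := tendsto_atTop_add_const_right _ (height ξ n) h1
  simp only [sub_add_cancel] at h3
  rw [← tendsto_add_atTop_iff_nat n]
  simpa only [add_comm] using h3

/-- A walk that is unbounded above regenerates and so tends to ∞; positive probability of R = ∞ thus
excludes oscillation. -/
lemma ae_tendsto_or_tendsto (h : IsMixingWalk q μ) (hρ : μ (noStop c) ≠ 0) :
    ∀ᵐ ξ ∂μ, Tendsto (height ξ) atTop atTop ∨ Tendsto (fun n => -height ξ n) atTop atTop := by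
  obtain ⟨ξ₀, hξ₀⟩ := nonempty_of_measure_ne_zero hρ
  obtain ⟨D, r, hD⟩ := h.exists_isRate (one_le_of_stopTime_pos (by
    rw [show stopTime c ξ₀ = ⊤ from hξ₀]; exact le_top))
  filter_upwards [h.ae_unbounded_or_tendsto, h.ae_regen_ne_top hD le_rfl hρ] with ξ h1 h2
  exact h1.imp (fun hub => tendsto_height_of_regen (h2 hub)) id

lemma unbounded_of_tendsto {ξ : ℕ → Letter d} (h : Tendsto (height ξ) atTop atTop) (b : ℤ) :
    ∃ n, b ≤ height ξ n := (h.eventually_ge_atTop b).exists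

/-- The letters after a regeneration time are almost independent of those before, and their law
is almost the law of the walk conditioned on `R = ∞`. -/
lemma regen_mixing [IsProbabilityMeasure μ] (hD : IsRate μ c D r) (hL : r ≤ L) {k : ℕ}
    {A : Set (ℕ → Letter d)} (hAm : MeasurableSet A) (hA : A ⊆ regenFinite c L k)
    (htop : ∀ ξ ∈ A, stopTime c (iterRegen c L k ξ) = ⊤)
    (hswap : ∀ ξ ∈ A, ∀ η ∈ cyl (regenTimes c L k ξ) ξ,
      stopTime c (shiftSeq (regenTimes c L k ξ) η) = ⊤ → η ∈ A)
    {B : Set (ℕ → Letter d)} (hB : MeasurableSet B) (hBR : B ⊆ noStop c) :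
    μ (noStop c) * μ (A ∩ iterRegen c L k ⁻¹' B) ≤
        ENNReal.ofReal (D L) ^ 2 * (μ A * μ B) ∧
      μ A * μ B ≤ ENNReal.ofReal (D L) ^ 2 * (μ (noStop c) * μ (A ∩ iterRegen c L k ⁻¹' B)) := by
  have h1D := (hD.ofReal_pos L).le
  rcases Nat.eq_zero_or_pos k with rfl | hk
  · -- then `A` is empty or the whole event
    have hA' : A = ∅ ∨ A = noStop c := by
      rcases A.eq_empty_or_nonempty with h | ⟨ξ, hξ⟩
      · exact Or.inl h
      · refine Or.inr (Set.Subset.antisymm (fun ξ hξ => htop ξ hξ) fun η hη => ?_)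
        refine hswap ξ hξ η (fun i hi => absurd hi (by simp [regenTimes])) ?_
        rw [regenTimes, Finset.range_zero, Finset.sum_empty, shiftSeq_zero]
        exact hη
    have hpre : iterRegen c L 0 ⁻¹' B = B := rfl
    rw [hpre]
    rcases hA' with rfl | rfl
    · simp
    · rw [Set.inter_eq_self_of_subset_right hBR]
      have : (1 : ℝ≥0∞) ≤ ENNReal.ofReal (D L) ^ 2 := one_le_pow₀ h1D
      exact ⟨le_mul_of_one_le_left' this, le_mul_of_one_le_left' this⟩
  obtain ⟨k, rfl⟩ := Nat.exists_eq_succ_of_ne_zero hk.ne'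
  -- Prefixes of length n of elements of A whose last regeneration time considered is n. They depend
  -- on n letters only, and by the swapping property A restricted to this time is W n together with
  -- R = ∞ after n. This splits the non-causal event A into a past part and a future part.
  set W : ℕ → Set (ℕ → Letter d) := fun n =>
    {ξ | ∃ ξ' ∈ A, regenTimes c L (k + 1) ξ' = n ∧ ξ ∈ cyl n ξ'} with hW
  have hWd : ∀ n, Determined n (W n) := by
    rintro n ξ ⟨ξ', h1, h2, h3⟩ η hη
    exact ⟨ξ', h1, h2, by rw [← cyl_eq_of_mem le_rfl h3]; exact hη⟩
  have hWf : ∀ n, ∀ ξ ∈ W n, Fresh L ξ n := by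
    rintro n ξ ⟨ξ', h1, rfl, h3⟩
    exact (fresh_regenTimes (hA h1)).congr h3
  have hmix : ∀ n, ∀ {B : Set (ℕ → Letter d)}, MeasurableSet B → B ⊆ noStop c →
      μ (W n ∩ shiftSeq n ⁻¹' B) ≤ ENNReal.ofReal (D L) * (μ (W n) * μ B) ∧
      μ (W n) * μ B ≤ ENNReal.ofReal (D L) * μ (W n ∩ shiftSeq n ⁻¹' B) := fun n B hB hBR =>
    stopping_mixing hD hL (fun _ => n) (fun ξ hξ η hη => ⟨hWd n ξ hξ hη, rfl⟩) (hWf n) hB hBR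
  have hWA : ∀ n, ∀ ξ ∈ W n, shiftSeq n ξ ∈ noStop c →
      ξ ∈ A ∧ regenTimes c L (k + 1) ξ = n := by
    rintro n ξ ⟨ξ', h1, rfl, h3⟩ hs
    exact ⟨hswap ξ' h1 ξ h3 hs,
      regenTimes_swap (regen_swap (hA h1) h3 hs).1 le_rfl⟩
  have hdec : ∀ {B : Set (ℕ → Letter d)}, B ⊆ noStop c →
      A ∩ iterRegen c L (k + 1) ⁻¹' B = ⋃ n, W n ∩ shiftSeq n ⁻¹' B := by
    intro B hBR
    ext ξ
    simp only [Set.mem_inter_iff, Set.mem_preimage, Set.mem_iUnion]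
    constructor
    · rintro ⟨h1, h2⟩
      exact ⟨_, ⟨ξ, h1, rfl, mem_cyl_self _ _⟩, by rwa [← iterRegen_eq_shiftSeq]⟩
    · rintro ⟨n, h1, h2⟩
      obtain ⟨h3, h4⟩ := hWA n ξ h1 (hBR h2)
      exact ⟨h3, by rwa [iterRegen_eq_shiftSeq, h4]⟩
  have hsum : ∀ {B : Set (ℕ → Letter d)}, MeasurableSet B → B ⊆ noStop c →
      μ (A ∩ iterRegen c L (k + 1) ⁻¹' B) = ∑' n, μ (W n ∩ shiftSeq n ⁻¹' B) := by
    intro B hB hBR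
    rw [hdec hBR, measure_iUnion]
    · intro m n hmn
      refine Set.disjoint_left.2 fun ξ h1 h2 => hmn ?_
      rw [← (hWA m ξ h1.1 (hBR h1.2)).2, ← (hWA n ξ h2.1 (hBR h2.2)).2]
    · exact fun n => (hWd n).measurableSet.inter (measurable_shiftSeq n hB)
  have hAeq : μ A = ∑' n, μ (W n ∩ shiftSeq n ⁻¹' noStop c) := by
    rw [← hsum (measurableSet_noStop c) subset_rfl]
    congr 1
    exact (Set.inter_eq_self_of_subset_left fun ξ hξ => htop ξ hξ).symm
  rw [hsum hB hBR, hAeq]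
  set K := ENNReal.ofReal (D L)
  constructor
  -- One factor D(L) compares the future event B, the other the future event R = ∞ contained in A.
  · rw [← ENNReal.tsum_mul_left, ← ENNReal.tsum_mul_right, ← ENNReal.tsum_mul_left]
    refine ENNReal.tsum_le_tsum fun n => ?_
    calc μ (noStop c) * μ (W n ∩ shiftSeq n ⁻¹' B)
        ≤ μ (noStop c) * (K * (μ (W n) * μ B)) := by gcongr; exact (hmix n hB hBR).1
      _ = K * (μ (W n) * μ (noStop c)) * μ B := by ring
      _ ≤ K * (K * μ (W n ∩ shiftSeq n ⁻¹' noStop c)) * μ B :=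
          mul_le_mul_left (mul_le_mul_right (hmix n (measurableSet_noStop c) subset_rfl).2 _) _
      _ = _ := by ring
  · rw [← ENNReal.tsum_mul_left, ← ENNReal.tsum_mul_right, ← ENNReal.tsum_mul_left]
    refine ENNReal.tsum_le_tsum fun n => ?_
    calc μ (W n ∩ shiftSeq n ⁻¹' noStop c) * μ B
        ≤ (K * (μ (W n) * μ (noStop c))) * μ B := by
          gcongr; exact (hmix n (measurableSet_noStop c) subset_rfl).1
      _ = K * (μ (noStop c) * (μ (W n) * μ B)) := by ring
      _ = K * μ (noStop c) * (μ (W n) * μ B) := by ring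
      _ ≤ K * μ (noStop c) * (K * μ (W n ∩ shiftSeq n ⁻¹' B)) :=
          mul_le_mul_right (hmix n hB hBR).2 _
      _ = _ := by ring

lemma measurableSet_regenFinite (c : ℝ) (L k : ℕ) :
    MeasurableSet (regenFinite c L k : Set (ℕ → Letter d)) := by
  have : (regenFinite c L k : Set (ℕ → Letter d)) =
      ⋂ i, ⋂ (_ : i < k), {ξ | regen c L (iterRegen c L i ξ) ≠ ⊤} := by
    ext ξ; simp [regenFinite]
  rw [this]
  refine MeasurableSet.iInter fun i => MeasurableSet.iInter fun _ => ?_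
  exact ((measurable_regen c L).comp (measurable_iterRegen c L i)) (MeasurableSet.of_discrete
    (s := {x : ℕ∞ | x ≠ ⊤}))

/-- A property that almost surely holds on `R = ∞` holds almost surely after the first
regeneration time. -/
lemma ae_afterRegen [IsProbabilityMeasure μ] (hD : IsRate μ c D r) (hL : r ≤ L)
    (hρ : μ (noStop c) ≠ 0) {p : (ℕ → Letter d) → Prop}
    (hp : ∀ᵐ ξ ∂μ, stopTime c ξ = ⊤ → p ξ) :
    ∀ᵐ ξ ∂μ, regen c L ξ ≠ ⊤ → p (afterRegen c L ξ) := by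
  set N := toMeasurable μ {ξ | ¬(stopTime c ξ = ⊤ → p ξ)} with hN
  have hN0 : μ N = 0 := by rw [hN, measure_toMeasurable]; exact ae_iff.1 hp
  have hB : MeasurableSet (N ∩ noStop c) :=
    (measurableSet_toMeasurable _ _).inter (measurableSet_noStop c)
  have := (regen_mixing hD hL (k := 1) (measurableSet_regenFinite c L 1) subset_rfl
    (fun ξ hξ => stopTime_iterRegen hξ)
    (fun ξ hξ η hη hs i hi => by rw [(regen_swap hξ hη hs).1 i hi]; exact hξ i hi)
    hB Set.inter_subset_right).1
  rw [measure_mono_null Set.inter_subset_left hN0, mul_zero, mul_zero, nonpos_iff_eq_zero,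
    mul_eq_zero, or_iff_right hρ] at this
  rw [ae_iff]
  refine measure_mono_null (fun ξ hξ => ?_) this
  rw [Set.mem_ofPred, Classical.not_imp] at hξ
  refine ⟨fun i hi => ?_, ?_, ?_⟩
  · obtain rfl : i = 0 := by omega
    exact hξ.1
  · exact subset_toMeasurable _ _ (by
      rw [Set.mem_ofPred, Classical.not_imp]; exact ⟨stopTime_afterRegen hξ.1, hξ.2⟩)
  · exact stopTime_afterRegen hξ.1

/-- On R = ∞ the walk tends to ∞ and so regenerates; R = ∞ holds again afterwards, and
`ae_afterRegen` carries the almost sure statement through the induction. -/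
lemma ae_regenFinite (h : IsMixingWalk q μ) (hD : IsRate μ c D r) (hL : r ≤ L)
    (hρ : μ (noStop c) ≠ 0) : ∀ᵐ ξ ∂μ, stopTime c ξ = ⊤ → ∀ k, ξ ∈ regenFinite c L k := by
  have := h.isProbabilityMeasure
  have h1 : ∀ᵐ ξ ∂μ, stopTime c ξ = ⊤ → regen c L ξ ≠ ⊤ := by
    filter_upwards [h.ae_regen_ne_top hD hL hρ] with ξ hξ htop
    exact hξ (unbounded_of_tendsto (tendsto_height_of_noStop htop))
  have h2 : ∀ k, ∀ᵐ ξ ∂μ, stopTime c ξ = ⊤ → ξ ∈ regenFinite c L k := by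
    intro k
    induction k with
    | zero => exact ae_of_all _ fun ξ _ i hi => absurd hi (by omega)
    | succ k ih =>
      filter_upwards [h1, ae_afterRegen hD hL hρ ih] with ξ h3 h4 htop
      exact (regenFinite_succ_iff k).2 ⟨h3 htop, h4 (h3 htop)⟩
  filter_upwards [ae_all_iff.2 h2] with ξ hξ htop k using hξ k htop

end IsMixingWalk

end RWRE

/-! ### Tail sums, hitting times and the renewal bound for the gain -/

namespace RWRE

lemma natCast_eq_tsum (n : ℕ) : (n : ℝ≥0∞) = ∑' t : ℕ, if t < n then 1 else 0 := by
  rw [tsum_eq_sum (s := Finset.range n) (fun t ht => if_neg (by simpa using ht)),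
    Finset.sum_congr rfl fun t ht => if_pos (Finset.mem_range.1 ht)]
  simp

lemma lintegral_ite_one {Ω : Type*} [MeasurableSpace Ω] (μ : Measure Ω) {p : Ω → Prop}
    [DecidablePred p] (hp : MeasurableSet {x | p x}) :
    ∫⁻ x, (if p x then 1 else 0) ∂μ = μ {x | p x} := by
  rw [← lintegral_indicator_one hp]
  congr 1
  funext x
  simp [Set.indicator]

/-- The mean of a variable with values in `ℕ` is the sum of its tails. -/
lemma lintegral_natCast {Ω : Type*} [MeasurableSpace Ω] (μ : Measure Ω) {V : Ω → ℕ}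
    (hV : Measurable V) : ∫⁻ x, (V x : ℝ≥0∞) ∂μ = ∑' t : ℕ, μ {x | t < V x} := by
  have hm : ∀ t : ℕ, MeasurableSet {x | t < V x} := fun t => hV measurableSet_Ioi
  simp only [natCast_eq_tsum (V _)]
  rw [lintegral_tsum fun t => (Measurable.ite (hm t) measurable_const measurable_const).aemeasurable]
  exact tsum_congr fun t => lintegral_ite_one μ (hm t)

variable {d : ℕ} [NeZero d]

lemma measurable_height (n : ℕ) : Measurable fun ξ : ℕ → Letter d => height ξ n :=
  measurable_to_countable' fun l => Determined.measurableSet (n := n) fun ξ hξ η hη => by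
    rw [Set.mem_preimage, height_congr hη le_rfl]; exact hξ

lemma measurable_height_of {τ : (ℕ → Letter d) → ℕ} (hτ : Measurable τ) :
    Measurable fun ξ : ℕ → Letter d => height ξ (τ ξ) := by
  have h1 : Measurable fun p : ℕ × (ℕ → Letter d) => height p.2 p.1 :=
    measurable_from_prod_countable_right fun n => measurable_height n
  exact h1.comp (hτ.prodMk measurable_id)

/-! ### Hitting times of levels -/

open Classical in
/-- The first time at which the walk is at level `l` or higher (`0` if there is none). -/
noncomputable def hit (l : ℤ) (ξ : ℕ → Letter d) : ℕ :=
  if h : ∃ n, l ≤ height ξ n then Nat.find h else 0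

/-- The level `l` is reached. -/
def Reaches (l : ℤ) : Set (ℕ → Letter d) := {ξ | ∃ n, l ≤ height ξ n}

section

variable {ξ η : ℕ → Letter d} {l : ℤ}

lemma le_height_hit (h : ξ ∈ Reaches l) : l ≤ height ξ (hit l ξ) := by
  classical
  rw [hit, dif_pos (show ∃ n, l ≤ height ξ n from h)]
  exact Nat.find_spec (p := fun n => l ≤ height ξ n) h

lemma height_lt_of_lt_hit {m : ℕ} (hm : m < hit l ξ) : height ξ m < l := by
  classical
  unfold hit at hm
  split_ifs at hm with h
  · exact not_le.1 (Nat.find_min h hm)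
  · omega

lemma hit_le {n : ℕ} (h : l ≤ height ξ n) : hit l ξ ≤ n := by
  classical
  rw [hit, dif_pos ⟨n, h⟩]
  exact Nat.find_min' _ h

lemma hit_eq_iff (h : ξ ∈ Reaches l) {n : ℕ} :
    hit l ξ = n ↔ l ≤ height ξ n ∧ ∀ m < n, height ξ m < l := by
  constructor
  · rintro rfl
    exact ⟨le_height_hit h, fun m hm => height_lt_of_lt_hit hm⟩
  · rintro ⟨h1, h2⟩
    refine le_antisymm (hit_le h1) (not_lt.1 fun hlt => ?_)
    exact absurd (le_height_hit h) (not_le.2 (h2 _ hlt))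

lemma height_hit (h : ξ ∈ Reaches l) (hl : 0 ≤ l) : height ξ (hit l ξ) = l := by
  refine le_antisymm ?_ (le_height_hit h)
  rcases Nat.eq_zero_or_pos (hit l ξ) with h0 | h0
  · rw [h0]; simpa using hl
  · obtain ⟨k, hk⟩ := Nat.exists_eq_succ_of_ne_zero h0.ne'
    have h1 := height_lt_of_lt_hit (ξ := ξ) (l := l) (m := k) (by omega)
    have h2 := height_succ_le ξ k
    rw [hk, Nat.succ_eq_add_one]; omega

lemma hit_congr (h : ξ ∈ Reaches l) (hη : η ∈ cyl (hit l ξ) ξ) :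
    η ∈ Reaches l ∧ hit l η = hit l ξ := by
  have h1 : l ≤ height η (hit l ξ) := by
    rw [height_congr hη le_rfl]; exact le_height_hit h
  have h2 : η ∈ Reaches l := ⟨_, h1⟩
  refine ⟨h2, (hit_eq_iff h2).2 ⟨h1, fun m hm => ?_⟩⟩
  rw [height_congr hη hm.le]
  exact height_lt_of_lt_hit hm

lemma hit_mono {l' : ℤ} (h : l ≤ l') (h' : ξ ∈ Reaches l') : hit l ξ ≤ hit l' ξ :=
  hit_le (h.trans (le_height_hit h'))

end

/-! ### The mean gain in level between two regeneration times -/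

/-- The level reached at the first regeneration time. -/
noncomputable def gain (c : ℝ) (L : ℕ) (ξ : ℕ → Letter d) : ℕ :=
  (height ξ (regen c L ξ).toNat).toNat

section

variable {c : ℝ} {L : ℕ} {ξ : ℕ → Letter d}

lemma measurable_toNat_regen (c : ℝ) (L : ℕ) :
    Measurable fun ξ : ℕ → Letter d => (regen c L ξ).toNat :=
  (measurable_from_top.mono le_top le_rfl : Measurable fun x : ℕ∞ => x.toNat).comp
    (measurable_regen c L)

lemma measurable_gain (c : ℝ) (L : ℕ) : Measurable (gain c L : (ℕ → Letter d) → ℕ) :=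
  (measurable_from_top : Measurable Int.toNat).comp
    (measurable_height_of (measurable_toNat_regen c L))

lemma measurable_regenTimes (c : ℝ) (L k : ℕ) :
    Measurable (regenTimes c L k : (ℕ → Letter d) → ℕ) :=
  Finset.measurable_sum _ fun i _ => (measurable_toNat_regen c L).comp (measurable_iterRegen c L i)

lemma Fresh.le_height {n : ℕ} (h : Fresh L ξ n) : (L : ℤ) ≤ height ξ n := by
  have h1 := h.height_add le_rfl
  rw [Nat.sub_add_cancel h.1] at h1
  have h2 : 0 ≤ height ξ (n - L) := by
    rcases Nat.eq_zero_or_pos (n - L) with h0 | h0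
    · rw [h0]; simp
    · have := h.2.1 0 h0; simp at this; exact this.le
  omega

lemma natCast_gain (h : regen c L ξ ≠ ⊤) : (gain c L ξ : ℤ) = height ξ (regen c L ξ).toNat := by
  have := (Fresh.of_regen (ENat.natCast_toNat h).symm).le_height
  rw [gain, Int.toNat_of_nonneg (by omega)]

lemma regenTimes_succ (k : ℕ) : regenTimes c L (k + 1) ξ =
    regenTimes c L k ξ + (regen c L (iterRegen c L k ξ)).toNat := by
  rw [regenTimes, Finset.sum_range_succ]; rfl

lemma height_regenTimes_succ {k : ℕ} (h : ξ ∈ regenFinite c L (k + 1)) :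
    height ξ (regenTimes c L (k + 1) ξ) =
      height ξ (regenTimes c L k ξ) + gain c L (iterRegen c L k ξ) := by
  rw [natCast_gain (h k (by omega)), iterRegen_eq_shiftSeq k, height_shift, regenTimes_succ,
    iterRegen_eq_shiftSeq k]
  ring

lemma regenFinite_anti {j k : ℕ} (hjk : j ≤ k) (h : ξ ∈ regenFinite c L k) :
    ξ ∈ regenFinite c L j := fun i hi => h i (hi.trans_le hjk)

lemma height_regenTimes {k : ℕ} (h : ξ ∈ regenFinite c L k) :
    height ξ (regenTimes c L k ξ) = ∑ i ∈ Finset.range k, (gain c L (iterRegen c L i ξ) : ℤ) := by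
  induction k with
  | zero => simp [regenTimes]
  | succ k ih =>
    rw [height_regenTimes_succ h, ih (regenFinite_anti (by omega) h), Finset.sum_range_succ]

lemma height_regenTimes_mono {j k : ℕ} (hjk : j ≤ k) (h : ξ ∈ regenFinite c L k) :
    height ξ (regenTimes c L j ξ) ≤ height ξ (regenTimes c L k ξ) := by
  rw [height_regenTimes h, height_regenTimes (regenFinite_anti hjk h)]
  exact Finset.sum_le_sum_of_subset_of_nonneg (Finset.range_mono hjk) fun i _ _ => by positivity

lemma le_toNat_regen (h : regen c L ξ ≠ ⊤) : L ≤ (regen c L ξ).toNat :=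
  (Fresh.of_regen (ENat.natCast_toNat h).symm).1

lemma le_regenTimes (hL : 1 ≤ L) {k : ℕ} (h : ξ ∈ regenFinite c L k) : k ≤ regenTimes c L k ξ := by
  induction k with
  | zero => simp
  | succ k ih =>
    rw [regenTimes_succ]
    have := ih (regenFinite_anti (by omega) h)
    have := le_toNat_regen (h k (by omega))
    omega

/-- Near every fresh run that is followed by `R = ∞`, there is a regeneration time. -/
lemma exists_regenTimes_near (hL : 1 ≤ L) (h : ∀ k, ξ ∈ regenFinite c L k) {n : ℕ}
    (hf : Fresh L ξ n) (htop : stopTime c (shiftSeq n ξ) = ⊤) :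
    ∃ k, height ξ n - L < height ξ (regenTimes c L k ξ) ∧
      height ξ (regenTimes c L k ξ) ≤ height ξ n := by
  classical
  have hex : ∃ k, n < regenTimes c L (k + 1) ξ := ⟨n, by have := le_regenTimes hL (h (n + 1)); omega⟩
  have h1 := Nat.find_spec hex
  set k := Nat.find hex with hk
  have h2 : regenTimes c L k ξ ≤ n := by
    rcases Nat.eq_zero_or_pos k with h0 | h0
    · rw [h0]; simp [regenTimes]
    · have := Nat.find_min hex (m := k - 1) (by omega)
      rw [Nat.sub_add_cancel h0] at this
      omega
  set T := regenTimes c L k ξ with hT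
  -- If the whole run lay after the regeneration time T, the walk restarted at T would regenerate by
  -- time n, against the choice of k. So T falls inside the run, where heights are known exactly.
  have h3 : n < T + L := by
    by_contra hlt
    have hf' := hf.shift_of_le (s := T) (by omega)
    have := regen_le_of_fresh hf' (by rw [shiftSeq_shiftSeq, Nat.add_sub_cancel' h2]; exact htop)
    have h4 : (regen c L (iterRegen c L k ξ)).toNat ≤ n - T := by
      rw [iterRegen_eq_shiftSeq]
      exact ENat.toNat_le_of_le_natCast this
    rw [regenTimes_succ] at h1
    omega
  obtain ⟨i, hi⟩ := Nat.exists_eq_add_of_le (show n - L ≤ T by omega)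
  have h5 := hf.height_add (i := i) (by have := hf.1; omega)
  have h6 := hf.height_add le_rfl
  rw [Nat.sub_add_cancel hf.1] at h6
  rw [← hi] at h5
  have := hf.1
  refine ⟨k, ?_, ?_⟩ <;> rw [← hT] <;> omega

end

namespace IsMixingWalk

variable {q : ℝ≥0∞} {μ : Measure (ℕ → Letter d)} {c : ℝ} {D : ℕ → ℝ} {r L : ℕ}

/-- The event that a fresh run ends at level `l + L`, with `R = ∞` before and after. -/
def renewalAt (c : ℝ) (L : ℕ) (l : ℤ) : Set (ℕ → Letter d) :=
  {ξ | stopTime c ξ = ⊤ ∧ ∃ n, Fresh L ξ n ∧ height ξ n = l + L ∧ stopTime c (shiftSeq n ξ) = ⊤}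

/-- The level l is reached before R with probability at least that of R = ∞; a run of L marked steps
e₁ costs q ^ L; the future then has R = ∞ up to the factor D(L). Every step of the run is a record,
so no violation occurs during it, and the three pieces combine to R = ∞ from the start. -/
lemma le_measure_renewalAt (h : IsMixingWalk q μ) (hc : 1 ≤ c) (hD : IsRate μ c D r) (hL : r ≤ L)
    {l : ℤ} (hl : 0 ≤ l) : q ^ L * μ (noStop c) * μ (noStop c) ≤
      ENNReal.ofReal (D L) * μ (renewalAt c L l) := by
  have := h.isProbabilityMeasure
  set A₀ : Set (ℕ → Letter d) := {ξ | ξ ∈ Reaches l ∧ (hit l ξ : ℕ∞) ≤ stopTime c ξ} with hA₀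
  have hcl₀ : ∀ ξ ∈ A₀, ∀ η ∈ cyl (hit l ξ) ξ, η ∈ A₀ ∧ hit l η = hit l ξ := by
    rintro ξ ⟨h1, h2⟩ η hη
    obtain ⟨h3, h4⟩ := hit_congr h1 hη
    refine ⟨⟨h3, ?_⟩, h4⟩
    rw [h4]
    exact determined_le_stopTime c _ ξ h2 hη
  set A : Set (ℕ → Letter d) := A₀ ∩ {ξ | ∀ i < L, ξ (hit l ξ + i) = upLetter d} with hA
  have hcl : ∀ ξ ∈ A, ∀ η ∈ cyl (hit l ξ + L) ξ, η ∈ A ∧ hit l η + L = hit l ξ + L := by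
    rintro ξ ⟨h1, h2⟩ η hη
    obtain ⟨h3, h4⟩ := hcl₀ ξ h1 η (cyl_anti (by omega) _ hη)
    refine ⟨⟨h3, fun i hi => ?_⟩, by rw [h4]⟩
    rw [h4, hη _ (by omega)]
    exact h2 i hi
  have hf : ∀ ξ ∈ A, Fresh L ξ (hit l ξ + L) := by
    rintro ξ ⟨⟨h1, h2⟩, h3⟩
    refine ⟨by omega, fun m hm => ?_, fun i hi1 hi2 => ?_⟩
    · rw [Nat.add_sub_cancel] at hm ⊢
      exact (height_lt_of_lt_hit hm).trans_le (le_height_hit h1)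
    · obtain ⟨j, rfl⟩ := Nat.exists_eq_add_of_le (show hit l ξ ≤ i by omega)
      exact h3 j (by omega)
  have hA₀m := measurableSet_of_stopping _ hcl₀
  have hAge : q ^ L * μ (noStop c) ≤ μ A := by
    have h1 : (q ^ L • μ) A₀ ≤
        (μ.restrict {ξ | ∀ i < L, ξ (hit l ξ + i) = upLetter d}) A₀ := by
      refine measure_le_of_stopping (hit l) hcl₀ fun ξ hξ => ?_
      rw [Measure.smul_apply, smul_eq_mul, Measure.restrict_apply (measurableSet_cyl _ _),
        ← h.measure_determined_inter_run (s := upLetter d) rfl (determined_cyl _ _)]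
      refine measure_mono fun η hη => ⟨hη.1, fun i hi => ?_⟩
      rw [(hcl₀ ξ hξ η hη.1).2]
      exact hη.2 i hi
    rw [Measure.smul_apply, smul_eq_mul, Measure.restrict_apply hA₀m] at h1
    refine le_trans ?_ h1
    gcongr
    intro ξ hξ
    exact ⟨unbounded_of_tendsto (tendsto_height_of_noStop hξ) l, by
      rw [show stopTime c ξ = ⊤ from hξ]; exact le_top⟩
  calc q ^ L * μ (noStop c) * μ (noStop c) ≤ μ A * μ (noStop c) := by gcongr
    _ ≤ _ := (stopping_mixing hD hL _ hcl hf (measurableSet_noStop c) subset_rfl).2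
    _ ≤ _ := by
      gcongr
      rintro ξ ⟨hξ, htop⟩
      have hf' := hf ξ hξ
      have hh := height_run hξ.2 le_rfl
      rw [height_hit hξ.1.1 hl] at hh
      refine ⟨?_, _, hf', hh, htop⟩
      refine stopTime_eq_top_of_record (n := hit l ξ + L) ?_ (fun m hm => hf'.record hm) htop
      have hstep : ∀ i ≤ L, ((hit l ξ + i : ℕ) : ℕ∞) ≤ stopTime c ξ := by
        intro i hi
        induction i with
        | zero => exact hξ.1.2
        | succ i ih =>
          refine le_stopTime_succ_of_record hc (ih (by omega)) fun m hm => ?_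
          change m < hit l ξ + i at hm
          change height ξ m < height ξ (hit l ξ + i)
          have h1 := height_run hξ.2 (show i ≤ L by omega)
          rcases lt_or_ge m (hit l ξ) with hlt | hge
          · have := height_lt_of_lt_hit hlt
            rw [h1, height_hit hξ.1.1 hl]; omega
          · obtain ⟨j, rfl⟩ := Nat.exists_eq_add_of_le hge
            rw [h1, height_run hξ.2 (show j ≤ L by omega)]
            omega
      exact hstep L le_rfl

/-- The mean gain in level is finite. -/
lemma lintegral_gain_lt_top (h : IsMixingWalk q μ) (hD : IsRate μ c D r) (hL : r ≤ L)
    (hL1 : 1 ≤ L) (hρ : μ (noStop c) ≠ 0) :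
    ∫⁻ ξ in noStop c, (gain c L ξ : ℝ≥0∞) ∂μ < ⊤ := by
  classical
  have := h.isProbabilityMeasure
  have hc : 1 ≤ c := by
    obtain ⟨ξ₀, hξ₀⟩ := nonempty_of_measure_ne_zero hρ
    exact one_le_of_stopTime_pos (by rw [show stopTime c ξ₀ = ⊤ from hξ₀]; exact le_top)
  set K := ENNReal.ofReal (D L) with hK
  set e₀ : ℝ≥0∞ := q ^ L * μ (noStop c) * μ (noStop c) / K with he₀
  have hK0 : K ≠ 0 := (zero_lt_one.trans (hD.ofReal_pos L)).ne'
  have he0 : e₀ ≠ 0 := by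
    rw [he₀]
    exact (ENNReal.div_pos (mul_ne_zero (mul_ne_zero (pow_ne_zero _ h.pos.ne') hρ) hρ)
      ENNReal.ofReal_ne_top).ne'
  set g : ℕ → ℝ≥0∞ := fun t => μ (noStop c ∩ {ξ | t < gain c L ξ}) with hg
  -- The k-th regeneration point lies in the b-th block of L levels. By `exists_regenTimes_near` a
  -- renewal in the block forces this for some k, so the probabilities sum over k to at least e₀.
  set X : ℕ → ℕ → Set (ℕ → Letter d) := fun k b => {ξ | stopTime c ξ = ⊤ ∧ ξ ∈ regenFinite c L k ∧
    (b * L : ℤ) < height ξ (regenTimes c L k ξ) ∧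
      height ξ (regenTimes c L k ξ) ≤ ((b + 1) * L : ℤ)} with hX
  have hXm : ∀ k b, MeasurableSet (X k b) := by
    intro k b
    have hh := measurable_height_of (measurable_regenTimes (d := d) c L k)
    exact (measurableSet_noStop c).inter ((measurableSet_regenFinite c L k).inter
      ((hh measurableSet_Ioi).inter (hh measurableSet_Iic)))
  have hgm : ∀ t, MeasurableSet (noStop c ∩ {ξ : ℕ → Letter d | t < gain c L ξ}) := fun t =>
    (measurableSet_noStop c).inter (measurable_gain c L measurableSet_Ioi)
  have hXsum : ∀ b, e₀ ≤ ∑' k, μ (X k b) := by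
    intro b
    refine (ENNReal.div_le_of_le_mul' (h.le_measure_renewalAt hc hD hL
      (l := (b * L : ℤ)) (by positivity))).trans ?_
    refine le_trans (measure_mono_ae ?_) (measure_iUnion_le fun k => X k b)
    filter_upwards [h.ae_regenFinite hD hL hρ] with ξ h1 h2
    obtain ⟨h3, n, h4, h5, h6⟩ := h2
    obtain ⟨k, h7, h8⟩ := exists_regenTimes_near hL1 (h1 h3) h4 h6
    rw [h5] at h7 h8
    refine Set.mem_iUnion.2 ⟨k, h3, h1 h3 k, by linarith, by linarith⟩
  have hmix : ∀ k b t, μ (X k b) * g t ≤ K ^ 2 * μ (X k b ∩ {ξ | t < gain c L (iterRegen c L k ξ)}) := by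
    intro k b t
    refine (regen_mixing hD hL (hXm k b) (fun ξ hξ => hξ.2.1) (fun ξ hξ => ?_)
      (fun ξ hξ η hη hs => ?_) (hgm t) Set.inter_subset_left).2.trans ?_
    · rcases k with _ | k
      · exact hξ.1
      · exact stopTime_iterRegen hξ.2.1
    · obtain ⟨h1, h2⟩ := regen_swap hξ.2.1 hη hs
      have h3 := regenTimes_swap h1 le_rfl
      have h4 := height_congr hη le_rfl
      refine ⟨h2 hξ.1, fun i hi => by rw [h1 i hi]; exact hξ.2.1 i hi, ?_⟩
      rw [h3, h4]
      exact hξ.2.2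
    · gcongr
      calc _ ≤ 1 * μ (X k b ∩ {ξ | t < gain c L (iterRegen c L k ξ)}) := by
            gcongr
            · exact prob_le_one
            · exact fun ξ hξ => hξ.2
        _ = _ := one_mul _
  -- Decomposition according to the last regeneration point at or below level BL. If it lies in
  -- block b and the next gain exceeds (B − b)L, then the next point lies above BL. These events are
  -- disjoint over k and b, so their probabilities sum to at most 1; near-independence of the next
  -- gain turns this into a bound on the tails that is uniform in B.
  have hbound : ∀ B : ℕ, e₀ * ∑ i ∈ Finset.range B, g ((i + 1) * L) ≤ K ^ 2 := by
    intro B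
    set Y : ℕ → ℕ → Set (ℕ → Letter d) := fun k b =>
      X k b ∩ {ξ | (B - b) * L < gain c L (iterRegen c L k ξ)} with hY
    have hYm : ∀ k b, MeasurableSet (Y k b) := fun k b => (hXm k b).inter
      (((measurable_gain c L).comp (measurable_iterRegen c L k)) measurableSet_Ioi)
    have hYp : ∀ k b ξ, b < B → ξ ∈ Y k b → ξ ∈ regenFinite c L (k + 1) ∧
        height ξ (regenTimes c L k ξ) ≤ (B * L : ℤ) ∧
        (B * L : ℤ) < height ξ (regenTimes c L (k + 1) ξ) := by
      rintro k b ξ hb ⟨⟨h1, h2, h3, h4⟩, h5⟩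
      have h6 : ξ ∈ regenFinite c L (k + 1) := by
        intro i hi
        rcases Nat.lt_succ_iff_lt_or_eq.1 hi with hi | rfl
        · exact h2 i hi
        · intro htop
          rw [Set.mem_ofPred, gain, htop] at h5
          simp at h5
      have hbB : ((B - b : ℕ) : ℤ) = B - b := by omega
      refine ⟨h6, h4.trans ?_, ?_⟩
      · have : ((b : ℤ) + 1) ≤ B := by omega
        gcongr
      · rw [height_regenTimes_succ h6]
        have h7 : (((B - b) * L : ℕ) : ℤ) < gain c L (iterRegen c L k ξ) := by exact_mod_cast h5
        push_cast at h7
        rw [hbB] at h7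
        linarith
    have hdisj : ∑ b ∈ Finset.range B, ∑' k, μ (Y k b) ≤ 1 := by
      have h1 : ∑ b ∈ Finset.range B, ∑' k, μ (Y k b) =
          ∑' p : (Finset.range B) × ℕ, μ (Y p.2 p.1) := by
        rw [ENNReal.tsum_prod (f := fun (b : Finset.range B) (k : ℕ) => μ (Y k b)), tsum_fintype,
          ← Finset.sum_coe_sort]
      rw [h1, ← measure_iUnion (μ := μ) (f := fun p : Finset.range B × ℕ => Y p.2 p.1) (fun p p' hne => ?_) fun p => hYm p.2 p.1]
      · exact prob_le_one
      · refine Set.disjoint_left.2 fun ξ hξ hξ' => hne ?_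
        obtain ⟨⟨b, hb⟩, k⟩ := p
        obtain ⟨⟨b', hb'⟩, k'⟩ := p'
        obtain ⟨h1, h2, h3⟩ := hYp k b ξ (Finset.mem_range.1 hb) hξ
        obtain ⟨h1', h2', h3'⟩ := hYp k' b' ξ (Finset.mem_range.1 hb') hξ'
        have hk : k = k' := by
          rcases lt_trichotomy k k' with hlt | heq | hlt
          · have := height_regenTimes_mono (show k + 1 ≤ k' by omega)
              (regenFinite_anti (by omega) h1')
            linarith
          · exact heq
          · have := height_regenTimes_mono (show k' + 1 ≤ k by omega)
              (regenFinite_anti (by omega) h1)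
            linarith
        subst hk
        obtain ⟨⟨-, -, h3, h4⟩, -⟩ := hξ
        obtain ⟨⟨-, -, h3', h4'⟩, -⟩ := hξ'
        simp only at h3 h4 h3' h4'
        have hL0 : (0 : ℤ) < L := by exact_mod_cast hL1
        have e1 : (b : ℤ) < b' + 1 := lt_of_mul_lt_mul_right (h3.trans_le h4') hL0.le
        have e2 : (b' : ℤ) < b + 1 := lt_of_mul_lt_mul_right (h3'.trans_le h4) hL0.le
        have : b = b' := by omega
        subst this
        rfl
    calc e₀ * ∑ i ∈ Finset.range B, g ((i + 1) * L)
        = ∑ b ∈ Finset.range B, e₀ * g ((B - b) * L) := by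
          rw [← Finset.sum_range_reflect, Finset.mul_sum]
          refine Finset.sum_congr rfl fun b hb => ?_
          have := Finset.mem_range.1 hb
          rw [show B - 1 - b + 1 = B - b by omega]
      _ ≤ ∑ b ∈ Finset.range B, ∑' k, K ^ 2 * μ (Y k b) := by
          refine Finset.sum_le_sum fun b _ => ?_
          refine (mul_le_mul_left (hXsum b) _).trans ?_
          rw [← ENNReal.tsum_mul_right]
          exact ENNReal.tsum_le_tsum fun k => hmix k b _
      _ = K ^ 2 * ∑ b ∈ Finset.range B, ∑' k, μ (Y k b) := by
          rw [Finset.mul_sum]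
          exact Finset.sum_congr rfl fun b _ => ENNReal.tsum_mul_left
      _ ≤ K ^ 2 * 1 := by gcongr
      _ = K ^ 2 := mul_one _
  have hsum : ∑' i, g ((i + 1) * L) ≤ K ^ 2 / e₀ := by
    rw [ENNReal.tsum_eq_iSup_nat]
    refine iSup_le fun B => ?_
    rw [ENNReal.le_div_iff_mul_le (Or.inl he0)
      (Or.inr (ENNReal.pow_ne_top ENNReal.ofReal_ne_top)), mul_comm]
    exact hbound B
  have hsum' : ∑' i, g (i * L) < ⊤ := by
    rw [tsum_eq_zero_add' ENNReal.summable]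
    refine ENNReal.add_lt_top.2 ⟨measure_lt_top _ _, ?_⟩
    exact hsum.trans_lt (ENNReal.div_lt_top (ENNReal.pow_ne_top ENNReal.ofReal_ne_top) he0)
  -- Only tails at multiples of L are controlled, and these determine the mean up to rounding to the
  -- next multiple.
  have hpt : ∀ n : ℕ, (n : ℝ≥0∞) ≤ L * ∑' i : ℕ, if i * L < n then 1 else 0 := by
    intro n
    have h1 : ∀ i < (n + L - 1) / L, i * L < n := by
      intro i hi
      have h2 : (i + 1) * L ≤ n + L - 1 := (Nat.le_div_iff_mul_le (by omega)).1 hi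
      rw [add_mul] at h2
      omega
    have h2 : n ≤ L * ((n + L - 1) / L) := by
      have := Nat.lt_mul_div_succ (n + L - 1) (show 0 < L by omega)
      rw [mul_add] at this
      omega
    calc (n : ℝ≥0∞) ≤ ((L * ((n + L - 1) / L) : ℕ) : ℝ≥0∞) := by exact_mod_cast h2
      _ = L * ∑ i ∈ Finset.range ((n + L - 1) / L), (if i * L < n then 1 else 0) := by
          rw [Finset.sum_congr rfl fun i hi => if_pos (h1 i (Finset.mem_range.1 hi))]
          simp
      _ ≤ _ := by gcongr; exact ENNReal.sum_le_tsum _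
  have hm : ∀ t : ℕ, MeasurableSet {ξ : ℕ → Letter d | t < gain c L ξ} := fun t =>
    measurable_gain c L measurableSet_Ioi
  calc ∫⁻ ξ in noStop c, (gain c L ξ : ℝ≥0∞) ∂μ
      ≤ ∫⁻ ξ in noStop c, L * ∑' i : ℕ, (if i * L < gain c L ξ then 1 else 0) ∂μ :=
        lintegral_mono fun ξ => hpt _
    _ = L * ∑' i, g (i * L) := by
        rw [lintegral_const_mul _ (Measurable.tsum fun i =>
          Measurable.ite (hm _) measurable_const measurable_const),
          lintegral_tsum fun i =>
            (Measurable.ite (hm _) measurable_const measurable_const).aemeasurable]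
        congr 1
        refine tsum_congr fun i => ?_
        rw [lintegral_ite_one _ (hm _), Measure.restrict_apply (hm _), Set.inter_comm]
    _ < ⊤ := ENNReal.mul_lt_top (ENNReal.natCast_lt_top L) hsum'

end IsMixingWalk

end RWRE

namespace RWRE

/-! ### A strong law of large numbers by stochastic domination -/

/-- The quantile function of G under Lebesgue measure on (0, 1]. Since G tends to 0, the infimum is
over a nonempty set for every x > 0, and the default value 0 does not matter. -/
lemma exists_measure_nat_tail {G : ℕ → ℝ≥0∞} (hG : Antitone G) (hG1 : ∀ t, G t ≤ 1)
    (h0 : Tendsto G atTop (𝓝 0)) :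
    ∃ ν : Measure ℕ, IsProbabilityMeasure ν ∧ ∀ t, ν (Set.Ioi t) = G t := by
  set Q : ℝ → ℕ := fun x => sInf {t | G t ≤ ENNReal.ofReal x} with hQ
  have hQlt : ∀ t x, t < Q x ↔ ENNReal.ofReal x < G t ∧ ∃ s, G s ≤ ENNReal.ofReal x := by
    intro t x
    constructor
    · intro h
      refine ⟨?_, ?_⟩
      · by_contra h1
        exact absurd (Nat.sInf_le (show t ∈ {t | G t ≤ ENNReal.ofReal x} from not_lt.1 h1))
          (not_le.2 h)
      · by_contra h1
        push Not at h1
        have : {t | G t ≤ ENNReal.ofReal x} = ∅ :=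
          Set.eq_empty_of_forall_notMem fun s hs => absurd hs (not_le.2 (h1 s))
        rw [hQ] at h
        simp only [this, Nat.sInf_empty] at h
        omega
    · rintro ⟨h1, s, hs⟩
      by_contra h2
      have h3 : G (Q x) ≤ ENNReal.ofReal x := Nat.sInf_mem (s := {t | G t ≤ ENNReal.ofReal x}) ⟨s, hs⟩
      exact absurd ((hG (not_lt.1 h2)).trans h3) (not_le.2 h1)
  have hpre : ∀ t, Q ⁻¹' Set.Ioi t =
      {x | ENNReal.ofReal x < G t} ∩ ⋃ s, {x | G s ≤ ENNReal.ofReal x} := by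
    intro t; ext x
    simp only [Set.mem_preimage, Set.mem_Ioi, hQlt, Set.mem_inter_iff, Set.mem_ofPred,
      Set.mem_iUnion]
  have hQm : Measurable Q := measurable_of_Ioi fun t => by
    rw [hpre]
    exact (measurableSet_lt ENNReal.measurable_ofReal measurable_const).inter
      (MeasurableSet.iUnion fun s => measurableSet_le measurable_const ENNReal.measurable_ofReal)
  have : IsProbabilityMeasure (volume.restrict (Set.Ioc (0 : ℝ) 1)) := ⟨by simp⟩
  refine ⟨(volume.restrict (Set.Ioc (0 : ℝ) 1)).map Q,
    Measure.isProbabilityMeasure_map hQm.aemeasurable, fun t => ?_⟩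
  rw [Measure.map_apply hQm measurableSet_Ioi, Measure.restrict_apply (hQm measurableSet_Ioi)]
  have hGt : G t ≠ ⊤ := ne_top_of_le_ne_top ENNReal.one_ne_top (hG1 t)
  have : Q ⁻¹' Set.Ioi t ∩ Set.Ioc 0 1 = Set.Ioo 0 (G t).toReal := by
    ext x
    simp only [Set.mem_inter_iff, Set.mem_preimage, Set.mem_Ioi, hQlt, Set.mem_Ioc, Set.mem_Ioo]
    constructor
    · rintro ⟨⟨h1, -⟩, h2, -⟩
      exact ⟨h2, (ENNReal.ofReal_lt_iff_lt_toReal h2.le hGt).1 h1⟩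
    · rintro ⟨h1, h2⟩
      have h3 : (G t).toReal ≤ 1 := ENNReal.toReal_le_of_le_ofReal zero_le_one (by simpa using hG1 t)
      refine ⟨⟨(ENNReal.ofReal_lt_iff_lt_toReal h1.le hGt).2 h2, ?_⟩, h1, by linarith⟩
      exact (h0.eventually_le_const (ENNReal.ofReal_pos.2 h1)).exists
  rw [this, Real.volume_Ioo, sub_zero, ENNReal.ofReal_toReal hGt]

lemma eq_add_tsum_of_monotone {φ : ℕ → ℝ≥0∞} (hφ : Monotone φ) (n : ℕ) :
    φ n = φ 0 + ∑' t : ℕ, if t < n then φ (t + 1) - φ t else 0 := by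
  rw [tsum_eq_sum (s := Finset.range n) (fun t ht => if_neg (by simpa using ht)),
    Finset.sum_congr rfl fun t ht => if_pos (Finset.mem_range.1 ht)]
  induction n with
  | zero => simp
  | succ n ih =>
    rw [Finset.sum_range_succ, ← add_assoc, ← ih, add_tsub_cancel_of_le (hφ n.le_succ)]

lemma lintegral_comp_nat {Ω : Type*} [MeasurableSpace Ω] (ρ : Measure Ω) {V : Ω → ℕ}
    (hV : Measurable V) {φ : ℕ → ℝ≥0∞} (hφ : Monotone φ) :
    ∫⁻ x, φ (V x) ∂ρ = φ 0 * ρ Set.univ + ∑' t, (φ (t + 1) - φ t) * ρ {x | t < V x} := by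
  have hm : ∀ t : ℕ, MeasurableSet {x | t < V x} := fun t => hV measurableSet_Ioi
  simp only [eq_add_tsum_of_monotone hφ (V _)]
  rw [lintegral_add_left measurable_const, lintegral_const, lintegral_tsum fun t =>
    (Measurable.ite (hm t) measurable_const measurable_const).aemeasurable]
  congr 1
  refine tsum_congr fun t => ?_
  rw [← lintegral_ite_one ρ (hm t), ← lintegral_const_mul _
    (Measurable.ite (hm t) measurable_const measurable_const)]
  simp

/-- Layer-cake formula for stochastic domination. The total masses are compared separately because φ
0 need not vanish. -/
lemma lintegral_le_of_tail {Ω Ω' : Type*} [MeasurableSpace Ω] [MeasurableSpace Ω']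
    {ρ : Measure Ω} {ρ' : Measure Ω'} {V : Ω → ℕ} {V' : Ω' → ℕ} (hV : Measurable V)
    (hV' : Measurable V') (h0 : ρ Set.univ ≤ ρ' Set.univ)
    (h : ∀ t, ρ {x | t < V x} ≤ ρ' {x | t < V' x}) {φ : ℕ → ℝ≥0∞} (hφ : Monotone φ) :
    ∫⁻ x, φ (V x) ∂ρ ≤ ∫⁻ x, φ (V' x) ∂ρ' := by
  rw [lintegral_comp_nat ρ hV hφ, lintegral_comp_nat ρ' hV' hφ]
  exact add_le_add (mul_le_mul_right h0 _)
    (ENNReal.tsum_le_tsum fun t => mul_le_mul_right (h t) _)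

lemma lintegral_le_of_lintegral_cyl {S : Type*} [Countable S] [MeasurableSpace S]
    [MeasurableSingletonClass S] {μ ν : Measure (ℕ → S)} {n : ℕ} {f g : (ℕ → S) → ℝ≥0∞}
    (h : ∀ ξ, ∫⁻ x in cyl n ξ, f x ∂μ ≤ ∫⁻ x in cyl n ξ, g x ∂ν) :
    ∫⁻ x, f x ∂μ ≤ ∫⁻ x, g x ∂ν := by
  have hcov : ⋃ w : Fin n → S, firstLetters n ⁻¹' {w} = (Set.univ : Set (ℕ → S)) :=
    Set.eq_univ_of_forall fun x => Set.mem_iUnion.2 ⟨firstLetters n x, rfl⟩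
  have hsplit : ∀ (ρ : Measure (ℕ → S)) (k : (ℕ → S) → ℝ≥0∞),
      ∫⁻ x, k x ∂ρ = ∑' w : Fin n → S, ∫⁻ x in firstLetters n ⁻¹' {w}, k x ∂ρ := by
    intro ρ k
    rw [← setLIntegral_univ, ← hcov, lintegral_iUnion
      (fun w => measurable_firstLetters n (measurableSet_singleton w))]
    intro w w' hw
    exact Set.disjoint_left.2 fun x hx hx' => hw (hx.symm.trans hx')
  rw [hsplit μ f, hsplit ν g]
  refine ENNReal.tsum_le_tsum fun w => ?_
  rcases (firstLetters n ⁻¹' {w}).eq_empty_or_nonempty with he | ⟨ξ, hξ⟩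
  · simp [he]
  · have : firstLetters n ⁻¹' {w} = cyl n ξ := by
      ext x
      rw [Set.mem_preimage, ← Set.mem_singleton_iff.1 hξ, Set.mem_singleton_iff,
        firstLetters_eq_iff]
    rw [this]
    exact h ξ

/-- The last coordinate is replaced by an independent sample of ν. Under μ₁ this can only increase
the integral of a monotone function, under μ₂ only decrease it; between the two replacements the
function depends on one coordinate fewer, and induction applies. -/
lemma lintegral_monotone_le {μ₁ μ₂ : Measure (ℕ → ℕ)} {ν : Measure ℕ} [IsProbabilityMeasure ν]
    (h0 : μ₁ Set.univ ≤ μ₂ Set.univ)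
    (h1 : ∀ k ξ t, μ₁ (cyl k ξ ∩ {x | t < x k}) ≤ μ₁ (cyl k ξ) * ν (Set.Ioi t))
    (h2 : ∀ k ξ t, μ₂ (cyl k ξ) * ν (Set.Ioi t) ≤ μ₂ (cyl k ξ ∩ {x | t < x k}))
    (n : ℕ) (F : (ℕ → ℕ) → ℝ≥0∞) (hF : Monotone F) (hFn : ∀ ξ, ∀ η ∈ cyl n ξ, F η = F ξ) :
    ∫⁻ x, F x ∂μ₁ ≤ ∫⁻ x, F x ∂μ₂ := by
  induction n generalizing F with
  | zero =>
    have : F = fun _ => F 0 := funext fun x => hFn _ _ fun i hi => absurd hi (by omega)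
    rw [this, lintegral_const, lintegral_const]
    gcongr
  | succ n ih =>
    set F' : (ℕ → ℕ) → ℝ≥0∞ := fun ξ => ∫⁻ s, F (Function.update ξ n s) ∂ν with hF'
    have hcylm : ∀ t, MeasurableSet {x : ℕ → ℕ | t < x n} := fun t =>
      measurable_pi_apply n measurableSet_Ioi
    have hF'n : ∀ ξ, ∀ η ∈ cyl n ξ, F' η = F' ξ := by
      intro ξ η hη
      refine lintegral_congr fun s => hFn _ _ fun i hi => ?_
      rcases Nat.lt_succ_iff_lt_or_eq.1 hi with hi | rfl
      · rw [Function.update_of_ne hi.ne, Function.update_of_ne hi.ne, hη i hi]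
      · simp
    have hup : ∀ ξ, ∀ x ∈ cyl n ξ, F x = F (Function.update ξ n (x n)) := by
      intro ξ x hx
      refine hFn _ _ fun i hi => ?_
      rcases Nat.lt_succ_iff_lt_or_eq.1 hi with hi | rfl
      · rw [Function.update_of_ne hi.ne, hx i hi]
      · simp
    have hmono : ∀ ξ, Monotone fun s => F (Function.update ξ n s) := fun ξ s t hst =>
      hF (update_le_update_iff.2 ⟨hst, fun _ _ => le_rfl⟩)
    have hint : ∀ (ρ : Measure (ℕ → ℕ)) ξ, ∫⁻ x in cyl n ξ, F x ∂ρ =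
        ∫⁻ x in cyl n ξ, F (Function.update ξ n (x n)) ∂ρ := fun ρ ξ =>
      setLIntegral_congr_fun (measurableSet_cyl _ _) fun x hx => hup ξ x hx
    have hint' : ∀ (ρ : Measure (ℕ → ℕ)) ξ, ∫⁻ x in cyl n ξ, F' x ∂ρ =
        ∫⁻ s, F (Function.update ξ n s) ∂(ρ (cyl n ξ) • ν) := by
      intro ρ ξ
      rw [setLIntegral_congr_fun (g := fun _ => F' ξ) (measurableSet_cyl _ _)
        fun x hx => hF'n ξ x hx, setLIntegral_const, lintegral_smul_measure, smul_eq_mul, mul_comm]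
    have hset : ∀ (ρ : Measure (ℕ → ℕ)) ξ t, (ρ.restrict (cyl n ξ)) {x | t < x n} =
        ρ (cyl n ξ ∩ {x | t < x n}) := fun ρ ξ t => by
      rw [Measure.restrict_apply (hcylm t), Set.inter_comm]
    calc ∫⁻ x, F x ∂μ₁ ≤ ∫⁻ x, F' x ∂μ₁ := by
          refine lintegral_le_of_lintegral_cyl (n := n) fun ξ => ?_
          rw [hint, hint']
          refine lintegral_le_of_tail (measurable_pi_apply n) measurable_id ?_ (fun t => ?_) (hmono ξ)
          · simp
          · rw [hset, Measure.smul_apply, smul_eq_mul]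
            exact h1 n ξ t
      _ ≤ ∫⁻ x, F' x ∂μ₂ := ih F' (fun ξ η hξη => lintegral_mono fun s =>
            hF (update_le_update_iff.2 ⟨le_rfl, fun i _ => hξη i⟩)) hF'n
      _ ≤ ∫⁻ x, F x ∂μ₂ := by
          refine lintegral_le_of_lintegral_cyl (n := n) fun ξ => ?_
          rw [hint, hint']
          refine lintegral_le_of_tail measurable_id (measurable_pi_apply n) ?_ (fun t => ?_) (hmono ξ)
          · simp
          · rw [hset, Measure.smul_apply, smul_eq_mul]
            exact h2 n ξ t

lemma infinitePi_cyl_inter {ν : Measure ℕ} [IsProbabilityMeasure ν] (k : ℕ) (ξ : ℕ → ℕ) (t : ℕ) :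
    Measure.infinitePi (fun _ : ℕ => ν) (cyl k ξ ∩ {x | t < x k}) =
      Measure.infinitePi (fun _ : ℕ => ν) (cyl k ξ) * ν (Set.Ioi t) := by
  set u : ℕ → Set ℕ := fun i => if i < k then {ξ i} else Set.Ioi t with hu
  have h1 : cyl k ξ = Set.pi (Finset.range k) u := by
    ext x
    simp only [cyl, Set.mem_ofPred, Set.mem_pi, Finset.coe_range, Set.mem_Iio]
    refine forall₂_congr fun i hi => ?_
    simp [hu, hi]
  have h2 : cyl k ξ ∩ {x | t < x k} = Set.pi (Finset.range (k + 1)) u := by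
    rw [h1]
    ext x
    simp only [Set.mem_inter_iff, Set.mem_ofPred, Set.mem_pi, Finset.coe_range, Set.mem_Iio,
      Nat.lt_succ_iff_lt_or_eq, or_imp, forall_and, forall_eq]
    refine and_congr_right fun _ => ?_
    simp [hu]
  rw [h2, h1, Measure.infinitePi_pi _ fun i _ => MeasurableSet.of_discrete,
    Measure.infinitePi_pi _ fun i _ => MeasurableSet.of_discrete, Finset.prod_range_succ]
  simp [hu]

/-- If the conditional tails of `V k` given `V 0, …, V (k - 1)` are bounded by `G`, then the
averages of the variables `V k` are asymptotically at most `∑ t, G t`. -/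
theorem ae_eventually_sum_le {Ω : Type*} [MeasurableSpace Ω] {μ : Measure Ω}
    [IsProbabilityMeasure μ] {V : ℕ → Ω → ℕ} (hV : ∀ k, Measurable (V k)) {G : ℕ → ℝ≥0∞}
    (hG : Antitone G) (hGs : ∑' t, G t ≠ ⊤)
    (hdom : ∀ k (v : ℕ → ℕ) t, μ ({x | ∀ i < k, V i x = v i} ∩ {x | t < V k x}) ≤
      G t * μ {x | ∀ i < k, V i x = v i})
    {b : ℝ} (hb : (∑' t, G t).toReal < b) :
    ∀ᵐ x ∂μ, ∀ᶠ n : ℕ in atTop, (∑ i ∈ Finset.range n, (V i x : ℝ)) ≤ b * n := by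
  -- G is only a bound and may exceed 1; its truncation is a genuine tail, with no larger sum.
  set g : ℕ → ℝ≥0∞ := fun t => min (G t) 1 with hg
  have hganti : Antitone g := fun s t hst => min_le_min_right _ (hG hst)
  have hg0 : Tendsto g atTop (𝓝 0) :=
    tendsto_of_tendsto_of_tendsto_of_le_of_le tendsto_const_nhds
      (ENNReal.tendsto_atTop_zero_of_tsum_ne_top hGs) (fun _ => zero_le) fun t => min_le_left _ _
  obtain ⟨ν, hν, hνt⟩ := exists_measure_nat_tail hganti (fun t => min_le_right _ _) hg0
  set ρ : Measure (ℕ → ℕ) := Measure.infinitePi fun _ : ℕ => ν with hρ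
  set f : Ω → ℕ → ℕ := fun x k => V k x with hf
  have hfm : Measurable f := measurable_pi_lambda _ hV
  have hμ1 : IsProbabilityMeasure (μ.map f) := Measure.isProbabilityMeasure_map hfm.aemeasurable
  have hcm : ∀ k t, MeasurableSet {x : ℕ → ℕ | t < x k} := fun k t =>
    measurable_pi_apply k measurableSet_Ioi
  set Bad : ℕ → Set (ℕ → ℕ) := fun N =>
    {x | ∃ n, N ≤ n ∧ b * n < ∑ i ∈ Finset.range n, (x i : ℝ)} with hBad
  -- Restricting the violation time to at most M gives an increasing event that depends on M
  -- coordinates, so domination applies; M → ∞ follows by monotone convergence.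
  set Bad' : ℕ → ℕ → Set (ℕ → ℕ) := fun N M =>
    {x | ∃ n, N ≤ n ∧ n ≤ M ∧ b * n < ∑ i ∈ Finset.range n, (x i : ℝ)} with hBad'
  have hsumcyl : ∀ n (x y : ℕ → ℕ), y ∈ cyl n x →
      ∑ i ∈ Finset.range n, (y i : ℝ) = ∑ i ∈ Finset.range n, (x i : ℝ) := fun n x y hy =>
    Finset.sum_congr rfl fun i hi => by rw [hy i (Finset.mem_range.1 hi)]
  have hdet : ∀ N M, Determined M (Bad' N M) := by
    rintro N M x ⟨n, h1, h2, h3⟩ y hy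
    exact ⟨n, h1, h2, by rwa [hsumcyl n x y (cyl_anti h2 _ hy)]⟩
  have hU : ∀ N, Bad N = ⋃ M, Bad' N M := by
    intro N; ext x
    simp only [hBad, hBad', Set.mem_ofPred, Set.mem_iUnion]
    exact ⟨fun ⟨n, h1, h2⟩ => ⟨n, n, h1, le_rfl, h2⟩, fun ⟨M, n, h1, _, h2⟩ => ⟨n, h1, h2⟩⟩
  have hmonoM : ∀ N, Monotone (Bad' N) := fun N M M' hM x ⟨n, h1, h2, h3⟩ =>
    ⟨n, h1, h2.trans hM, h3⟩
  have hcomp : ∀ N M, (μ.map f) (Bad' N M) ≤ ρ (Bad' N M) := by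
    intro N M
    have hm := (hdet N M).measurableSet
    rw [← lintegral_indicator_one hm, ← lintegral_indicator_one hm]
    refine lintegral_monotone_le (ν := ν) (by simp) (fun k ξ t => ?_) (fun k ξ t => ?_) M _ ?_ ?_
    · rw [Measure.map_apply hfm ((measurableSet_cyl _ _).inter (hcm k t)),
        Measure.map_apply hfm (measurableSet_cyl _ _), hνt]
      have h1 : f ⁻¹' cyl k ξ = {x | ∀ i < k, V i x = ξ i} := rfl
      have h2 : f ⁻¹' {x | t < x k} = {x | t < V k x} := rfl
      rw [Set.preimage_inter, h1, h2, hg, mul_comm]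
      simp only
      rcases min_choice (G t) 1 with h | h
      · rw [h]; exact hdom k ξ t
      · rw [h, one_mul]; exact measure_mono Set.inter_subset_left
    · rw [infinitePi_cyl_inter]
    · intro x y hxy
      by_cases hx : x ∈ Bad' N M
      · have hy : y ∈ Bad' N M := by
          obtain ⟨n, h1, h2, h3⟩ := hx
          exact ⟨n, h1, h2, h3.trans_le (Finset.sum_le_sum fun i _ => by exact_mod_cast hxy i)⟩
        simp [hx, hy]
      · simp [hx]
    · intro x y hy
      have : y ∈ Bad' N M ↔ x ∈ Bad' N M :=
        ⟨fun h => hdet N M _ h (mem_cyl_symm hy), fun h => hdet N M _ h hy⟩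
      by_cases hx : x ∈ Bad' N M
      · simp [hx, this.2 hx]
      · simp [hx, mt this.1 hx]
  have hcomp' : ∀ N, (μ.map f) (Bad N) ≤ ρ (Bad N) := by
    intro N
    rw [hU, (hmonoM N).measure_iUnion, (hmonoM N).measure_iUnion]
    exact iSup_mono fun M => hcomp N M
  have hmean : ∫⁻ x, ((x 0 : ℕ) : ℝ≥0∞) ∂ρ = ∑' t, g t := by
    rw [lintegral_natCast _ (measurable_pi_apply 0)]
    refine tsum_congr fun t => ?_
    rw [← hνt, ← Measure.infinitePi_map_eval (fun _ : ℕ => ν) 0,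
      Measure.map_apply (measurable_pi_apply 0) measurableSet_Ioi]
    rfl
  have hgs : ∑' t, g t ≤ ∑' t, G t := ENNReal.tsum_le_tsum fun t => min_le_left _ _
  have hXm : ∀ i, Measurable fun x : ℕ → ℕ => ((x i : ℕ) : ℝ) := fun i =>
    Measurable.of_discrete.comp (measurable_pi_apply i)
  have hnorm : ∫⁻ x, ENNReal.ofReal ((x 0 : ℕ) : ℝ) ∂ρ = ∑' t, g t := by
    rw [← hmean]; exact lintegral_congr fun x => ENNReal.ofReal_natCast _
  have hae : ∀ᵐ x ∂ρ, ∀ᶠ n : ℕ in atTop, (∑ i ∈ Finset.range n, (x i : ℝ)) ≤ b * n := by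
    have hslln := strong_law_ae_real (μ := ρ) (fun i (x : ℕ → ℕ) => (x i : ℝ)) ?_ ?_ ?_
    · filter_upwards [hslln] with x hx
      have hE : ∫ x, ((x 0 : ℕ) : ℝ) ∂ρ < b := by
        rw [integral_eq_lintegral_of_nonneg_ae (ae_of_all _ fun x => by positivity)
          (hXm 0).aestronglyMeasurable, hnorm]
        exact (ENNReal.toReal_mono hGs hgs).trans_lt hb
      filter_upwards [hx.eventually_lt_const hE, eventually_gt_atTop 0] with n hn hn0
      rw [div_lt_iff₀ (by exact_mod_cast hn0)] at hn
      exact hn.le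
    · refine ⟨(hXm 0).aestronglyMeasurable, ?_⟩
      rw [hasFiniteIntegral_iff_ofReal (ae_of_all _ fun x => by positivity), hnorm]
      exact hgs.trans_lt (lt_top_iff_ne_top.2 hGs)
    · intro i j hij
      exact (iIndepFun_infinitePi (P := fun _ : ℕ => ν) (X := fun _ (s : ℕ) => (s : ℝ))
        fun _ => Measurable.of_discrete).indepFun hij
    · intro i
      refine ⟨(hXm i).aemeasurable, (hXm 0).aemeasurable, ?_⟩
      have : ∀ j : ℕ, ρ.map (fun x => ((x j : ℕ) : ℝ)) = ν.map (fun s : ℕ => (s : ℝ)) := fun j => by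
        conv_rhs => rw [← Measure.infinitePi_map_eval (fun _ : ℕ => ν) j]
        exact (Measure.map_map (f := fun x : ℕ → ℕ => x j) (g := fun s : ℕ => (s : ℝ))
          Measurable.of_discrete (measurable_pi_apply j)).symm
      rw [this i, this 0]
  have hlim : ρ (⋂ N, Bad N) = 0 := by
    refine measure_mono_null (fun x hx => ?_) (ae_iff.1 hae)
    rw [Set.mem_ofPred, not_eventually]
    refine frequently_atTop.2 fun N => ?_
    obtain ⟨n, h1, h2⟩ := Set.mem_iInter.1 hx N
    exact ⟨n, h1, not_le.2 h2⟩
  have hBm : ∀ N, MeasurableSet (Bad N) := fun N => by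
    rw [hU]; exact MeasurableSet.iUnion fun M => (hdet N M).measurableSet
  have hanti : Antitone Bad := fun N N' hN x ⟨n, h1, h2⟩ => ⟨n, hN.trans h1, h2⟩
  have htend := tendsto_measure_iInter_atTop (μ := ρ) (fun N => (hBm N).nullMeasurableSet) hanti
    ⟨0, measure_ne_top _ _⟩
  rw [hlim] at htend
  have hzero : (μ.map f) (⋂ N, Bad N) = 0 :=
    le_antisymm (ge_of_tendsto' htend fun N =>
      (measure_mono (Set.iInter_subset _ N)).trans (hcomp' N)) zero_le
  rw [Measure.map_apply hfm (MeasurableSet.iInter hBm)] at hzero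
  rw [ae_iff]
  refine measure_mono_null (fun x hx => ?_) hzero
  rw [Set.mem_ofPred, not_eventually] at hx
  refine Set.mem_iInter.2 fun N => ?_
  obtain ⟨n, h1, h2⟩ := frequently_atTop.1 hx N
  exact ⟨n, h1, not_le.1 h2⟩

/-- The variables `V k` are independent and identically distributed up to a factor `K` in the
conditional laws. -/
structure IsAlmostIID {Ω : Type*} [MeasurableSpace Ω] (K : ℝ≥0∞) (μ : Measure Ω)
    (V : ℕ → Ω → ℕ) : Prop where
  measurable : ∀ k, Measurable (V k)
  le : ∀ k (C : ℕ → Set ℕ) (S : Set ℕ), μ ({x | ∀ i < k, V i x ∈ C i} ∩ V k ⁻¹' S) ≤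
    K * (μ (V 0 ⁻¹' S) * μ {x | ∀ i < k, V i x ∈ C i})
  ge : ∀ k (C : ℕ → Set ℕ) (S : Set ℕ), μ (V 0 ⁻¹' S) * μ {x | ∀ i < k, V i x ∈ C i} ≤
    K * μ ({x | ∀ i < k, V i x ∈ C i} ∩ V k ⁻¹' S)

namespace IsAlmostIID

variable {Ω : Type*} [MeasurableSpace Ω] {K : ℝ≥0∞} {μ : Measure Ω} [IsProbabilityMeasure μ]
  {V : ℕ → Ω → ℕ}

lemma ae_eventually_sum_le (h : IsAlmostIID K μ V) {b : ℝ}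
    (hb : K * ∫⁻ x, (V 0 x : ℝ≥0∞) ∂μ < ENNReal.ofReal b) :
    ∀ᵐ x ∂μ, ∀ᶠ n : ℕ in atTop, (∑ i ∈ Finset.range n, (V i x : ℝ)) ≤ b * n := by
  rw [lintegral_natCast μ (h.measurable 0), ← ENNReal.tsum_mul_left] at hb
  refine RWRE.ae_eventually_sum_le h.measurable (G := fun t => K * μ {x | t < V 0 x})
    (fun s t hst => ?_) (hb.trans_le le_top).ne (fun k v t => ?_) ?_
  · show K * μ {x | t < V 0 x} ≤ K * μ {x | s < V 0 x}
    have hsub : {x | t < V 0 x} ⊆ {x | s < V 0 x} := fun x hx => hst.trans_lt hx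
    exact mul_le_mul_right (measure_mono hsub) _
  · rw [mul_assoc]
    exact h.le k (fun i => {v i}) (Set.Ioi t)
  · exact (ENNReal.lt_ofReal_iff_toReal_lt (hb.trans_le le_top).ne).1 hb

/-- The upper bound is applied to the truncated differences N − V k, whose conditional tails are at
most 1 − K⁻¹ P(V 0 > N − 1 − t). Their averages are asymptotically below N − a, and V k ≥ N − (N − V
k). -/
lemma ae_eventually_le_sum (h : IsAlmostIID K μ V) (hK : 1 ≤ K) (hK' : K ≠ ⊤) {a : ℝ}
    (ha : K * ENNReal.ofReal a < ∫⁻ x, (V 0 x : ℝ≥0∞) ∂μ) :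
    ∀ᵐ x ∂μ, ∀ᶠ n : ℕ in atTop, a * n ≤ ∑ i ∈ Finset.range n, (V i x : ℝ) := by
  classical
  have hK0 : K ≠ 0 := (zero_lt_one.trans_le hK).ne'
  rw [lintegral_natCast μ (h.measurable 0), ENNReal.tsum_eq_iSup_nat, lt_iSup_iff] at ha
  -- Finitely many tails already bring the mean above K a; this also covers an infinite mean.
  obtain ⟨N, hN⟩ := ha
  set p : ℕ → ℝ≥0∞ := fun t => K⁻¹ * μ {x | t < V 0 x} with hp
  have hp1 : ∀ t, p t ≤ 1 := fun t => by
    calc p t ≤ 1 * 1 := mul_le_mul' (ENNReal.inv_le_one.2 hK) prob_le_one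
      _ = 1 := mul_one _
  set G : ℕ → ℝ≥0∞ := fun t => if t < N then 1 - p (N - 1 - t) else 0 with hG
  have hGsum : ∑' t, G t = ∑ t ∈ Finset.range N, (1 - p t) := by
    rw [tsum_eq_sum (s := Finset.range N) (fun t ht => if_neg (by simpa using ht)),
      ← Finset.sum_range_reflect]
    refine Finset.sum_congr rfl fun t ht => ?_
    have := Finset.mem_range.1 ht
    rw [if_pos (by omega), show N - 1 - (N - 1 - t) = t by omega]
  have hGs : ∑' t, G t ≠ ⊤ := by
    rw [hGsum]
    exact (ENNReal.sum_lt_top.2 fun t _ => tsub_le_self.trans_lt ENNReal.one_lt_top).ne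
  have hadd : ∑' t, G t + ∑ t ∈ Finset.range N, p t = N := by
    rw [hGsum, ← Finset.sum_add_distrib, Finset.sum_congr rfl fun t _ => tsub_add_cancel_of_le (hp1 t)]
    simp
  have hpN : ENNReal.ofReal a < ∑ t ∈ Finset.range N, p t := by
    rw [← Finset.mul_sum, mul_comm, ← div_eq_mul_inv,
      ENNReal.lt_div_iff_mul_lt (Or.inl hK0) (Or.inl hK'), mul_comm]
    exact hN
  have hpt : ∑ t ∈ Finset.range N, p t ≠ ⊤ := fun htop => by
    rw [htop, add_top] at hadd
    exact ENNReal.natCast_ne_top N hadd.symm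
  have hb : (∑' t, G t).toReal < N - a := by
    have h1 := congrArg ENNReal.toReal hadd
    rw [ENNReal.toReal_add hGs hpt, ENNReal.toReal_natCast] at h1
    have h2 : a < (∑ t ∈ Finset.range N, p t).toReal := by
      rcases lt_or_ge a 0 with h0 | h0
      · exact h0.trans_le ENNReal.toReal_nonneg
      · exact (ENNReal.ofReal_lt_iff_lt_toReal h0 hpt).1 hpN
    linarith
  have hW : ∀ k, Measurable fun x => N - V k x := fun k => Measurable.of_discrete.comp (h.measurable k)
  have hpat : ∀ k (C : ℕ → Set ℕ), MeasurableSet {x | ∀ i < k, V i x ∈ C i} := fun k C => by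
    have : {x | ∀ i < k, V i x ∈ C i} = ⋂ i, ⋂ (_ : i < k), V i ⁻¹' C i := by ext x; simp
    rw [this]
    exact MeasurableSet.iInter fun i => MeasurableSet.iInter fun _ =>
      h.measurable i MeasurableSet.of_discrete
  have hGanti : Antitone G := by
    intro s t hst
    simp only [hG]
    split_ifs with h1 h2
    · refine tsub_le_tsub_left (mul_le_mul_right (measure_mono fun x hx => ?_) _) _
      rw [Set.mem_ofPred] at hx ⊢
      omega
    · omega
    · exact zero_le
    · exact le_rfl
  have hdom : ∀ k (w : ℕ → ℕ) t, μ ({x | ∀ i < k, N - V i x = w i} ∩ {x | t < N - V k x}) ≤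
      G t * μ {x | ∀ i < k, N - V i x = w i} := by
    intro k w t
    set C : ℕ → Set ℕ := fun i => {s | N - s = w i} with hC
    have hpatC : {x | ∀ i < k, N - V i x = w i} = {x | ∀ i < k, V i x ∈ C i} := rfl
    rw [hpatC]
    rcases lt_or_ge t N with ht | ht
    · have hGt : G t = 1 - p (N - 1 - t) := if_pos ht
      have h1 : {x | ∀ i < k, V i x ∈ C i} ∩ {x | t < N - V k x} =
          {x | ∀ i < k, V i x ∈ C i} \
            ({x | ∀ i < k, V i x ∈ C i} ∩ V k ⁻¹' Set.Ioi (N - 1 - t)) := by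
        ext x
        simp only [Set.mem_inter_iff, Set.mem_sdiff, Set.mem_ofPred, Set.mem_preimage, Set.mem_Ioi,
          not_and]
        refine and_congr_right fun h2 => ?_
        exact ⟨fun h3 _ => by omega, fun h3 => by have := h3 h2; omega⟩
      rw [h1, measure_sdiff Set.inter_subset_left
        ((hpat k C).inter (h.measurable k measurableSet_Ioi)).nullMeasurableSet
        (measure_ne_top _ _), hGt, ENNReal.sub_mul (fun _ _ => measure_ne_top _ _), one_mul]
      refine tsub_le_tsub_left ?_ _
      have h2 := h.ge k C (Set.Ioi (N - 1 - t))
      calc p (N - 1 - t) * μ {x | ∀ i < k, V i x ∈ C i}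
          = K⁻¹ * (μ (V 0 ⁻¹' Set.Ioi (N - 1 - t)) * μ {x | ∀ i < k, V i x ∈ C i}) := by
            rw [hp, mul_assoc]; rfl
        _ ≤ K⁻¹ * (K * μ ({x | ∀ i < k, V i x ∈ C i} ∩ V k ⁻¹' Set.Ioi (N - 1 - t))) :=
            mul_le_mul_right h2 _
        _ = _ := by rw [← mul_assoc, ENNReal.inv_mul_cancel hK0 hK', one_mul]
    · have : {x | t < N - V k x} = ∅ := Set.eq_empty_of_forall_notMem fun x hx => by
        rw [Set.mem_ofPred] at hx; omega
      rw [this, Set.inter_empty, measure_empty]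
      exact zero_le
  have key := RWRE.ae_eventually_sum_le hW hGanti hGs hdom hb
  filter_upwards [key] with x hx
  filter_upwards [hx] with n hn
  have h1 : (n : ℝ) * N ≤ ∑ i ∈ Finset.range n, ((N - V i x : ℕ) : ℝ) +
      ∑ i ∈ Finset.range n, (V i x : ℝ) := by
    rw [← Finset.sum_add_distrib]
    calc (n : ℝ) * N = ∑ i ∈ Finset.range n, (N : ℝ) := by simp
      _ ≤ _ := Finset.sum_le_sum fun i _ => by
        have : N ≤ (N - V i x) + V i x := by omega
        exact_mod_cast this
  linarith

end IsAlmostIID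

end RWRE

namespace RWRE

variable {d : ℕ} [NeZero d]

/-! ### The speed of a walk for which `R = ∞` has positive probability -/

lemma regenTimes_mono {c : ℝ} {L : ℕ} {ξ : ℕ → Letter d} {j k : ℕ} (h : j ≤ k) :
    regenTimes c L j ξ ≤ regenTimes c L k ξ :=
  Finset.sum_le_sum_of_subset (Finset.range_mono h)

/-- The variable `f` depends on the letters before the first regeneration time only. -/
def BeforeRegen (c : ℝ) (L : ℕ) (f : (ℕ → Letter d) → ℕ) : Prop :=
  ∀ (ξ η : ℕ → Letter d) (n : ℕ), regen c L ξ = n → η ∈ cyl n ξ → regen c L η = n → f η = f ξ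

lemma beforeRegen_regen (c : ℝ) (L : ℕ) :
    BeforeRegen (d := d) c L fun ξ => (regen c L ξ).toNat :=
  fun ξ η n h1 _ h3 => by simp only [h1, h3]

lemma beforeRegen_gain (c : ℝ) (L : ℕ) : BeforeRegen (d := d) c L (gain c L) :=
  fun ξ η n h1 h2 h3 => by
    simp only [gain, h1, h3]
    exact congrArg _ (height_congr h2 (by simp))

lemma BeforeRegen.iterRegen_eq {c : ℝ} {L k : ℕ} {f : (ℕ → Letter d) → ℕ}
    (hf : BeforeRegen c L f) {ξ η : ℕ → Letter d} (h : ξ ∈ regenFinite c L k)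
    (hη : η ∈ cyl (regenTimes c L k ξ) ξ)
    (htop : stopTime c (shiftSeq (regenTimes c L k ξ) η) = ⊤) {i : ℕ} (hi : i < k) :
    f (iterRegen c L i η) = f (iterRegen c L i ξ) := by
  have h1 := (regen_swap h hη htop).1
  have h2 := ENat.natCast_toNat (h i hi)
  refine hf _ _ _ h2.symm ?_ (by rw [h1 i hi, h2])
  rw [iterRegen_eq_shiftSeq i (ξ := η), iterRegen_eq_shiftSeq i (ξ := ξ), regenTimes_swap h1 hi.le]
  refine shiftSeq_mem_cyl (cyl_anti ?_ _ hη)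
  rw [← iterRegen_eq_shiftSeq, ← regenTimes_succ]
  exact regenTimes_mono hi

namespace IsMixingWalk

variable {q : ℝ≥0∞} {μ : Measure (ℕ → Letter d)} {c : ℝ} {D : ℕ → ℝ} {r L : ℕ}

/-- This is `regen_mixing` divided by ρ², with A a pattern of the first k values and B a condition
on the next one. The finiteness required of A costs nothing, since on R = ∞ all regeneration times
are finite almost surely. -/
lemma isAlmostIID (h : IsMixingWalk q μ) (hD : IsRate μ c D r) (hL : r ≤ L)
    (hρ : μ (noStop c) ≠ 0) {f : (ℕ → Letter d) → ℕ} (hfm : Measurable f)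
    (hf : BeforeRegen c L f) :
    IsAlmostIID (ENNReal.ofReal (D L) ^ 2) (ProbabilityTheory.cond μ (noStop c))
      (fun k ξ => f (iterRegen c L k ξ)) := by
  have := h.isProbabilityMeasure
  set ρ := μ (noStop c) with hρdef
  set K := ENNReal.ofReal (D L) ^ 2 with hK
  have hρt : ρ ≠ ⊤ := measure_ne_top _ _
  have hm : ∀ k, Measurable fun ξ => f (iterRegen c L k ξ) := fun k =>
    hfm.comp (measurable_iterRegen c L k)
  have hc := fun s : Set (ℕ → Letter d) => cond_apply (measurableSet_noStop c) μ s
  have key : ∀ k (C : ℕ → Set ℕ) (S : Set ℕ), ∃ a b e : ℝ≥0∞,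
      ProbabilityTheory.cond μ (noStop c) ({ξ | ∀ i < k, f (iterRegen c L i ξ) ∈ C i} ∩
        (fun ξ => f (iterRegen c L k ξ)) ⁻¹' S) = ρ⁻¹ * e ∧
      ProbabilityTheory.cond μ (noStop c) {ξ | ∀ i < k, f (iterRegen c L i ξ) ∈ C i} = ρ⁻¹ * a ∧
      ProbabilityTheory.cond μ (noStop c) ((fun ξ => f (iterRegen c L 0 ξ)) ⁻¹' S) = ρ⁻¹ * b ∧
      ρ * e ≤ K * (a * b) ∧ a * b ≤ K * (ρ * e) := by
    intro k C S
    set A : Set (ℕ → Letter d) :=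
      noStop c ∩ (regenFinite c L k ∩ {ξ | ∀ i < k, f (iterRegen c L i ξ) ∈ C i}) with hA
    set B : Set (ℕ → Letter d) := noStop c ∩ f ⁻¹' S with hB
    have hpat : MeasurableSet {ξ | ∀ i < k, f (iterRegen c L i ξ) ∈ C i} := by
      have : {ξ | ∀ i < k, f (iterRegen c L i ξ) ∈ C i} =
        ⋂ i, ⋂ (_ : i < k), (fun ξ => f (iterRegen c L i ξ)) ⁻¹' C i := by ext x; simp
      rw [this]
      exact MeasurableSet.iInter fun i => MeasurableSet.iInter fun _ =>
        hm i MeasurableSet.of_discrete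
    have htop : ∀ ξ ∈ A, stopTime c (iterRegen c L k ξ) = ⊤ := by
      intro ξ hξ
      rcases k with _ | k
      · exact hξ.1
      · exact stopTime_iterRegen hξ.2.1
    obtain ⟨h1, h2⟩ := regen_mixing hD hL (k := k) (A := A)
      ((measurableSet_noStop c).inter ((measurableSet_regenFinite c L k).inter hpat))
      (fun ξ hξ => hξ.2.1) htop (fun ξ hξ η hη hs => by
        obtain ⟨h1, h2⟩ := regen_swap hξ.2.1 hη hs
        refine ⟨h2 hξ.1, fun i hi => by rw [h1 i hi]; exact hξ.2.1 i hi, fun i hi => ?_⟩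
        rw [hf.iterRegen_eq hξ.2.1 hη hs hi]
        exact hξ.2.2 i hi)
      ((measurableSet_noStop c).inter (hfm MeasurableSet.of_discrete) : MeasurableSet B)
      Set.inter_subset_left
    have hfin := h.ae_regenFinite hD hL hρ
    refine ⟨μ A, μ B, _, ?_, ?_, ?_, h1, h2⟩
    · rw [hc]
      congr 1
      refine measure_congr ?_
      filter_upwards [hfin] with ξ hξ
      refine propext ⟨fun hx => ?_, fun hx => ⟨hx.1.1, hx.1.2.2, hx.2.2⟩⟩
      have hxA : ξ ∈ A := ⟨hx.1, hξ hx.1 k, hx.2.1⟩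
      exact ⟨hxA, htop ξ hxA, hx.2.2⟩
    · rw [hc]
      congr 1
      refine measure_congr ?_
      filter_upwards [hfin] with ξ hξ
      exact propext ⟨fun hx => ⟨hx.1, hξ hx.1 k, hx.2⟩, fun hx => ⟨hx.1, hx.2.2⟩⟩
    · rw [hc]
      rfl
  refine ⟨hm, fun k C S => ?_, fun k C S => ?_⟩
  · obtain ⟨a, b, e, h1, h2, h3, h4, h5⟩ := key k C S
    rw [h1, h2, h3]
    calc ρ⁻¹ * e = ρ⁻¹ * (ρ⁻¹ * (ρ * e)) := by
          rw [← mul_assoc ρ⁻¹ ρ, ENNReal.inv_mul_cancel hρ hρt, one_mul]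
      _ ≤ ρ⁻¹ * (ρ⁻¹ * (K * (a * b))) := by gcongr
      _ = _ := by ring
  · obtain ⟨a, b, e, h1, h2, h3, h4, h5⟩ := key k C S
    rw [h1, h2, h3]
    calc ρ⁻¹ * b * (ρ⁻¹ * a) = ρ⁻¹ * (ρ⁻¹ * (a * b)) := by ring
      _ ≤ ρ⁻¹ * (ρ⁻¹ * (K * (ρ * e))) := by gcongr
      _ = K * (ρ⁻¹ * ((ρ⁻¹ * ρ) * e)) := by ring
      _ = _ := by rw [ENNReal.inv_mul_cancel hρ hρt, one_mul]

end IsMixingWalk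

/-- Between the regeneration times with index `k` and `k + 1`, the height is between the heights at
these times. -/
lemma height_between {c : ℝ} {L k n : ℕ} {ξ : ℕ → Letter d} (htop : stopTime c ξ = ⊤)
    (h : ξ ∈ regenFinite c L (k + 1)) (h1 : regenTimes c L k ξ ≤ n)
    (h2 : n ≤ regenTimes c L (k + 1) ξ) :
    height ξ (regenTimes c L k ξ) ≤ height ξ n ∧
      height ξ n ≤ height ξ (regenTimes c L (k + 1) ξ) := by
  constructor
  · have hs : stopTime c (iterRegen c L k ξ) = ⊤ := by
      rcases k with _ | k
      · exact htop
      · exact stopTime_iterRegen (regenFinite_anti (by omega) h)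
    obtain ⟨i, rfl⟩ := Nat.exists_eq_add_of_le h1
    rcases Nat.eq_zero_or_pos i with rfl | hi
    · simp
    · have := height_pos_of_le_stopTime (c := c) (ξ := iterRegen c L k ξ) (n := i + 1)
        (by rw [hs]; exact le_top) (Nat.lt_succ_self i) hi
      rw [iterRegen_eq_shiftSeq, height_shift] at this
      omega
  · rcases h2.lt_or_eq with h2 | rfl
    · exact ((fresh_regenTimes h).record h2).le
    · exact le_rfl

lemma eventually_between {c : ℝ} {L : ℕ} (hL : 1 ≤ L) {ξ : ℕ → Letter d}
    (h : ∀ k, ξ ∈ regenFinite c L k) (K : ℕ) : ∀ᶠ n in atTop, ∃ k, K ≤ k ∧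
      regenTimes c L k ξ ≤ n ∧ n ≤ regenTimes c L (k + 1) ξ := by
  classical
  filter_upwards [eventually_ge_atTop (regenTimes c L K ξ)] with n hn
  have hex : ∃ k, n < regenTimes c L (k + 1) ξ :=
    ⟨n, by have := le_regenTimes hL (h (n + 1)); omega⟩
  have h1 := Nat.find_spec hex
  refine ⟨Nat.find hex, ?_, ?_, h1.le⟩
  · by_contra hlt
    have := regenTimes_mono (c := c) (L := L) (ξ := ξ) (show Nat.find hex + 1 ≤ K by omega)
    omega
  · rcases Nat.eq_zero_or_pos (Nat.find hex) with h0 | h0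
    · rw [h0]; simp [regenTimes]
    · have := Nat.find_min hex (m := Nat.find hex - 1) (by omega)
      rw [Nat.sub_add_cancel h0] at this
      omega

/-- For n between the regeneration times with index k and k + 1, the height is at most b(k + 1)
while n is at least ak. The margin ua − b absorbs the extra b once k is large, which fixes K₃. -/
lemma eventually_height_le {c : ℝ} {L : ℕ} (hL : 1 ≤ L) {ξ : ℕ → Letter d}
    (htop : stopTime c ξ = ⊤) (h : ∀ k, ξ ∈ regenFinite c L k) {a b u : ℝ} (hu : 0 ≤ u)
    (hb : ∀ᶠ k : ℕ in atTop, ∑ i ∈ Finset.range k, (gain c L (iterRegen c L i ξ) : ℝ) ≤ b * k)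
    (ha : ∀ᶠ k : ℕ in atTop,
      a * k ≤ ∑ i ∈ Finset.range k, ((regen c L (iterRegen c L i ξ)).toNat : ℝ))
    (hab : b < u * a) : ∀ᶠ n : ℕ in atTop, (height ξ n : ℝ) ≤ u * n := by
  obtain ⟨K₁, hK₁⟩ := eventually_atTop.1 hb
  obtain ⟨K₂, hK₂⟩ := eventually_atTop.1 ha
  obtain ⟨K₃, hK₃⟩ := exists_nat_ge (b / (u * a - b))
  rw [div_le_iff₀ (by linarith)] at hK₃
  filter_upwards [eventually_between hL h (max K₁ (max K₂ K₃))] with n ⟨k, h1, h2, h3⟩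
  have h4 := (height_between htop (h (k + 1)) h2 h3).2
  rw [height_regenTimes (h (k + 1))] at h4
  have h4' : (height ξ n : ℝ) ≤
      ∑ i ∈ Finset.range (k + 1), (gain c L (iterRegen c L i ξ) : ℝ) := by exact_mod_cast h4
  have h5 := hK₁ (k + 1) (by omega)
  have h6 := hK₂ k (by omega)
  have h7 : ∑ i ∈ Finset.range k, ((regen c L (iterRegen c L i ξ)).toNat : ℝ) ≤ n := by
    rw [regenTimes] at h2; exact_mod_cast h2
  have h8 : u * (a * k) ≤ u * n := mul_le_mul_of_nonneg_left (h6.trans h7) hu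
  have h9 : (K₃ : ℝ) ≤ k := by exact_mod_cast (by omega : K₃ ≤ k)
  have h10 : (K₃ : ℝ) * (u * a - b) ≤ k * (u * a - b) :=
    mul_le_mul_of_nonneg_right h9 (by linarith)
  push_cast at h5
  linarith

/-- Here the time is counted up to the regeneration with index k + 1 and the gain only up to k; the
margin a − ub absorbs the difference. -/
lemma eventually_le_height {c : ℝ} {L : ℕ} (hL : 1 ≤ L) {ξ : ℕ → Letter d}
    (htop : stopTime c ξ = ⊤) (h : ∀ k, ξ ∈ regenFinite c L k) {a b u : ℝ} (hu : 0 ≤ u)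
    (hb : ∀ᶠ k : ℕ in atTop,
      ∑ i ∈ Finset.range k, ((regen c L (iterRegen c L i ξ)).toNat : ℝ) ≤ b * k)
    (ha : ∀ᶠ k : ℕ in atTop,
      a * k ≤ ∑ i ∈ Finset.range k, (gain c L (iterRegen c L i ξ) : ℝ))
    (hab : u * b < a) : ∀ᶠ n : ℕ in atTop, u * n ≤ (height ξ n : ℝ) := by
  obtain ⟨K₁, hK₁⟩ := eventually_atTop.1 hb
  obtain ⟨K₂, hK₂⟩ := eventually_atTop.1 ha
  obtain ⟨K₃, hK₃⟩ := exists_nat_ge (u * b / (a - u * b))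
  rw [div_le_iff₀ (by linarith)] at hK₃
  filter_upwards [eventually_between hL h (max K₁ (max K₂ K₃))] with n ⟨k, h1, h2, h3⟩
  have h4 := (height_between htop (h (k + 1)) h2 h3).1
  rw [height_regenTimes (h k)] at h4
  have h4' : ∑ i ∈ Finset.range k, (gain c L (iterRegen c L i ξ) : ℝ) ≤ (height ξ n : ℝ) := by
    exact_mod_cast h4
  have h5 := hK₁ (k + 1) (by omega)
  have h6 := hK₂ k (by omega)
  have h7 : (n : ℝ) ≤
      ∑ i ∈ Finset.range (k + 1), ((regen c L (iterRegen c L i ξ)).toNat : ℝ) := by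
    rw [regenTimes] at h3; exact_mod_cast h3
  have h8 := mul_le_mul_of_nonneg_left (h7.trans h5) hu
  have h9 : (K₃ : ℝ) ≤ k := by exact_mod_cast (by omega : K₃ ≤ k)
  have h10 : (K₃ : ℝ) * (a - u * b) ≤ k * (a - u * b) :=
    mul_le_mul_of_nonneg_right h9 (by linarith)
  push_cast at h8
  linarith

lemma ae_cond_iff {Ω : Type*} [MeasurableSpace Ω] {μ : Measure Ω} [IsFiniteMeasure μ]
    {s : Set Ω} (hs : MeasurableSet s) {p : Ω → Prop} :
    (∀ᵐ x ∂(ProbabilityTheory.cond μ s), p x) ↔ ∀ᵐ x ∂μ, x ∈ s → p x := by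
  rw [← ae_restrict_iff' hs, ProbabilityTheory.cond, Measure.ae_ennreal_smul_measure_iff]
  exact (ENNReal.inv_pos.2 (measure_ne_top _ _)).ne'

namespace IsMixingWalk

variable {q : ℝ≥0∞} {μ : Measure (ℕ → Letter d)} {c : ℝ} {D : ℕ → ℝ} {r L : ℕ}

/-- The mean of the first regeneration time under the law conditioned on `R = ∞`. -/
noncomputable def meanTime (μ : Measure (ℕ → Letter d)) (c : ℝ) (L : ℕ) : ℝ≥0∞ :=
  ∫⁻ ξ, ((regen c L ξ).toNat : ℝ≥0∞) ∂(ProbabilityTheory.cond μ (noStop c))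

/-- The mean gain in level under the law conditioned on `R = ∞`. -/
noncomputable def meanGain (μ : Measure (ℕ → Letter d)) (c : ℝ) (L : ℕ) : ℝ≥0∞ :=
  ∫⁻ ξ, (gain c L ξ : ℝ≥0∞) ∂(ProbabilityTheory.cond μ (noStop c))

/-- The fourth power is K² with K = D(L)²: one factor bounds the gains from above, the other the
times from below. -/
lemma ae_eventually_height_le (h : IsMixingWalk q μ) (hD : IsRate μ c D r) (hL : r ≤ L)
    (hL1 : 1 ≤ L) (hρ : μ (noStop c) ≠ 0) {u : ℝ} (hu : 0 < u)
    (hlt : ENNReal.ofReal (D L) ^ 4 * meanGain μ c L < ENNReal.ofReal u * meanTime μ c L) :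
    ∀ᵐ ξ ∂μ, stopTime c ξ = ⊤ → ∀ᶠ n : ℕ in atTop, (height ξ n : ℝ) ≤ u * n := by
  have := h.isProbabilityMeasure
  have := cond_isProbabilityMeasure hρ
  set K := ENNReal.ofReal (D L) ^ 2 with hK
  have hK1 : 1 ≤ K := one_le_pow₀ (hD.ofReal_pos L).le
  have hK0 : K ≠ 0 := (zero_lt_one.trans_le hK1).ne'
  have hKt : K ≠ ⊤ := ENNReal.pow_ne_top ENNReal.ofReal_ne_top
  have hu0 : ENNReal.ofReal u ≠ 0 := (ENNReal.ofReal_pos.2 hu).ne'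
  have h1 : K * meanGain μ c L < ENNReal.ofReal u * meanTime μ c L / K := by
    rw [ENNReal.lt_div_iff_mul_lt (Or.inl hK0) (Or.inl hKt), hK]
    convert hlt using 1; ring
  obtain ⟨y, hy1, hy2⟩ := exists_between h1
  obtain ⟨y', hy'1, hy'2⟩ := exists_between hy2
  have hyt : y ≠ ⊤ := (hy'1.trans_le le_top).ne
  have hy't : y' ≠ ⊤ := (hy'2.trans_le le_top).ne
  have e1 := (h.isAlmostIID hD hL hρ (measurable_gain c L)
    (beforeRegen_gain c L)).ae_eventually_sum_le (b := y.toReal)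
    (by rw [ENNReal.ofReal_toReal hyt]; exact hy1)
  have e2 := (h.isAlmostIID hD hL hρ (measurable_toNat_regen c L)
    (beforeRegen_regen c L)).ae_eventually_le_sum hK1 hKt (a := y'.toReal / u) (by
      rw [ENNReal.ofReal_div_of_pos hu, ENNReal.ofReal_toReal hy't, mul_comm,
        ← ENNReal.lt_div_iff_mul_lt (Or.inl hK0) (Or.inl hKt)]
      rw [mul_div_assoc] at hy'2
      exact ENNReal.div_lt_of_lt_mul' hy'2)
  rw [ae_cond_iff (measurableSet_noStop c)] at e1 e2
  filter_upwards [e1, e2, h.ae_regenFinite hD hL hρ] with ξ h1 h2 h3 htop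
  refine eventually_height_le hL1 htop (h3 htop) hu.le (h1 htop) (h2 htop) ?_
  rw [mul_div_cancel₀ _ hu.ne']
  exact (ENNReal.toReal_lt_toReal hyt hy't).2 hy'1

lemma ae_eventually_le_height (h : IsMixingWalk q μ) (hD : IsRate μ c D r) (hL : r ≤ L)
    (hL1 : 1 ≤ L) (hρ : μ (noStop c) ≠ 0) {u : ℝ} (hu : 0 < u)
    (hlt : ENNReal.ofReal (D L) ^ 4 * (ENNReal.ofReal u * meanTime μ c L) < meanGain μ c L) :
    ∀ᵐ ξ ∂μ, stopTime c ξ = ⊤ → ∀ᶠ n : ℕ in atTop, u * n ≤ (height ξ n : ℝ) := by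
  have := h.isProbabilityMeasure
  have := cond_isProbabilityMeasure hρ
  set K := ENNReal.ofReal (D L) ^ 2 with hK
  have hK1 : 1 ≤ K := one_le_pow₀ (hD.ofReal_pos L).le
  have hK0 : K ≠ 0 := (zero_lt_one.trans_le hK1).ne'
  have hKt : K ≠ ⊤ := ENNReal.pow_ne_top ENNReal.ofReal_ne_top
  have hu0 : ENNReal.ofReal u ≠ 0 := (ENNReal.ofReal_pos.2 hu).ne'
  have h1 : K * meanTime μ c L < meanGain μ c L / K / ENNReal.ofReal u := by
    rw [ENNReal.lt_div_iff_mul_lt (Or.inl hu0) (Or.inl ENNReal.ofReal_ne_top),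
      ENNReal.lt_div_iff_mul_lt (Or.inl hK0) (Or.inl hKt), hK]
    convert hlt using 1; ring
  obtain ⟨y, hy1, hy2⟩ := exists_between h1
  obtain ⟨y', hy'1, hy'2⟩ := exists_between hy2
  have hyt : y ≠ ⊤ := (hy'1.trans_le le_top).ne
  have hy't : y' ≠ ⊤ := (hy'2.trans_le le_top).ne
  have e1 := (h.isAlmostIID hD hL hρ (measurable_toNat_regen c L)
    (beforeRegen_regen c L)).ae_eventually_sum_le (b := y.toReal)
    (by rw [ENNReal.ofReal_toReal hyt]; exact hy1)
  have e2 := (h.isAlmostIID hD hL hρ (measurable_gain c L)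
    (beforeRegen_gain c L)).ae_eventually_le_sum hK1 hKt (a := u * y'.toReal) (by
      rw [ENNReal.ofReal_mul hu.le, ENNReal.ofReal_toReal hy't, mul_comm,
        ← ENNReal.lt_div_iff_mul_lt (Or.inl hK0) (Or.inl hKt), mul_comm,
        ← ENNReal.lt_div_iff_mul_lt (Or.inl hu0) (Or.inl ENNReal.ofReal_ne_top)]
      exact hy'2)
  rw [ae_cond_iff (measurableSet_noStop c)] at e1 e2
  filter_upwards [e1, e2, h.ae_regenFinite hD hL hρ] with ξ h1 h2 h3 htop
  refine eventually_le_height hL1 htop (h3 htop) hu.le (h1 htop) (h2 htop) ?_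
  exact mul_lt_mul_of_pos_left ((ENNReal.toReal_lt_toReal hyt hy't).2 hy'1) hu

lemma meanTime_ne_zero (h : IsMixingWalk q μ) (hD : IsRate μ c D r) (hL : r ≤ L)
    (hL1 : 1 ≤ L) (hρ : μ (noStop c) ≠ 0) : 1 ≤ meanTime μ c L := by
  have := h.isProbabilityMeasure
  have := cond_isProbabilityMeasure hρ
  have h1 := (ae_cond_iff (measurableSet_noStop c)).2 (h.ae_regenFinite hD hL hρ)
  calc (1 : ℝ≥0∞) = ∫⁻ ξ, 1 ∂(ProbabilityTheory.cond μ (noStop c)) := by simp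
    _ ≤ _ := lintegral_mono_ae (by
      filter_upwards [h1] with ξ hξ
      have := le_toNat_regen (hξ 1 0 (by omega))
      simp only [iterRegen, Function.iterate_zero, id] at this
      exact_mod_cast hL1.trans this)

lemma meanGain_ne_top (h : IsMixingWalk q μ) (hD : IsRate μ c D r) (hL : r ≤ L)
    (hL1 : 1 ≤ L) (hρ : μ (noStop c) ≠ 0) : meanGain μ c L ≠ ⊤ := by
  rw [meanGain, ProbabilityTheory.cond, lintegral_smul_measure]
  exact ENNReal.mul_ne_top (ENNReal.inv_ne_top.2 hρ)
    (h.lintegral_gain_lt_top hD hL hL1 hρ).ne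

/-- The approximate speed that is computed from the regeneration structure. -/
noncomputable def approxSpeed (μ : Measure (ℕ → Letter d)) (c : ℝ) (L : ℕ) : ℝ :=
  (meanGain μ c L / meanTime μ c L).toReal

/-- An infinite mean time makes the approximate speed 0. Then the first conclusion holds for every u
> 0 since the mean gain is finite, and the second premise is impossible. -/
lemma approxSpeed_bounds (h : IsMixingWalk q μ) (hD : IsRate μ c D r) (hL : r ≤ L)
    (hL1 : 1 ≤ L) (hρ : μ (noStop c) ≠ 0) {u : ℝ} (hu : 0 < u) :
    (D L ^ 4 * approxSpeed μ c L < u →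
      ENNReal.ofReal (D L) ^ 4 * meanGain μ c L < ENNReal.ofReal u * meanTime μ c L) ∧
    (D L ^ 4 * u < approxSpeed μ c L →
      ENNReal.ofReal (D L) ^ 4 * (ENNReal.ofReal u * meanTime μ c L) < meanGain μ c L) := by
  have hG := h.meanGain_ne_top hD hL hL1 hρ
  have hT := (zero_lt_one.trans_le (h.meanTime_ne_zero hD hL hL1 hρ)).ne'
  have hD1 : 0 < D L := zero_lt_one.trans (hD.1 L)
  have hx : meanGain μ c L / meanTime μ c L ≠ ⊤ := ENNReal.div_ne_top hG hT
  have hofw : ENNReal.ofReal (approxSpeed μ c L) = meanGain μ c L / meanTime μ c L :=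
    ENNReal.ofReal_toReal hx
  rcases eq_or_ne (meanTime μ c L) ⊤ with htop | htop
  · have hw : approxSpeed μ c L = 0 := by rw [approxSpeed, htop, ENNReal.div_top]; rfl
    refine ⟨fun _ => ?_, fun h1 => ?_⟩
    · rw [htop, ENNReal.mul_top (ENNReal.ofReal_pos.2 hu).ne']
      exact ENNReal.mul_lt_top (ENNReal.pow_lt_top ENNReal.ofReal_lt_top) (lt_top_iff_ne_top.2 hG)
    · rw [hw] at h1
      exact absurd h1 (not_lt.2 (by positivity))
  · have hGeq : meanGain μ c L = meanGain μ c L / meanTime μ c L * meanTime μ c L :=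
      (ENNReal.div_mul_cancel hT htop).symm
    refine ⟨fun h1 => ?_, fun h1 => ?_⟩
    · rw [hGeq, ← mul_assoc, ← hofw, ← ENNReal.ofReal_pow hD1.le,
        ← ENNReal.ofReal_mul (by positivity)]
      exact (ENNReal.mul_lt_mul_iff_left hT htop).2 ((ENNReal.ofReal_lt_ofReal_iff hu).2 h1)
    · rw [hGeq, ← mul_assoc, ← hofw, ← ENNReal.ofReal_pow hD1.le,
        ← ENNReal.ofReal_mul (by positivity)]
      exact (ENNReal.mul_lt_mul_iff_left hT htop).2 ((ENNReal.ofReal_lt_ofReal_iff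
        (lt_of_le_of_lt (by positivity) h1)).2 h1)

lemma tendsto_div_of_shift {ξ : ℕ → Letter d} {n : ℕ} {v : ℝ}
    (h : Tendsto (fun m : ℕ => (height (shiftSeq n ξ) m : ℝ) / m) atTop (𝓝 v)) :
    Tendsto (fun m : ℕ => (height ξ m : ℝ) / m) atTop (𝓝 v) := by
  rw [← tendsto_add_atTop_iff_nat n]
  have h1 : Tendsto (fun m : ℕ => (m : ℝ) / (m + n : ℕ)) atTop (𝓝 1) := by
    have := (tendsto_natCast_div_add_atTop (𝕜 := ℝ) (n : ℝ))
    simpa using this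
  have h2 : Tendsto (fun m : ℕ => (height ξ n : ℝ) / (m + n : ℕ)) atTop (𝓝 0) :=
    (tendsto_const_div_atTop_nhds_zero_nat (height ξ n : ℝ)).comp (tendsto_add_atTop_nat n)
  have h3 := (h.mul h1).add h2
  rw [mul_one, add_zero] at h3
  refine h3.congr' ?_
  filter_upwards [eventually_gt_atTop 0] with m hm
  have hm' : (m : ℝ) ≠ 0 := by exact_mod_cast hm.ne'
  rw [height_shift, add_comm n m]
  push_cast
  have : (m : ℝ) + n ≠ 0 := by positivity
  field_simp
  ring

/-- If `R = ∞` has positive probability, then the walk has a deterministic speed on the event that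
it tends to `∞`, and if this speed is positive, then the regeneration times are integrable. -/
theorem exists_speed (h : IsMixingWalk q μ) (hρ : μ (noStop c) ≠ 0) :
    ∃ v : ℝ, 0 ≤ v ∧
      (∀ᵐ ξ ∂μ, Tendsto (height ξ) atTop atTop →
        Tendsto (fun n : ℕ => (height ξ n : ℝ) / n) atTop (𝓝 v)) ∧
      (0 < v → ∃ L₀, ∀ L ≥ L₀, ∫⁻ ξ, (regen c L ξ : ℝ≥0∞)
        ∂(ProbabilityTheory.cond μ (noStop c)) < ⊤) := by
  have := h.isProbabilityMeasure
  obtain ⟨ξ₀, hξ₀⟩ := nonempty_of_measure_ne_zero hρ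
  obtain ⟨D, r, hD⟩ := h.exists_isRate (one_le_of_stopTime_pos (by
    rw [show stopTime c ξ₀ = ⊤ from hξ₀]; exact le_top))
  set L₁ := max r 1 with hL₁
  set w : ℕ → ℝ := fun L => approxSpeed μ c L with hw
  have hw0 : ∀ L, 0 ≤ w L := fun L => ENNReal.toReal_nonneg
  have hD0 : ∀ L, 0 < D L := fun L => zero_lt_one.trans (hD.1 L)
  have hae : ∀ᵐ ξ ∂μ, stopTime c ξ = ⊤ → ∀ L ≥ L₁, ∀ u : ℚ, 0 < (u : ℝ) →
      (D L ^ 4 * w L < u → ∀ᶠ n : ℕ in atTop, (height ξ n : ℝ) ≤ u * n) ∧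
      (D L ^ 4 * u < w L → ∀ᶠ n : ℕ in atTop, u * n ≤ (height ξ n : ℝ)) := by
    have : ∀ L ≥ L₁, ∀ u : ℚ, 0 < (u : ℝ) → ∀ᵐ ξ ∂μ, stopTime c ξ = ⊤ →
        (D L ^ 4 * w L < u → ∀ᶠ n : ℕ in atTop, (height ξ n : ℝ) ≤ u * n) ∧
        (D L ^ 4 * u < w L → ∀ᶠ n : ℕ in atTop, u * n ≤ (height ξ n : ℝ)) := by
      intro L hL u hu
      have hr : r ≤ L := (le_max_left _ _).trans hL
      have h1 : 1 ≤ L := (le_max_right _ _).trans hL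
      obtain ⟨b1, b2⟩ := h.approxSpeed_bounds hD hr h1 hρ hu
      by_cases c1 : D L ^ 4 * w L < u
      · have c2 : ¬ D L ^ 4 * u < w L := fun c2 => by
          have h4 : 1 < D L ^ 4 := one_lt_pow₀ (hD.1 L) (by norm_num)
          nlinarith [hw0 L]
        filter_upwards [h.ae_eventually_height_le hD hr h1 hρ hu (b1 c1)] with ξ hξ htop
        exact ⟨fun _ => hξ htop, fun c => absurd c c2⟩
      · by_cases c2 : D L ^ 4 * u < w L
        · filter_upwards [h.ae_eventually_le_height hD hr h1 hρ hu (b2 c2)] with ξ hξ htop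
          exact ⟨fun c => absurd c c1, fun _ => hξ htop⟩
        · exact ae_of_all _ fun ξ _ => ⟨fun c => absurd c c1, fun c => absurd c c2⟩
    have h2 := ae_all_iff.2 fun L => ae_all_iff.2 fun hL => ae_all_iff.2 fun u =>
      ae_all_iff.2 fun hu => this L hL u hu
    filter_upwards [h2] with ξ hξ htop L hL u hu using hξ L hL u hu htop
  -- The bounds for different L concern the same paths. A lower bound from L above an upper bound
  -- from L' would contradict each other along any path with R = ∞ in the almost sure set.
  have hcmp : ∀ L ≥ L₁, ∀ L' ≥ L₁, w L / D L ^ 4 ≤ D L' ^ 4 * w L' := by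
    intro L hL L' hL'
    by_contra hlt
    push Not at hlt
    obtain ⟨u, hu1, hu2⟩ := exists_rat_btwn hlt
    obtain ⟨u', hu'1, hu'2⟩ := exists_rat_btwn hu2
    obtain ⟨ξ, hξ, hξ'⟩ := ((frequently_ae_mem_iff.2 hρ).and_eventually hae).exists
    have hu0 : 0 < (u : ℝ) := lt_of_le_of_lt (by have := hw0 L'; have := hD0 L'; positivity) hu1
    have hu'0 : 0 < (u' : ℝ) := hu0.trans hu'1
    have e1 := (hξ' hξ L' hL' u hu0).1 hu1
    have e2 := (hξ' hξ L hL u' hu'0).2 (by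
      rw [lt_div_iff₀ (pow_pos (hD0 L) 4)] at hu'2; linarith)
    obtain ⟨n, h1, h2, h3⟩ := (e1.and (e2.and (eventually_gt_atTop 0))).exists
    have hn : (0 : ℝ) < n := by exact_mod_cast h3
    nlinarith
  -- The speed is the supremum of all lower bounds; by the comparison it lies below every upper
  -- bound.
  set S : Set ℝ := (fun L => w L / D L ^ 4) '' Set.Ici L₁ with hS
  have hSn : S.Nonempty := ⟨_, L₁, Set.mem_Ici.2 le_rfl, rfl⟩
  have hSb : BddAbove S := ⟨D L₁ ^ 4 * w L₁, by
    rintro _ ⟨L, hL, rfl⟩; exact hcmp L hL L₁ le_rfl⟩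
  set v := sSup S with hv
  have hlo : ∀ L ≥ L₁, w L / D L ^ 4 ≤ v := fun L hL => le_csSup hSb ⟨L, hL, rfl⟩
  have hhi : ∀ L ≥ L₁, v ≤ D L ^ 4 * w L := fun L hL => csSup_le hSn (by
    rintro _ ⟨L', hL', rfl⟩; exact hcmp L' hL' L hL)
  have hv0 : 0 ≤ v := (div_nonneg (hw0 L₁) (pow_pos (hD0 L₁) 4).le).trans (hlo L₁ le_rfl)
  have hDv : Tendsto (fun L => D L ^ 8 * v) atTop (𝓝 v) := by
    have := (hD.2.1.pow 8).mul_const v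
    simpa using this
  have hspeed : ∀ᵐ ξ ∂μ, stopTime c ξ = ⊤ →
      Tendsto (fun n : ℕ => (height ξ n : ℝ) / n) atTop (𝓝 v) := by
    filter_upwards [hae] with ξ hξ htop
    rw [tendsto_order]
    constructor
    · intro b hb
      rcases lt_or_ge b 0 with hb0 | hb0
      · have := (tendsto_height_of_noStop htop).eventually_ge_atTop 0
        filter_upwards [this] with n hn
        refine hb0.trans_le (div_nonneg ?_ (Nat.cast_nonneg n))
        exact_mod_cast hn
      · obtain ⟨u, hu1, hu2⟩ := exists_rat_btwn hb
        obtain ⟨_, ⟨L, hL, rfl⟩, hlt⟩ := exists_lt_of_lt_csSup hSn hu2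
        have := (hξ htop L hL u (hb0.trans_lt hu1)).2 (by
          rw [lt_div_iff₀ (pow_pos (hD0 L) 4)] at hlt; linarith)
        filter_upwards [this, eventually_gt_atTop 0] with n h1 h2
        refine hu1.trans_le ?_
        rwa [le_div_iff₀ (by exact_mod_cast h2)]
    · intro b hb
      obtain ⟨u, hu1, hu2⟩ := exists_rat_btwn hb
      obtain ⟨L, hLu, hL⟩ := ((hDv.eventually_lt_const hu1).and (eventually_ge_atTop L₁)).exists
      -- The lower bound w L / D L ^ 4 ≤ v turns the upper bound into D L ^ 8 * v, which converges
      -- to v.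
      have h8 : D L ^ 4 * w L ≤ D L ^ 8 * v := by
        have := hlo L hL
        rw [div_le_iff₀ (pow_pos (hD0 L) 4)] at this
        calc D L ^ 4 * w L ≤ D L ^ 4 * (v * D L ^ 4) :=
              mul_le_mul_of_nonneg_left this (pow_pos (hD0 L) 4).le
          _ = _ := by ring
      have := (hξ htop L hL u (hv0.trans_lt hu1)).1 (h8.trans_lt hLu)
      filter_upwards [this, eventually_gt_atTop 0] with n h1 h2
      refine lt_of_le_of_lt ?_ hu2
      rwa [div_le_iff₀ (by exact_mod_cast h2)]
  refine ⟨v, hv0, ?_, fun hvpos => ⟨L₁, fun L hL => ?_⟩⟩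
  -- A walk that tends to ∞ regenerates, and after its first regeneration it is a walk with R = ∞;
  -- finitely many steps do not change the limit.
  · filter_upwards [h.ae_regen_ne_top hD le_rfl hρ, ae_afterRegen hD le_rfl hρ hspeed]
      with ξ h1 h2 h3
    exact tendsto_div_of_shift (h2 (h1 (unbounded_of_tendsto h3)))
  · have hr : r ≤ L := (le_max_left _ _).trans hL
    -- An infinite mean time would give w L = 0, against 0 < v ≤ D L ^ 4 * w L.
    have h1 : meanTime μ c L ≠ ⊤ := by
      intro htop
      have : w L = 0 := by simp only [hw, approxSpeed, htop, ENNReal.div_top]; rfl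
      have := hhi L hL
      rw [‹w L = 0›, mul_zero] at this
      linarith
    refine lt_of_le_of_lt (le_of_eq ?_) (lt_top_iff_ne_top.2 h1)
    rw [meanTime]
    refine lintegral_congr_ae ((ae_cond_iff (measurableSet_noStop c)).2 ?_)
    filter_upwards [h.ae_regen_ne_top hD hr hρ] with ξ h2 h3
    have h4 := h2 (unbounded_of_tendsto (tendsto_height_of_noStop h3))
    conv_lhs => rw [← ENat.natCast_toNat h4]
    simp

end IsMixingWalk

end RWRE

namespace RWRE

variable {d : ℕ} [NeZero d]

/-! ### The walk is slow if `R < ∞` almost surely -/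

/-- Soon after the walk has reached the level `l`, it starts from the level `l + r` a long stretch
without a violation. -/
def LongStretch (c r C : ℕ) (h : ℕ → ℕ) (l : ℕ) : Set (ℕ → Letter d) :=
  {ξ | ξ ∈ Reaches l ∧ ∃ i < c, ∃ t ≤ C * (h i + r), height ξ (hit l ξ + t) = l + r ∧
    (h (i + 1) : ℕ∞) ≤ stopTime c (shiftSeq (hit l ξ + t) ξ)}

/-- A time within which it is decided whether a long stretch occurs. -/
def stretchSpan (c r C : ℕ) (h : ℕ → ℕ) : ℕ :=
  1 + ∑ i ∈ Finset.range c, (C * (h i + r) + h (i + 1))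

lemma longStretch_congr {c r C : ℕ} {h : ℕ → ℕ} {l : ℕ} {ξ η : ℕ → Letter d}
    (hξ : ξ ∈ LongStretch c r C h l) (hη : η ∈ cyl (hit l ξ + stretchSpan c r C h) ξ) :
    η ∈ LongStretch c r C h l := by
  obtain ⟨h1, i, hi, t, ht, h2, h3⟩ := hξ
  obtain ⟨h4, h5⟩ := hit_congr h1 (cyl_anti (by omega) _ hη)
  have hW : C * (h i + r) + h (i + 1) < stretchSpan c r C h := by
    have := Finset.single_le_sum (f := fun i => C * (h i + r) + h (i + 1)) (fun _ _ => Nat.zero_le _)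
      (Finset.mem_range.2 hi)
    rw [stretchSpan]; omega
  refine ⟨h4, i, hi, t, ht, ?_, ?_⟩
  · rw [h5, height_congr hη (by omega)]
    exact h2
  · rw [h5]
    refine determined_le_stopTime c _ _ h3 (shiftSeq_mem_cyl (cyl_anti (by omega) _ hη))

/-- The walk climbs at most one level per step. For levels at least `stretchSpan` apart this means
that a long stretch at the lower level is decided before the upper level is hit. -/
lemma le_hit_add {l k : ℕ} {ξ : ℕ → Letter d} (h : ξ ∈ Reaches ((l + k : ℕ) : ℤ)) :
    hit l ξ + k ≤ hit ((l + k : ℕ) : ℤ) ξ := by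
  have h1 := le_height_hit h
  set T := hit ((l + k : ℕ) : ℤ) ξ with hT
  have hle : hit l ξ ≤ T := hit_mono (by push_cast; omega) h
  have hr : ξ ∈ Reaches (l : ℤ) := ⟨_, le_trans (by push_cast; omega) h1⟩
  have h2 := height_hit hr (by omega)
  have h3 := height_add_le ξ (hit l ξ) (T - hit l ξ)
  rw [Nat.add_sub_cancel' hle, h2] at h3
  push_cast [hle] at h1 h3
  omega

namespace IsMixingWalk

variable {q : ℝ≥0∞} {μ : Measure (ℕ → Letter d)} {D : ℕ → ℝ} {r : ℕ}

/-- The one-sided mixing bound at gap r. The t letters after time n disappear from the right-hand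
side, which allows conditioning at the earlier time n. -/
lemma measure_cyl_inter_stretch_le [IsProbabilityMeasure μ] {c : ℝ} (hD : IsRate μ c D r)
    (ξ : ℕ → Letter d) {n t m : ℕ} {a : ℤ} (ha : ∀ i < n, height ξ i < a)
    (har : a + r ≤ height ξ (n + t)) :
    μ (cyl (n + t) ξ ∩ shiftSeq (n + t) ⁻¹' {ζ | (m : ℕ∞) ≤ stopTime c ζ}) ≤
      ENNReal.ofReal (D r) * (μ (cyl n ξ) * μ {ζ | (m : ℕ∞) ≤ stopTime c ζ}) := by
  have hdet := determined_le_stopTime (d := d) c m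
  have := measure_le_of_determined (μ := (μ.restrict (cyl (n + t) ξ)).map (shiftSeq (n + t)))
    (ν := (ENNReal.ofReal (D r) * μ (cyl n ξ)) • μ) hdet fun ζ hζ => by
      rw [Measure.map_apply (measurable_shiftSeq _) (measurableSet_cyl _ _),
        Measure.restrict_apply (measurable_shiftSeq _ (measurableSet_cyl _ _)), cyl_inter_shift,
        Measure.smul_apply, smul_eq_mul, mul_assoc]
      have hg := glue_mem_cyl (n + t) ξ ζ
      have := (hD.2.2 r le_rfl (glue (n + t) ξ ζ) n t m a
        (fun i hi => by rw [height_congr hg (by omega)]; exact ha i hi)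
        (by rw [height_congr hg le_rfl]; exact har) (by rw [shiftSeq_glue]; exact hζ)).1
      rw [shiftSeq_glue, cyl_eq_of_mem (Nat.le_add_right n t) hg] at this
      exact this
  rwa [Measure.map_apply (measurable_shiftSeq _) hdet.measurableSet,
    Measure.restrict_apply (measurable_shiftSeq _ hdet.measurableSet), Set.inter_comm,
    Measure.smul_apply, smul_eq_mul, mul_assoc] at this

/-- Sum over all words of length t between times n and n + t. The number of words is a crude factor,
but it depends on t only and can be beaten by the choice of m. -/
lemma measure_cyl_inter_stretch_le' [IsProbabilityMeasure μ] {c : ℝ} (hD : IsRate μ c D r)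
    (ξ : ℕ → Letter d) {n : ℕ} (t m : ℕ) {a : ℤ} (ha : ∀ i < n, height ξ i < a) :
    μ (cyl n ξ ∩ {ζ | a + r ≤ height ζ (n + t) ∧ (m : ℕ∞) ≤ stopTime c (shiftSeq (n + t) ζ)}) ≤
      Fintype.card (Letter d) ^ t *
        (ENNReal.ofReal (D r) * (μ (cyl n ξ) * μ {ζ | (m : ℕ∞) ≤ stopTime c ζ})) := by
  classical
  set η : (Fin t → Letter d) → ℕ → Letter d := fun w =>
    glue n ξ fun i => if h : i < t then w ⟨i, h⟩ else upLetter d with hη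
  have hcov : cyl n ξ ∩ {ζ | a + r ≤ height ζ (n + t) ∧ (m : ℕ∞) ≤ stopTime c (shiftSeq (n + t) ζ)} ⊆
      ⋃ w, (cyl (n + t) (η w) ∩ shiftSeq (n + t) ⁻¹' {ζ | (m : ℕ∞) ≤ stopTime c ζ}) ∩
        {ζ | a + r ≤ height ζ (n + t)} := by
    rintro ζ ⟨h1, h2, h3⟩
    refine Set.mem_iUnion.2 ⟨fun i => ζ (n + i), ⟨?_, h3⟩, h2⟩
    rw [hη]
    simp only
    rw [cyl_glue]
    refine ⟨h1, fun i hi => ?_⟩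
    simp only [dif_pos hi]
    rfl
  calc _ ≤ ∑ w, μ ((cyl (n + t) (η w) ∩ shiftSeq (n + t) ⁻¹' {ζ | (m : ℕ∞) ≤ stopTime c ζ}) ∩
        {ζ | a + r ≤ height ζ (n + t)}) :=
        (measure_mono hcov).trans (measure_iUnion_fintype_le _ _)
    _ ≤ ∑ w : Fin t → Letter d,
        (ENNReal.ofReal (D r) * (μ (cyl n ξ) * μ {ζ | (m : ℕ∞) ≤ stopTime c ζ})) := by
        refine Finset.sum_le_sum fun w _ => ?_
        have hg : η w ∈ cyl n ξ := glue_mem_cyl _ _ _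
        by_cases hh : a + r ≤ height (η w) (n + t)
        · refine (measure_mono Set.inter_subset_left).trans ?_
          have := measure_cyl_inter_stretch_le hD (η w) (n := n) (t := t) (m := m) (a := a)
            (fun i hi => by rw [height_congr hg hi.le]; exact ha i hi) hh
          rwa [cyl_eq_of_mem le_rfl hg] at this
        · refine le_trans (le_of_eq ?_) zero_le
          refine measure_mono_null (fun ζ hζ => hh ?_) measure_empty
          rw [← height_congr hζ.1.1 le_rfl]
          exact hζ.2
    _ = _ := by
        rw [Finset.sum_const, Finset.card_univ, Fintype.card_fun, Fintype.card_fin, nsmul_eq_mul]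
        push_cast
        rfl

/-- A union bound over the scale i < c and the starting time t; the hypothesis on the scales makes
each i contribute at most ε/c. -/
lemma measure_cyl_inter_longStretch_le [IsProbabilityMeasure μ] {c C : ℕ} (hc : 0 < c)
    (hD : IsRate μ c D r)
    {h : ℕ → ℕ} {ε : ℝ≥0∞} (hh : ∀ i, (C * (h i + r) + 1 : ℕ) *
      (Fintype.card (Letter d) ^ (C * (h i + r)) *
        (ENNReal.ofReal (D r) * μ {ζ | (h (i + 1) : ℕ∞) ≤ stopTime c ζ})) ≤ ε / c)
    {l : ℕ} {ξ : ℕ → Letter d} (hξ : ξ ∈ Reaches (l : ℤ)) :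
    μ (cyl (hit l ξ) ξ ∩ LongStretch c r C h l) ≤ ε * μ (cyl (hit l ξ) ξ) := by
  classical
  set n := hit l ξ with hn
  have hcov : cyl n ξ ∩ LongStretch c r C h l ⊆ ⋃ i ∈ Finset.range c,
      ⋃ t ∈ Finset.range (C * (h i + r) + 1), (cyl n ξ ∩ {ζ | (l : ℤ) + r ≤ height ζ (n + t) ∧
        (h (i + 1) : ℕ∞) ≤ stopTime c (shiftSeq (n + t) ζ)}) := by
    rintro ζ ⟨h1, h2, i, hi, t, ht, h3, h4⟩
    have h5 := (hit_congr hξ h1).2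
    rw [h5] at h3 h4
    simp only [Set.mem_iUnion]
    exact ⟨i, Finset.mem_range.2 hi, t, Finset.mem_range.2 (by omega), h1, h3.ge, h4⟩
  have hcard : (1 : ℝ≥0∞) ≤ Fintype.card (Letter d) := by
    have : Nonempty (Letter d) := ⟨upLetter d⟩
    exact_mod_cast Fintype.card_pos
  calc μ (cyl n ξ ∩ LongStretch c r C h l) ≤ _ := measure_mono hcov
    _ ≤ ∑ i ∈ Finset.range c, ∑ t ∈ Finset.range (C * (h i + r) + 1),
        μ (cyl n ξ ∩ {ζ | (l : ℤ) + r ≤ height ζ (n + t) ∧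
        (h (i + 1) : ℕ∞) ≤ stopTime c (shiftSeq (n + t) ζ)}) :=
        (measure_biUnion_finset_le _ _).trans
          (Finset.sum_le_sum fun i _ => measure_biUnion_finset_le _ _)
    _ ≤ ∑ i ∈ Finset.range c, ∑ t ∈ Finset.range (C * (h i + r) + 1),
        (Fintype.card (Letter d) ^ (C * (h i + r)) * (ENNReal.ofReal (D r) *
          (μ (cyl n ξ) * μ {ζ | (h (i + 1) : ℕ∞) ≤ stopTime c ζ}))) := by
        refine Finset.sum_le_sum fun i _ => Finset.sum_le_sum fun t ht => ?_
        refine (measure_cyl_inter_stretch_le' hD ξ t (h (i + 1))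
          fun i hi => height_lt_of_lt_hit hi).trans ?_
        have : t ≤ C * (h i + r) := by have := Finset.mem_range.1 ht; omega
        gcongr
    _ ≤ ∑ i ∈ Finset.range c, ε / c * μ (cyl n ξ) := by
        refine Finset.sum_le_sum fun i _ => ?_
        rw [Finset.sum_const, Finset.card_range, nsmul_eq_mul]
        refine le_trans (le_of_eq ?_) (mul_le_mul_left (hh i) (μ (cyl n ξ)))
        ring
    _ = ε * μ (cyl n ξ) := by
        rw [Finset.sum_const, Finset.card_range, nsmul_eq_mul, ← mul_assoc,
          ENNReal.mul_div_cancel (by exact_mod_cast hc.ne') (ENNReal.natCast_ne_top c)]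

/-- Conditioning at the hitting time of the highest level: by then all stretches at lower levels of
the progression are decided, because consecutive levels are `stretchSpan` apart. Each level
contributes a factor ε. -/
lemma measure_biInter_longStretch_le [IsProbabilityMeasure μ] {c C : ℕ} {h : ℕ → ℕ} {ε : ℝ≥0∞}
    (hE : ∀ (l : ℕ) (ξ : ℕ → Letter d), ξ ∈ Reaches (l : ℤ) →
      μ (cyl (hit l ξ) ξ ∩ LongStretch c r C h l) ≤ ε * μ (cyl (hit l ξ) ξ)) (s : ℕ)
    (J : Finset ℕ) :
    μ (⋂ j ∈ J, LongStretch c r C h (s + j * stretchSpan c r C h)) ≤ ε ^ J.card := by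
  classical
  set W := stretchSpan c r C h with hW
  induction J using Finset.induction_on_max with
  | empty => simp
  | insert m J hJ ih =>
    have hm : m ∉ J := fun hm => lt_irrefl _ (hJ m hm)
    rw [Finset.card_insert_of_notMem hm, pow_succ', Finset.set_biInter_insert]
    set l := s + m * W with hl
    set A : Set (ℕ → Letter d) := Reaches (l : ℤ) ∩
      ⋂ j ∈ J, LongStretch c r C h (s + j * W) with hA
    have hcl : ∀ ξ ∈ A, ∀ η ∈ cyl (hit l ξ) ξ, η ∈ A ∧ hit l η = hit l ξ := by
      rintro ξ ⟨h1, h2⟩ η hη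
      obtain ⟨h3, h4⟩ := hit_congr h1 hη
      refine ⟨⟨h3, ?_⟩, h4⟩
      simp only [Set.mem_iInter] at h2 ⊢
      intro j hj
      refine longStretch_congr (h2 j hj) (cyl_anti ?_ _ hη)
      have hjm : s + j * W + (m - j) * W = l := by
        have := hJ j hj
        rw [add_assoc, ← add_mul, Nat.add_sub_cancel' this.le]
      have h5 : ξ ∈ Reaches ((s + j * W + (m - j) * W : ℕ) : ℤ) := by rw [hjm]; exact h1
      have h6 := le_hit_add h5
      rw [hjm] at h6
      refine le_trans ?_ h6
      have := hJ j hj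
      have : 1 * W ≤ (m - j) * W := Nat.mul_le_mul_right _ (by omega)
      omega
    have hAm := measurableSet_of_stopping _ hcl
    have h1 := measure_le_of_stopping (μ := μ.restrict (LongStretch c r C h l)) (ν := ε • μ)
      (fun ξ => hit l ξ) hcl fun ξ hξ => by
        rw [Measure.restrict_apply (measurableSet_cyl _ _), Measure.smul_apply, smul_eq_mul]
        exact hE l ξ hξ.1
    rw [Measure.restrict_apply hAm, Measure.smul_apply, smul_eq_mul] at h1
    calc _ ≤ μ (A ∩ LongStretch c r C h l) := measure_mono fun ξ hξ => ⟨⟨hξ.1.1, hξ.2⟩, hξ.1⟩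
      _ ≤ ε * μ A := h1
      _ ≤ _ := by gcongr; exact (measure_mono Set.inter_subset_right).trans ih

-- If half of the 2kW levels carry a long stretch, then some residue class modulo W contains at
-- least k such levels among its 2k. There are at most 4 ^ k choices of k of them, each of
-- probability at most 8⁻¹ ^ k.
open Classical in
lemma measure_many_longStretch_le [IsProbabilityMeasure μ] {c C : ℕ} {h : ℕ → ℕ}
    (hE : ∀ (l : ℕ) (ξ : ℕ → Letter d), ξ ∈ Reaches (l : ℤ) →
      μ (cyl (hit l ξ) ξ ∩ LongStretch c r C h l) ≤ 8⁻¹ * μ (cyl (hit l ξ) ξ)) (k : ℕ) :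
    μ {ξ | stretchSpan c r C h * k ≤ ((Finset.range (stretchSpan c r C h * (2 * k))).filter
      fun l => ξ ∈ LongStretch c r C h l).card} ≤ stretchSpan c r C h * 2⁻¹ ^ k := by
  set W := stretchSpan c r C h with hW
  have hW1 : 1 ≤ W := by rw [hW, stretchSpan]; omega
  set B : ℕ → Set (ℕ → Letter d) := fun s => ⋃ J ∈ (Finset.range (2 * k)).powersetCard k,
    ⋂ j ∈ J, LongStretch c r C h (s + j * W) with hB
  have hBle : ∀ s, μ (B s) ≤ 2⁻¹ ^ k := by
    intro s
    calc μ (B s) ≤ ∑ J ∈ (Finset.range (2 * k)).powersetCard k,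
          μ (⋂ j ∈ J, LongStretch c r C h (s + j * W)) := measure_biUnion_finset_le _ _
      _ ≤ ∑ J ∈ (Finset.range (2 * k)).powersetCard k, 8⁻¹ ^ k := by
          refine Finset.sum_le_sum fun J hJ => ?_
          have := measure_biInter_longStretch_le hE s J
          rwa [(Finset.mem_powersetCard.1 hJ).2] at this
      _ = (2 * k).choose k * 8⁻¹ ^ k := by
          rw [Finset.sum_const, Finset.card_powersetCard, Finset.card_range, nsmul_eq_mul]
      _ ≤ 4 ^ k * 8⁻¹ ^ k := by
          gcongr
          have : (2 * k).choose k ≤ 4 ^ k := by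
            calc (2 * k).choose k ≤ 2 ^ (2 * k) := Nat.choose_le_two_pow _ _
              _ = 4 ^ k := by rw [pow_mul]; norm_num
          exact_mod_cast this
      _ = 2⁻¹ ^ k := by
          rw [← mul_pow]
          congr 1
          rw [show (8 : ℝ≥0∞) = 4 * 2 by norm_num, ENNReal.mul_inv (by simp) (by simp), ← mul_assoc,
            ENNReal.mul_inv_cancel (by simp) (by simp), one_mul]
  have hcov : {ξ | W * k ≤ ((Finset.range (W * (2 * k))).filter
      fun l => ξ ∈ LongStretch c r C h l).card} ⊆ ⋃ s ∈ Finset.range W, B s := by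
    intro ξ hξ
    rw [Set.mem_ofPred] at hξ
    set F := (Finset.range (W * (2 * k))).filter fun l => ξ ∈ LongStretch c r C h l with hF
    obtain ⟨s, hs, hsk⟩ := Finset.exists_le_card_fiber_of_mul_le_card_of_maps_to (s := F)
      (t := Finset.range W) (f := fun l => l % W) (n := k)
      (fun l _ => Finset.mem_range.2 (Nat.mod_lt _ hW1)) (Finset.nonempty_range_iff.2 (by omega))
      (by rwa [Finset.card_range])
    refine Set.mem_biUnion hs ?_
    have hinj : Set.InjOn (fun l => l / W) (F.filter fun l => l % W = s) := by
      intro x hx y hy hxy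
      have h1 := (Finset.mem_filter.1 (Finset.mem_coe.1 hx)).2
      have h2 := (Finset.mem_filter.1 (Finset.mem_coe.1 hy)).2
      simp only at hxy
      rw [← Nat.div_add_mod x W, ← Nat.div_add_mod y W, hxy, h1, h2]
    obtain ⟨J, hJ, hJk⟩ := Finset.exists_subset_card_eq
      (show k ≤ ((F.filter fun l => l % W = s).image fun l => l / W).card by
        rwa [Finset.card_image_of_injOn hinj])
    refine Set.mem_biUnion (x := J) ?_ ?_
    · refine Finset.mem_coe.2 (Finset.mem_powersetCard.2 ⟨fun j hj => ?_, hJk⟩)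
      obtain ⟨l, hl, rfl⟩ := Finset.mem_image.1 (hJ hj)
      have := (Finset.mem_filter.1 (Finset.mem_filter.1 hl).1).1
      exact Finset.mem_range.2 (Nat.div_lt_of_lt_mul (Finset.mem_range.1 this))
    · refine Set.mem_iInter₂.2 fun j hj => ?_
      obtain ⟨l, hl, rfl⟩ := Finset.mem_image.1 (hJ hj)
      obtain ⟨h1, h2⟩ := Finset.mem_filter.1 hl
      have : s + l / W * W = l := by rw [← h2, mul_comm]; exact Nat.mod_add_div l W
      rw [this]
      exact (Finset.mem_filter.1 h1).2
  calc _ ≤ _ := measure_mono hcov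
    _ ≤ ∑ s ∈ Finset.range W, μ (B s) := measure_biUnion_finset_le _ _
    _ ≤ ∑ s ∈ Finset.range W, 2⁻¹ ^ k := Finset.sum_le_sum fun s _ => hBle s
    _ = _ := by rw [Finset.sum_const, Finset.card_range, nsmul_eq_mul]

end IsMixingWalk

/-! ### Deterministic counting: a fast walk has many long stretches -/

section Counting

/-- Pigeonhole: if each of the c intervals from g i to g (i + 1) contained a point of S beyond its
left end, these points and g 0 would be c + 1 points of S. -/
lemma exists_gap {S : Finset ℕ} {g : ℕ → ℕ} {c : ℕ} (hS : S.card ≤ c) (h0 : g 0 ∈ S)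
    (hg : ∀ i < c, g i ≤ g (i + 1)) : ∃ i < c, ∀ t ∈ S, g i < t → g (i + 1) < t := by
  by_contra hno
  push Not at hno
  have key : ∀ i ≤ c, i + 1 ≤ (S.filter fun t => t ≤ g i).card := by
    intro i hi
    induction i with
    | zero => exact Finset.card_pos.2 ⟨g 0, Finset.mem_filter.2 ⟨h0, le_rfl⟩⟩
    | succ i ih =>
      obtain ⟨t, ht, h1, h2⟩ := hno i (by omega)
      refine Nat.succ_le_of_lt ((ih (by omega)).trans_lt (Finset.card_lt_card ?_))
      refine Finset.ssubset_iff_subset_ne.2 ⟨fun x hx => ?_, fun heq => ?_⟩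
      · rw [Finset.mem_filter] at hx ⊢
        exact ⟨hx.1, hx.2.trans (hg i (by omega))⟩
      · have : t ∈ S.filter fun t => t ≤ g i := by rw [heq]; exact Finset.mem_filter.2 ⟨ht, h2⟩
        exact absurd (Finset.mem_filter.1 this).2 (by omega)
  have := (key c le_rfl).trans (Finset.card_filter_le _ _)
  omega

/-- The number of visits to the level `l` up to time `τ`. -/
noncomputable def visits (ξ : ℕ → Letter d) (τ l : ℕ) : ℕ :=
  ((Finset.range (τ + 1)).filter fun i => height ξ i = l).card

variable {ξ : ℕ → Letter d} {M : ℕ}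

lemma reaches_of_le (hM : ξ ∈ Reaches (M : ℤ)) {l : ℕ} (hl : l ≤ M) : ξ ∈ Reaches (l : ℤ) := by
  obtain ⟨n, hn⟩ := hM
  exact ⟨n, le_trans (by exact_mod_cast hl) hn⟩

lemma hit_le_hit (hM : ξ ∈ Reaches (M : ℤ)) {l k : ℕ} (hlk : l ≤ k) (hk : k ≤ M) :
    hit l ξ ≤ hit k ξ := hit_mono (by exact_mod_cast hlk) (reaches_of_le hM hk)

/-- The level m = l + r has at most c visits, one of them at its hitting time. So for some i there
is no visit between the hitting times of m + h i and m + h (i + 1). The last visit t₀ before this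
gap starts a stretch that stays above m for at least the h (i + 1) steps needed to climb that far.
No higher level is crowded, so there is no violation, and t₀ is at most C(h i + r) after the hitting
time of l. -/
lemma longStretch_of_visits {c r C l : ℕ} {h : ℕ → ℕ} (h0 : h 0 = 0) (hmono : StrictMono h)
    (hM : ξ ∈ Reaches (M : ℤ)) (h1 : l + r + h c ≤ M)
    (h2 : ∀ j, visits ξ (hit M ξ) (l + r + j) ≤ c * (j + 1) ^ 2)
    (h3 : ∀ i < c, hit ((l + r + h i : ℕ) : ℤ) ξ ≤ hit l ξ + C * (h i + r)) :
    ξ ∈ LongStretch c r C h l := by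
  set τ := hit M ξ with hτ
  set m := l + r with hm
  set S := (Finset.range (τ + 1)).filter fun i => height ξ i = m with hS
  set g : ℕ → ℕ := fun i => hit ((m + h i : ℕ) : ℤ) ξ with hg
  have hle : ∀ i ≤ c, m + h i ≤ M := fun i hi => by have := hmono.monotone hi; omega
  have hgτ : ∀ i ≤ c, g i ≤ τ := fun i hi => hit_le_hit hM (hle i hi) le_rfl
  have hgh : ∀ i ≤ c, height ξ (g i) = ((m + h i : ℕ) : ℤ) := fun i hi =>
    height_hit (reaches_of_le hM (hle i hi)) (by positivity)
  have hgm : ∀ i < c, g i ≤ g (i + 1) := fun i hi =>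
    hit_le_hit hM (by have := hmono (Nat.lt_add_one i); omega) (hle _ hi)
  have hg0 : ∀ i ≤ c, g 0 ≤ g i := fun i hi =>
    hit_le_hit hM (by rw [h0]; omega) (hle _ hi)
  have hg0S : g 0 ∈ S := by
    refine Finset.mem_filter.2 ⟨Finset.mem_range.2 ?_, ?_⟩
    · have := hgτ 0 (by omega); omega
    · rw [hgh 0 (by omega), h0, add_zero]
  obtain ⟨i, hi, hgap⟩ := exists_gap (S := S) (g := g) (c := c)
    (by have := h2 0; simpa [visits] using this) hg0S hgm
  obtain ⟨t₀, ht₀, hmax⟩ := Finset.exists_max_image (S.filter fun t => t ≤ g i) id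
    ⟨g 0, Finset.mem_filter.2 ⟨hg0S, hg0 i hi.le⟩⟩
  obtain ⟨ht₀S, ht₀g⟩ := Finset.mem_filter.1 ht₀
  have ht₀h := (Finset.mem_filter.1 ht₀S).2
  have hnov : ∀ t, t₀ < t → t ≤ g (i + 1) → height ξ t ≠ m := by
    intro t ht1 ht2 heq
    have htS : t ∈ S := Finset.mem_filter.2
      ⟨Finset.mem_range.2 (by have := hgτ (i + 1) hi; omega), heq⟩
    rcases le_or_gt t (g i) with hle | hlt
    · have := hmax t (Finset.mem_filter.2 ⟨htS, hle⟩)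
      simp only [id] at this
      omega
    · have := hgap t htS hlt; omega
  have hgt : ∀ t, t₀ < t → t ≤ g (i + 1) → (m : ℤ) < height ξ t := by
    intro t ht1 ht2
    by_contra hlt
    obtain ⟨s, hs1, hs2, hs3⟩ := exists_height_eq ht2 (not_lt.1 hlt)
      (by rw [hgh _ hi]; push_cast; omega)
    exact hnov s (by omega) hs2 hs3
  have hlt₀ : hit l ξ ≤ t₀ := hit_le (by rw [ht₀h, hm]; push_cast; omega)
  have hlen : t₀ + h (i + 1) ≤ g (i + 1) := by
    have h4 := height_add_le ξ t₀ (g (i + 1) - t₀)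
    have h5 := hgm i hi
    have h6 := hg0 i hi.le
    rw [Nat.add_sub_cancel' (by omega), hgh (i + 1) hi, ht₀h] at h4
    push_cast at h4
    omega
  refine ⟨reaches_of_le hM (by omega), i, hi, t₀ - hit l ξ, ?_, ?_, ?_⟩
  · have h4 := h3 i hi
    have h5 : g i ≤ hit l ξ + C * (h i + r) := h4
    omega
  · rw [Nat.add_sub_cancel' hlt₀, ht₀h, hm]; push_cast; rfl
  · rw [Nat.add_sub_cancel' hlt₀, le_stopTime_iff]
    rintro k hk (⟨j, hj⟩ | ⟨hk1, hk2⟩)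
    · have h4 := h2 j
      have h5 : ((Finset.range (k + 1)).filter fun i => height (shiftSeq t₀ ξ) i = j).card ≤
          visits ξ τ (m + j) := by
        refine Finset.card_le_card_of_injOn (fun i => t₀ + i) (fun x hx => ?_)
          (fun x _ y _ hxy => by simpa using hxy)
        obtain ⟨hx1, hx2⟩ := Finset.mem_filter.1 (Finset.mem_coe.1 hx)
        have hx1 := Finset.mem_range.1 hx1
        refine Finset.mem_coe.2 (Finset.mem_filter.2 ⟨Finset.mem_range.2 ?_, ?_⟩)
        · have := hgτ (i + 1) hi
          show t₀ + x < τ + 1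
          omega
        · rw [height_shift, ht₀h] at hx2
          push_cast
          linarith
      have h6 : ((c : ℝ) * ((j : ℝ) + 1) ^ 2) < ((c * (j + 1) ^ 2 : ℕ) : ℝ) :=
        hj.trans_le (by exact_mod_cast h5.trans h4)
      push_cast at h6
      exact lt_irrefl _ h6
    · rw [height_shift, ht₀h] at hk2
      have := hgt (t₀ + k) (by omega) (by omega)
      omega

lemma sum_visits_le (ξ : ℕ → Letter d) (τ n s : ℕ) :
    ∑ l ∈ Finset.range n, visits ξ τ (l + s) ≤ τ + 1 := by
  simp only [visits]
  rw [← Finset.card_biUnion]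
  · refine (Finset.card_le_card (Finset.biUnion_subset.2 fun l _ =>
      Finset.filter_subset _ _)).trans (Finset.card_range _).le
  · intro l _ l' _ hne
    refine Finset.disjoint_left.2 fun i hi hi' => hne ?_
    have h1 := (Finset.mem_filter.1 hi).2
    have h2 := (Finset.mem_filter.1 hi').2
    rw [h1] at h2
    have : l + s = l' + s := by exact_mod_cast h2
    omega

lemma sum_inv_sq_le (n : ℕ) :
    ∑ j ∈ Finset.range (n + 1), (1 : ℝ) / ((j : ℝ) + 1) ^ 2 ≤ 2 - 1 / ((n : ℝ) + 1) := by
  induction n with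
  | zero => norm_num
  | succ n ih =>
    rw [Finset.sum_range_succ]
    have h : (1 : ℝ) / ((n : ℝ) + 1 + 1) ^ 2 ≤ 1 / ((n : ℝ) + 1) - 1 / ((n : ℝ) + 1 + 1) := by
      rw [div_sub_div _ _ (by positivity) (by positivity), div_le_div_iff₀ (by positivity)
        (by positivity)]
      nlinarith [Nat.cast_nonneg (α := ℝ) n]
    push_cast
    linarith

-- Weighting visits at distance j by (j + 1)⁻², a crowded level has weighted sum at least c. Summed
-- over all levels the weights give at most 2(τ + 1), since ∑ (j + 1)⁻² ≤ 2 and there are τ + 1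
-- times in all.
open Classical in
lemma card_crowded_le (ξ : ℕ → Letter d) {c : ℕ} (hc : 0 < c) (τ r M : ℕ) :
    c * ((Finset.range M).filter fun l => ∃ j, c * (j + 1) ^ 2 < visits ξ τ (l + r + j)).card ≤
      2 * (τ + 1) := by
  set B := (Finset.range M).filter fun l => ∃ j, c * (j + 1) ^ 2 < visits ξ τ (l + r + j) with hB
  have hcR : (0 : ℝ) < c := by exact_mod_cast hc
  have hj : ∀ l j, 0 < visits ξ τ (l + r + j) → j < τ + 1 := by
    intro l j h
    obtain ⟨i, hi⟩ := Finset.card_pos.1 h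
    obtain ⟨h1, h2⟩ := Finset.mem_filter.1 hi
    have := height_le ξ i
    have := Finset.mem_range.1 h1
    push_cast at h2
    omega
  have h1 : ∀ l ∈ B, (c : ℝ) ≤
      ∑ j ∈ Finset.range (τ + 1), (visits ξ τ (l + r + j) : ℝ) / ((j : ℝ) + 1) ^ 2 := by
    intro l hl
    obtain ⟨j, hlt⟩ := (Finset.mem_filter.1 hl).2
    refine le_trans ?_ (Finset.single_le_sum (f := fun j : ℕ =>
      (visits ξ τ (l + r + j) : ℝ) / ((j : ℝ) + 1) ^ 2) (fun _ _ => by positivity)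
      (Finset.mem_range.2 (hj l j (by omega))))
    rw [le_div_iff₀ (by positivity)]
    exact_mod_cast hlt.le
  have h2 : (c : ℝ) * B.card ≤ 2 * (τ + 1) := by
    calc (c : ℝ) * B.card = ∑ l ∈ B, (c : ℝ) := by rw [Finset.sum_const, nsmul_eq_mul, mul_comm]
      _ ≤ ∑ l ∈ B, ∑ j ∈ Finset.range (τ + 1),
          (visits ξ τ (l + r + j) : ℝ) / ((j : ℝ) + 1) ^ 2 := Finset.sum_le_sum h1
      _ ≤ ∑ l ∈ Finset.range M, ∑ j ∈ Finset.range (τ + 1),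
          (visits ξ τ (l + r + j) : ℝ) / ((j : ℝ) + 1) ^ 2 :=
        Finset.sum_le_sum_of_subset_of_nonneg (Finset.filter_subset _ _)
          fun _ _ _ => Finset.sum_nonneg fun _ _ => by positivity
      _ = ∑ j ∈ Finset.range (τ + 1), ((∑ l ∈ Finset.range M, visits ξ τ (l + (r + j)) : ℕ) : ℝ) *
          (1 / ((j : ℝ) + 1) ^ 2) := by
        rw [Finset.sum_comm]
        refine Finset.sum_congr rfl fun j _ => ?_
        rw [Nat.cast_sum, Finset.sum_mul]
        exact Finset.sum_congr rfl fun l _ => by rw [add_assoc, mul_one_div]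
      _ ≤ ∑ j ∈ Finset.range (τ + 1), ((τ + 1 : ℕ) : ℝ) * (1 / ((j : ℝ) + 1) ^ 2) := by
        refine Finset.sum_le_sum fun j _ => ?_
        gcongr
        exact sum_visits_le ξ τ M (r + j)
      _ ≤ ((τ + 1 : ℕ) : ℝ) * 2 := by
        rw [← Finset.mul_sum]
        gcongr
        refine (sum_inv_sq_le _).trans ?_
        have : (0 : ℝ) ≤ 1 / ((τ : ℝ) + 1) := by positivity
        linarith
      _ = _ := by push_cast; ring
  exact_mod_cast h2

/-- The sum of T (l + s) − T l over l telescopes to at most s τ, its terms are nonnegative, and each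
slow level contributes at least C s. -/
lemma card_slow_le {T : ℕ → ℕ} {M τ : ℕ} (hT : ∀ l ≤ M, T l ≤ τ) (C s : ℕ)
    (hmono : ∀ l, l + s ≤ M → T l ≤ T (l + s)) :
    C * ((Finset.range M).filter fun l => l + s ≤ M ∧ T l + C * s < T (l + s)).card ≤ τ := by
  set B := (Finset.range M).filter fun l => l + s ≤ M ∧ T l + C * s < T (l + s) with hB
  rcases Nat.eq_zero_or_pos s with rfl | hs
  · have : B = ∅ := Finset.filter_eq_empty_iff.2 fun l _ h => by simp at h
    simp [this]
  refine Nat.le_of_mul_le_mul_left ?_ hs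
  rcases lt_or_ge M s with hMs | hMs
  · have : B = ∅ := Finset.filter_eq_empty_iff.2 fun l _ h => by omega
    simp [this]
  set n := M + 1 - s with hn
  have h1 : ∑ l ∈ Finset.range n, T l + C * s * B.card ≤ ∑ l ∈ Finset.range n, T (s + l) := by
    have h2 : C * s * B.card = ∑ l ∈ Finset.range n, if l ∈ B then C * s else 0 := by
      rw [← Finset.sum_filter, Finset.sum_const, smul_eq_mul, mul_comm]
      congr 2
      ext l
      refine ⟨fun hl => ?_, fun hl => (Finset.mem_filter.1 hl).2⟩
      have := (Finset.mem_filter.1 hl).2.1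
      exact Finset.mem_filter.2 ⟨Finset.mem_range.2 (by omega), hl⟩
    rw [h2, ← Finset.sum_add_distrib]
    refine Finset.sum_le_sum fun l hl => ?_
    have hl := Finset.mem_range.1 hl
    rw [add_comm s l]
    split_ifs with hlB
    · exact (Finset.mem_filter.1 hlB).2.2.le
    · exact hmono l (by omega)
  have h2 : ∑ l ∈ Finset.range n, T (s + l) ≤ ∑ l ∈ Finset.range n, T l + s * τ := by
    have e1 := Finset.sum_range_add T s n
    have e2 := Finset.sum_range_add T n s
    rw [add_comm n s, e1] at e2
    have e3 : ∑ x ∈ Finset.range s, T (n + x) ≤ s * τ := by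
      calc _ ≤ ∑ x ∈ Finset.range s, τ := Finset.sum_le_sum fun x hx => hT _ (by
            have := Finset.mem_range.1 hx; omega)
        _ = _ := by simp
    omega
  calc s * (C * B.card) = C * s * B.card := by ring
    _ ≤ s * τ := by omega

open Classical in
/-- If the level `M` is reached quickly, then there are many long stretches on the way. -/
lemma many_longStretch {A c r C : ℕ} {h : ℕ → ℕ} (h0 : h 0 = 0) (hmono : StrictMono h)
    (hA : 1 ≤ A) (hc : c = 16 * A) (hC : C = 8 * c * A) (hM : ξ ∈ Reaches (M : ℤ))
    (hτ : hit M ξ ≤ A * M) (hbig : 4 * (r + h c) + 1 ≤ M) :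
    M ≤ 2 * ((Finset.range M).filter fun l => ξ ∈ LongStretch c r C h l).card := by
  set τ := hit M ξ with hτdef
  set E := (Finset.range M).filter fun l => ξ ∈ LongStretch c r C h l with hE
  set B₁ := (Finset.range M).filter fun l => M < l + (r + h c) with hB₁
  set B₂ := (Finset.range M).filter fun l => ∃ j, c * (j + 1) ^ 2 < visits ξ τ (l + r + j) with hB₂
  set B₃ : ℕ → Finset ℕ := fun i => (Finset.range M).filter fun l => l + (r + h i) ≤ M ∧
    hit (l : ℤ) ξ + C * (r + h i) < hit ((l + (r + h i) : ℕ) : ℤ) ξ with hB₃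
  -- A level without a long stretch is close to M, crowded, or slow. The assumption on M bounds the
  -- first kind by M/4, c = 16A the second by (M + 1)/8, and C = 8cA the third by M/8; so at least
  -- half of the levels remain.
  have hcov : Finset.range M ⊆ E ∪ (B₁ ∪ (B₂ ∪ (Finset.range c).biUnion B₃)) := by
    intro l hl
    by_contra hno
    simp only [Finset.mem_union, Finset.mem_biUnion, not_or, not_exists, not_and] at hno
    obtain ⟨n1, n2, n3, n4⟩ := hno
    refine n1 (Finset.mem_filter.2 ⟨hl, ?_⟩)
    have g1 : l + (r + h c) ≤ M := by
      by_contra hlt; exact n2 (Finset.mem_filter.2 ⟨hl, not_le.1 hlt⟩)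
    refine longStretch_of_visits h0 hmono hM (by omega) (fun j => ?_) (fun i hi => ?_)
    · by_contra hlt
      exact n3 (Finset.mem_filter.2 ⟨hl, j, not_le.1 hlt⟩)
    · by_contra hlt
      have := hmono.monotone hi.le
      refine n4 i (Finset.mem_range.2 hi) (Finset.mem_filter.2 ⟨hl, by omega, ?_⟩)
      rw [add_comm (h i) r, add_assoc] at hlt
      exact not_le.1 hlt
  have c1 : B₁.card ≤ r + h c := by
    calc B₁.card ≤ (Finset.Ico (M - (r + h c)) M).card := Finset.card_le_card fun l hl => by
          obtain ⟨h1, h2⟩ := Finset.mem_filter.1 hl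
          have := Finset.mem_range.1 h1
          exact Finset.mem_Ico.2 ⟨by omega, this⟩
      _ ≤ _ := by rw [Nat.card_Ico]; omega
  have c2 : c * B₂.card ≤ 2 * (τ + 1) := card_crowded_le ξ (by omega) τ r M
  have c3 : C * ((Finset.range c).biUnion B₃).card ≤ c * τ := by
    calc C * ((Finset.range c).biUnion B₃).card ≤ C * ∑ i ∈ Finset.range c, (B₃ i).card :=
          Nat.mul_le_mul_left _ Finset.card_biUnion_le
      _ = ∑ i ∈ Finset.range c, C * (B₃ i).card := Finset.mul_sum _ _ _
      _ ≤ ∑ i ∈ Finset.range c, τ := Finset.sum_le_sum fun i _ =>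
          card_slow_le (T := fun l => hit (l : ℤ) ξ) (fun l hl => hit_le_hit hM hl le_rfl) C
            (r + h i) fun l hl => hit_le_hit hM (by omega) hl
      _ = _ := by simp
  have hcard : M ≤ E.card + (B₁.card + (B₂.card + ((Finset.range c).biUnion B₃).card)) := by
    calc M = (Finset.range M).card := (Finset.card_range M).symm
      _ ≤ _ := Finset.card_le_card hcov
      _ ≤ _ := (Finset.card_union_le _ _).trans (Nat.add_le_add_left
          ((Finset.card_union_le _ _).trans (Nat.add_le_add_left (Finset.card_union_le _ _) _)) _)
  have d2 : 8 * B₂.card ≤ M + 1 := by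
    refine Nat.le_of_mul_le_mul_left (?_ : 2 * A * _ ≤ 2 * A * _) (by omega)
    calc 2 * A * (8 * B₂.card) = c * B₂.card := by rw [hc]; ring
      _ ≤ 2 * (A * M + 1) := by omega
      _ ≤ 2 * A * (M + 1) := by nlinarith
  have d3 : 8 * ((Finset.range c).biUnion B₃).card ≤ M := by
    have hcA : 0 < c * A := Nat.mul_pos (by omega) (by omega)
    refine Nat.le_of_mul_le_mul_left (?_ : c * A * _ ≤ c * A * _) hcA
    calc c * A * (8 * ((Finset.range c).biUnion B₃).card)
        = C * ((Finset.range c).biUnion B₃).card := by rw [hC]; ring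
      _ ≤ c * τ := c3
      _ ≤ c * (A * M) := Nat.mul_le_mul_left _ hτ
      _ = _ := by ring
  omega

end Counting

/-! ### Choice of the scales and the Borel–Cantelli argument -/

namespace IsMixingWalk

variable {q : ℝ≥0∞} {μ : Measure (ℕ → Letter d)}

/-- Since R < ∞ almost surely, the probability that R is at least m tends to 0. Each scale is chosen
after the previous one, large enough to beat the number of words and times that the previous scale
produces. -/
lemma exists_stretch_scales [IsProbabilityMeasure μ] {c C r : ℕ}
    (h0 : μ (noStop c) = 0) (K : ℝ) : ∃ h : ℕ → ℕ, h 0 = 0 ∧ StrictMono h ∧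
      ∀ i, (C * (h i + r) + 1 : ℕ) * (Fintype.card (Letter d) ^ (C * (h i + r)) *
        (ENNReal.ofReal K * μ {ζ | (h (i + 1) : ℕ∞) ≤ stopTime c ζ})) ≤ 8⁻¹ / (c : ℝ≥0∞) := by
  have htend : Tendsto (fun m : ℕ => μ {ζ : ℕ → Letter d | (m : ℕ∞) ≤ stopTime c ζ}) atTop (𝓝 0) := by
    rw [← h0, noStop_eq_iInter]
    refine tendsto_measure_iInter_atTop
      (fun m => (determined_le_stopTime c m).measurableSet.nullMeasurableSet) ?_
      ⟨0, measure_ne_top _ _⟩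
    intro m m' hm ζ hζ
    exact le_trans (by exact_mod_cast hm) (Set.mem_ofPred.1 hζ)
  have hex : ∀ x : ℕ, ∃ y, x < y ∧ (C * (x + r) + 1 : ℕ) *
      (Fintype.card (Letter d) ^ (C * (x + r)) *
        (ENNReal.ofReal K * μ {ζ | (y : ℕ∞) ≤ stopTime c ζ})) ≤ 8⁻¹ / (c : ℝ≥0∞) := by
    intro x
    set a : ℝ≥0∞ := (C * (x + r) + 1 : ℕ) *
      (Fintype.card (Letter d) ^ (C * (x + r)) * ENNReal.ofReal K) with ha
    have hat : a ≠ ⊤ := ENNReal.mul_ne_top (ENNReal.natCast_ne_top _)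
      (ENNReal.mul_ne_top (ENNReal.pow_ne_top (ENNReal.natCast_ne_top _)) ENNReal.ofReal_ne_top)
    have h1 : Tendsto (fun m : ℕ => a * μ {ζ : ℕ → Letter d | (m : ℕ∞) ≤ stopTime c ζ}) atTop
        (𝓝 0) := by
      have := ENNReal.Tendsto.const_mul htend (Or.inr hat)
      rwa [mul_zero] at this
    have hpos : (0 : ℝ≥0∞) < 8⁻¹ / (c : ℝ≥0∞) :=
      ENNReal.div_pos (by simp) (ENNReal.natCast_ne_top c)
    obtain ⟨y, hy1, hy2⟩ := ((h1.eventually_le_const hpos).and (eventually_gt_atTop x)).exists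
    refine ⟨y, hy2, le_trans (le_of_eq ?_) hy1⟩
    rw [ha]; ring
  choose g hg1 hg2 using hex
  refine ⟨fun i => g^[i] 0, rfl, strictMono_nat_of_lt_succ fun i => ?_, fun i => ?_⟩
  · rw [Function.iterate_succ_apply']; exact hg1 _
  · simp only [Function.iterate_succ_apply']; exact hg2 _

/-- If `R < ∞` almost surely for all constants `c`, then the walk has no positive speed. -/
theorem ae_eventually_height_le_div (h : IsMixingWalk q μ) (h0 : ∀ c : ℝ, μ (noStop c) = 0) {A : ℕ}
    (hA : 1 ≤ A) : ∀ᵐ ξ ∂μ, ∀ᶠ n : ℕ in atTop, A * height ξ n ≤ n := by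
  classical
  have := h.isProbabilityMeasure
  -- The constants are those for 2A: a height H is rounded down to a multiple M of 2W with H ≤ 2M,
  -- so a time below A H is a time below 2A M.
  set c := 16 * (2 * A) with hc
  obtain ⟨D, r, hD⟩ := h.exists_isRate (c := (c : ℝ)) (by
    have : 1 ≤ c := by omega
    exact_mod_cast this)
  set C := 8 * c * (2 * A) with hC
  obtain ⟨g, hg0, hg1, hg2⟩ := exists_stretch_scales (C := C) (r := r)
    (h0 c) (D r)
  set W := stretchSpan c r C g with hW
  have hW1 : 1 ≤ W := by rw [hW, stretchSpan]; omega
  have hE : ∀ (l : ℕ) (ξ : ℕ → Letter d), ξ ∈ Reaches (l : ℤ) →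
      μ (cyl (hit l ξ) ξ ∩ LongStretch c r C g l) ≤ 8⁻¹ * μ (cyl (hit l ξ) ξ) := fun l ξ hξ =>
    measure_cyl_inter_longStretch_le (by omega) hD hg2 hξ
  have hsum : ∑' k, μ {ξ | W * k ≤ ((Finset.range (W * (2 * k))).filter
      fun l => ξ ∈ LongStretch c r C g l).card} ≠ ⊤ := by
    refine ne_top_of_le_ne_top ?_
      (ENNReal.tsum_le_tsum fun k => measure_many_longStretch_le hE k)
    rw [ENNReal.tsum_mul_left, ENNReal.tsum_geometric]
    refine ENNReal.mul_ne_top (ENNReal.natCast_ne_top _) ?_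
    rw [ENNReal.one_sub_inv_two, inv_inv]
    exact ENNReal.ofNat_ne_top
  filter_upwards [ae_eventually_notMem hsum] with ξ hξ
  obtain ⟨k₀, hk₀⟩ := eventually_atTop.1 hξ
  set k₁ := k₀ + 4 * (r + g c) + 2 with hk₁
  filter_upwards [eventually_ge_atTop (A * (2 * W * k₁))] with n hn
  by_contra hlt
  push Not at hlt
  obtain ⟨H, hH⟩ := Int.eq_ofNat_of_zero_le (show 0 ≤ height ξ n by
    by_contra hneg
    have : (A : ℤ) * height ξ n ≤ 0 := mul_nonpos_of_nonneg_of_nonpos (by positivity) (by omega)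
    omega)
  rw [hH] at hlt
  have hlt' : n < A * H := by exact_mod_cast hlt
  set k := H / (2 * W) with hk
  have hHk : 2 * W * k ≤ H := Nat.mul_div_le _ _
  have hHk' : H < 2 * W * k + 2 * W := by
    have := Nat.lt_mul_div_succ H (show 0 < 2 * W by omega)
    rwa [mul_add, mul_one] at this
  have hkk : k₁ ≤ k := by
    rw [hk, Nat.le_div_iff_mul_le (by omega), mul_comm]
    exact (Nat.lt_of_mul_lt_mul_left (hn.trans_lt hlt')).le
  set M := W * (2 * k) with hM
  have hMk : 2 * W * k = M := by rw [hM]; ring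
  have hkM : k ≤ M := by
    rw [hM]; calc k ≤ 2 * k := by omega
      _ ≤ W * (2 * k) := Nat.le_mul_of_pos_left _ hW1
  have hWM : 2 * W ≤ M := by
    rw [← hMk]; exact Nat.le_mul_of_pos_right _ (by omega)
  have hMn : (M : ℤ) ≤ height ξ n := by rw [hH]; exact_mod_cast (by omega : M ≤ H)
  have hτ : hit M ξ ≤ 2 * A * M := by
    refine (hit_le hMn).trans ?_
    have : A * H ≤ A * (2 * M) := Nat.mul_le_mul_left _ (by omega)
    calc n ≤ A * H := hlt'.le
      _ ≤ A * (2 * M) := this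
      _ = 2 * A * M := by ring
  have hmany := many_longStretch hg0 hg1 (by omega : 1 ≤ 2 * A) hc hC (ξ := ξ) (M := M) ⟨n, hMn⟩ hτ
    (r := r) (by omega)
  refine hk₀ k (by omega) ?_
  have : M = 2 * (W * k) := by rw [hM]; ring
  change W * k ≤ ((Finset.range M).filter fun l => ξ ∈ LongStretch c r C g l).card
  omega

end IsMixingWalk

end RWRE

namespace RWRE

section Bridge

variable {d : ℕ} [NeZero d]

/-! ### Steps and their weights -/

lemma Dir.vec_injective : Function.Injective (Dir.vec : Dir d → Site d) := by
  rintro ⟨i, s⟩ ⟨j, t⟩ h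
  have hi := congrFun h i
  simp only [Dir.vec, Pi.single_eq_same] at hi
  by_cases hij : i = j
  · subst hij
    rw [Pi.single_eq_same] at hi
    rw [Units.ext hi]
  · rw [Pi.single_eq_of_ne hij] at hi
    exact absurd hi s.ne_zero

lemma stepLaw_apply (p : SiteLaw d) (z : Site d) (s : Set (Site d)) :
    stepLaw p z s = ∑ e : Dir d, ENNReal.ofReal (p e) * s.indicator 1 (z + e.vec) := by
  simp [stepLaw, Measure.dirac_apply' _ (Set.to_countable s).measurableSet]

lemma stepLaw_singleton (p : SiteLaw d) (z : Site d) (e : Dir d) :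
    stepLaw p z {z + e.vec} = ENNReal.ofReal (p e) := by
  classical
  rw [stepLaw_apply, Finset.sum_eq_single e]
  · simp
  · intro e' _ he'
    rw [Set.indicator_of_notMem, mul_zero]
    intro h
    exact he' (Dir.vec_injective (add_left_cancel (Set.mem_singleton_iff.1 h)))
  · simp

lemma stepLaw_singleton_of_forall_ne (p : SiteLaw d) {z y : Site d} (h : ∀ e : Dir d, e.vec ≠ y - z) :
    stepLaw p z {y} = 0 := by
  rw [stepLaw_apply]
  refine Finset.sum_eq_zero fun e _ => ?_
  rw [Set.indicator_of_notMem, mul_zero]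
  intro h'
  exact h e (by rw [← Set.mem_singleton_iff.1 h']; abel)

/-- The probability of a coin. -/
noncomputable def coinWeight (κ : EllipticityConst d) (b : Bool) : ℝ≥0∞ :=
  if b then ENNReal.ofReal (d * κ) else ENNReal.ofReal (1 - d * κ)

/-- The jump law at a site with law `p` when the coin shows `b`. -/
noncomputable def coinSite (κ : EllipticityConst d) (p : SiteLaw d) (b : Bool) : SiteLaw d :=
  if b = true then uniformLaw d else residualLaw κ p

/-- The weight of a letter at a site with law `p`. -/
noncomputable def letterWeight (κ : EllipticityConst d) (p : SiteLaw d) (a : Letter d) : ℝ≥0∞ :=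
  if a.mark then ENNReal.ofReal (κ / 2) else ENNReal.ofReal (p a.dir - κ / 2)

lemma measurable_letterWeight (κ : EllipticityConst d) (a : Letter d) :
    Measurable fun p => letterWeight κ p a := by
  unfold letterWeight
  split
  · exact measurable_const
  · exact ENNReal.measurable_ofReal.comp
      (((measurable_pi_apply a.dir).comp measurable_subtype_coe).sub_const _)

lemma letterWeight_le_one (κ : EllipticityConst d) (p : SiteLaw d) (a : Letter d) :
    letterWeight κ p a ≤ 1 := by
  have hd : (1 : ℝ) ≤ d := Nat.one_le_cast.2 (NeZero.pos d)
  have h1 := κ.mul_mem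
  have h2 := κ.2.1
  unfold letterWeight
  split <;> rw [ENNReal.ofReal_le_one]
  · nlinarith [h1.2]
  · have h3 : p a.dir ≤ 1 := by
      have h4 : ∑ e, p e = 1 := p.2.2
      rw [← h4]
      exact Finset.single_le_sum (f := fun e => p e) (fun e _ => p.2.1 e) (Finset.mem_univ _)
    linarith

/-- The point of the coins: a coin 1 followed by a uniform step has weight dκ · 1/(2d) = κ/2 at
every site, and the factor 1 − dκ of a coin 0 cancels the normalisation of the residual law. -/
lemma coinWeight_mul (κ : EllipticityConst d) {p : SiteLaw d} (hp : ∀ e, (κ : ℝ) / 2 ≤ p e)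
    (a : Letter d) :
    coinWeight κ a.mark * ENNReal.ofReal (coinSite κ p a.mark a.dir) = letterWeight κ p a := by
  obtain ⟨e, b⟩ := a
  have hd : (d : ℝ) ≠ 0 := Nat.cast_ne_zero.2 (NeZero.ne d)
  have h1 := κ.mul_mem
  cases b
  · simp only [coinWeight, coinSite, letterWeight, Bool.false_eq_true, if_false, residualLaw,
      dif_pos hp]
    rw [← ENNReal.ofReal_mul (sub_pos.2 h1.2).le]
    congr 1
    exact mul_div_cancel₀ _ (sub_pos.2 h1.2).ne'
  · simp only [coinWeight, coinSite, letterWeight, if_true]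
    rw [← ENNReal.ofReal_mul h1.1.le]
    congr 1
    change (d * κ : ℝ) * (1 / (2 * d)) = κ / 2
    field_simp

lemma sum_letterWeight (κ : EllipticityConst d) {p : SiteLaw d} (hp : ∀ e, (κ : ℝ) / 2 ≤ p e)
    (e : Dir d) : ∑ b : Bool, letterWeight κ p ⟨e, b⟩ = ENNReal.ofReal (p e) := by
  simp only [letterWeight, Fintype.sum_bool, if_true, Bool.false_eq_true, if_false]
  rw [← ENNReal.ofReal_add (half_pos κ.2.1).le (sub_nonneg.2 (hp e))]
  congr 1
  ring

lemma sum_coinWeight_mul_stepLaw (κ : EllipticityConst d) {p : SiteLaw d}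
    (hp : ∀ e, (κ : ℝ) / 2 ≤ p e) (z : Site d) (s : Set (Site d)) :
    ∑ b : Bool, coinWeight κ b * stepLaw (coinSite κ p b) z s = stepLaw p z s := by
  simp only [stepLaw_apply, Finset.mul_sum]
  rw [Finset.sum_comm]
  refine Finset.sum_congr rfl fun e _ => ?_
  rw [← sum_letterWeight κ hp e, Finset.sum_mul]
  refine Finset.sum_congr rfl fun b _ => ?_
  rw [← mul_assoc, coinWeight_mul κ hp ⟨e, b⟩]

/-! ### The law of the path and of the coins -/

lemma pathLaw_cyl (x : Site d) (q : ℕ → Env d) (n : ℕ) (y : WalkPath d) :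
    pathLaw x q (cyl (n + 1) y) = if x = y 0 then
      ∏ i ∈ Finset.range n, stepLaw (q i (y i)) (y i) {y (i + 1)} else 0 := by
  have h : ∀ n, (pathLaw x q).map (Preorder.frestrictLe n) {Preorder.frestrictLe n y} =
      pathLaw x q (cyl (n + 1) y) := by
    intro n
    rw [Measure.map_apply (by fun_prop) (measurableSet_singleton _)]
    congr 1
    ext X
    simp only [Set.mem_preimage, Set.mem_singleton_iff, cyl, Set.mem_ofPred, funext_iff,
      Preorder.frestrictLe_apply, Subtype.forall, Finset.mem_Iic, Nat.lt_succ_iff]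
  induction n with
  | zero =>
    rw [← h, pathLaw_init, Finset.range_zero, Finset.prod_empty]
    rfl
  | succ n ih =>
    rw [← h, pathLaw_succ]
    have h1 : Preorder.frestrictLe₂ (π := fun _ => Site d) n.le_succ
        (Preorder.frestrictLe (n + 1) y) = Preorder.frestrictLe n y := rfl
    rw [h1, h, ih, Finset.prod_range_succ, ite_mul, zero_mul]
    rfl

lemma ae_pathLaw_zero (x : Site d) (q : ℕ → Env d) : ∀ᵐ X ∂(pathLaw x q), X 0 = x := by
  have hm : Measurable (Preorder.frestrictLe 0 : WalkPath d → _) := by fun_prop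
  have h : ∀ᵐ a ∂((pathLaw x q).map (Preorder.frestrictLe 0)),
      a ⟨0, Finset.mem_Iic.2 le_rfl⟩ = x := by
    rw [ae_iff_of_countable]
    intro a ha
    rw [pathLaw_init] at ha
    exact (ite_ne_right_iff.1 ha).1.symm
  exact ae_of_ae_map hm.aemeasurable h

lemma ae_pathLaw_step (x : Site d) (q : ℕ → Env d) (n : ℕ) :
    ∀ᵐ X ∂(pathLaw x q), ∃ e : Dir d, e.vec = X (n + 1) - X n := by
  have hm : Measurable (Preorder.frestrictLe (n + 1) : WalkPath d → _) := by fun_prop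
  have h : ∀ᵐ a ∂((pathLaw x q).map (Preorder.frestrictLe (n + 1))), ∃ e : Dir d,
      e.vec = a ⟨n + 1, Finset.mem_Iic.2 le_rfl⟩ - a ⟨n, Finset.mem_Iic.2 n.le_succ⟩ := by
    rw [ae_iff_of_countable]
    intro a ha
    rw [pathLaw_succ] at ha
    by_contra hne
    push Not at hne
    exact (mul_ne_zero_iff.1 ha).2 (stepLaw_singleton_of_forall_ne _ hne)
  exact ae_of_ae_map hm.aemeasurable h

/-- Coins used at different times have different indices even if the path returns to a site, so
along a fixed path they are independent. -/
lemma lintegral_coinLaw_prod (κ : EllipticityConst d) (n : ℕ) (x : ℕ → Site d)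
    (f : ℕ → Bool → ℝ≥0∞) :
    ∫⁻ ε, ∏ i ∈ Finset.range n, f i (ε (i, x i)) ∂(coinLaw κ) =
      ∏ i ∈ Finset.range n, ∑ b : Bool, coinWeight κ b * f i b := by
  have hind : iIndepFun (fun i (ε : Coins d) => f i (ε (i, x i))) (coinLaw κ) := by
    have h := (iIndepFun_infinitePi (P := fun _ : ℕ × Site d =>
        bernoulliMeasure true false ⟨d * κ, Set.Ioo_subset_Icc_self κ.mul_mem⟩)
        (X := fun p : ℕ × Site d => f p.1) (fun p => Measurable.of_discrete))
    exact h.precomp (g := fun i => (i, x i)) fun i j hij => (Prod.mk.inj hij).1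
  rw [lintegral_prod_eq_prod_lintegral_of_indepFun _ _ hind fun i =>
    Measurable.of_discrete.comp (measurable_pi_apply _)]
  refine Finset.prod_congr rfl fun i _ => ?_
  have h := measurePreserving_eval_infinitePi (fun _ : ℕ × Site d =>
        bernoulliMeasure true false ⟨d * κ, Set.Ioo_subset_Icc_self κ.mul_mem⟩) (i, x i)
  have h2 := h.lintegral_comp (f := f i) Measurable.of_discrete
  refine h2.trans ?_
  have e1 : ((unitInterval.toNNReal ⟨d * κ, Set.Ioo_subset_Icc_self κ.mul_mem⟩ : NNReal) : ℝ≥0∞) =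
      ENNReal.ofReal (d * κ) := (ENNReal.ofReal_eq_coe_nnreal _).symm
  have e2 : ((unitInterval.toNNReal
      (unitInterval.symm ⟨d * κ, Set.Ioo_subset_Icc_self κ.mul_mem⟩) : NNReal) : ℝ≥0∞) =
      ENNReal.ofReal (1 - d * κ) := (ENNReal.ofReal_eq_coe_nnreal _).symm
  rw [bernoulliMeasure_def, lintegral_add_measure]
  simp only [lintegral_smul_measure, lintegral_dirac, Fintype.sum_bool, coinWeight, if_true,
    Bool.false_eq_true, if_false, ENNReal.smul_def, smul_eq_mul, e1, e2]

/-! ### The letters of the walk with coins -/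

open Classical in
/-- The direction of a step. -/
noncomputable def dirOf (z : Site d) : Dir d := if h : ∃ e : Dir d, e.vec = z then h.choose else (0, 1)

lemma vec_dirOf {z : Site d} (h : ∃ e : Dir d, e.vec = z) : (dirOf z).vec = z := by
  rw [dirOf, dif_pos h]
  exact h.choose_spec

/-- The steps of the walk and the coins used for them. -/
noncomputable def letters (w : (Env d × Coins d) × WalkPath d) : ℕ → Letter d :=
  fun i => ⟨dirOf (w.2 (i + 1) - w.2 i), w.1.2 (i, w.2 i)⟩

lemma measurable_coin_at (i : ℕ) :
    Measurable fun w : (Env d × Coins d) × WalkPath d => w.1.2 (i, w.2 i) := by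
  have h : Measurable fun p : Coins d × Site d => p.1 (i, p.2) :=
    measurable_from_prod_countable_left fun x => measurable_pi_apply (i, x)
  exact h.comp (measurable_fst.snd.prodMk ((measurable_pi_apply i).comp measurable_snd))

lemma measurable_letters :
    Measurable (letters : (Env d × Coins d) × WalkPath d → ℕ → Letter d) := by
  refine measurable_pi_lambda _ fun i => ?_
  have h : Measurable fun p : (Site d × Site d) × Bool => (⟨dirOf (p.1.2 - p.1.1), p.2⟩ : Letter d) :=
    Measurable.of_discrete
  exact h.comp ((((measurable_pi_apply i).comp measurable_snd).prodMk
    ((measurable_pi_apply (i + 1)).comp measurable_snd)).prodMk (measurable_coin_at i))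

/-- The law of the letters. -/
noncomputable def letterLaw (P : Measure (Env d)) (κ : EllipticityConst d) :
    Measure (ℕ → Letter d) := (tripleLaw P κ).map letters

instance (P : Measure (Env d)) [IsProbabilityMeasure P] (κ : EllipticityConst d) :
    IsProbabilityMeasure (tripleLaw P κ) := by
  unfold tripleLaw; infer_instance

instance (P : Measure (Env d)) [IsProbabilityMeasure P] (κ : EllipticityConst d) :
    IsProbabilityMeasure (letterLaw P κ) :=
  Measure.isProbabilityMeasure_map measurable_letters.aemeasurable

/-- Only almost sure, because `dirOf` takes a default value on increments that are not unit vectors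
and paths of letters start at the origin. -/
lemma ae_path_letters (P : Measure (Env d)) [IsProbabilityMeasure P] (κ : EllipticityConst d) :
    ∀ᵐ w ∂(tripleLaw P κ), path (letters w) = w.2 := by
  have h0 : ∀ᵐ w ∂(tripleLaw P κ), w.2 0 = 0 :=
    Measure.ae_compProd_of_ae_ae
      (measurableSet_eq_fun ((measurable_pi_apply 0).comp measurable_snd) measurable_const)
      (ae_of_all _ fun w => ae_pathLaw_zero 0 (coinEnv κ w))
  have h1 : ∀ᵐ w ∂(tripleLaw P κ), ∀ n, ∃ e : Dir d, e.vec = w.2 (n + 1) - w.2 n := by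
    refine ae_all_iff.2 fun n => Measure.ae_compProd_of_ae_ae ?_
      (ae_of_all _ fun w => ae_pathLaw_step 0 (coinEnv κ w) n)
    have h : Measurable fun w : (Env d × Coins d) × WalkPath d => w.2 (n + 1) - w.2 n :=
      ((measurable_pi_apply (n + 1)).comp measurable_snd).sub
        ((measurable_pi_apply n).comp measurable_snd)
    exact h (Set.to_countable {z | ∃ e : Dir d, e.vec = z}).measurableSet
  filter_upwards [h0, h1] with w hw0 hw1
  funext n
  induction n with
  | zero => rw [path_zero, hw0]
  | succ n ih =>
    rw [path_succ, ih, show (letters w n).dir = dirOf (w.2 (n + 1) - w.2 n) from rfl,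
      vec_dirOf (hw1 n)]
    abel

/-- The law of the environment is elliptic at all sites. -/
lemma IsUniformlyElliptic.ae_forall {P : Measure (Env d)} {κ : EllipticityConst d}
    (hell : IsUniformlyElliptic P κ) (hstat : IsShiftInvariant P) :
    ∀ᵐ ω ∂P, ∀ x, ∀ e : Dir d, (κ : ℝ) / 2 ≤ ω x e := by
  rw [ae_all_iff]
  intro x
  have hm : Measurable (shiftEnv x : Env d → Env d) :=
    measurable_pi_lambda _ fun z => measurable_pi_apply (z + x)
  have h := hell
  rw [IsUniformlyElliptic, ← hstat x] at h
  filter_upwards [ae_of_ae_map hm.aemeasurable h] with ω hω e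
  have h2 := hω e
  rw [shiftEnv, zero_add] at h2
  linarith [κ.2.1]

/-- The probability of a cylinder under the law of the letters. -/
lemma letterLaw_cyl {P : Measure (Env d)} [IsProbabilityMeasure P] {κ : EllipticityConst d}
    (hell : IsUniformlyElliptic P κ) (hstat : IsShiftInvariant P) (n : ℕ) (ξ : ℕ → Letter d) :
    letterLaw P κ (cyl n ξ) =
      ∫⁻ ω, ∏ i ∈ Finset.range n, letterWeight κ (ω (path ξ i)) (ξ i) ∂P := by
  set E : Set ((Env d × Coins d) × WalkPath d) :=
    {w | w.2 ∈ cyl (n + 1) (path ξ) ∧ ∀ i < n, w.1.2 (i, path ξ i) = (ξ i).mark} with hE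
  have hcoin : ∀ i, Measurable fun w : Env d × Coins d => w.2 (i, path ξ i) := fun i =>
    (measurable_pi_apply _).comp measurable_snd
  have hC : MeasurableSet {w : Env d × Coins d | ∀ i < n, w.2 (i, path ξ i) = (ξ i).mark} := by
    simp only [Set.ofPred_forall]
    exact MeasurableSet.iInter fun i => MeasurableSet.iInter fun _ =>
      measurableSet_eq_fun (hcoin i) measurable_const
  have hEm : MeasurableSet E := by
    have h1 : MeasurableSet {w : (Env d × Coins d) × WalkPath d | w.2 ∈ cyl (n + 1) (path ξ)} :=
      measurable_snd (measurableSet_cyl (n + 1) (path ξ))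
    exact h1.inter (measurable_fst hC)
  have h1 : letterLaw P κ (cyl n ξ) = tripleLaw P κ E := by
    rw [letterLaw, Measure.map_apply measurable_letters (measurableSet_cyl n ξ)]
    refine measure_congr ?_
    filter_upwards [ae_path_letters P κ] with w hw
    refine propext ⟨fun h => ?_, fun h => ?_⟩
    · have h2 : ∀ i ≤ n, w.2 i = path ξ i := fun i hi => by
        rw [← hw]; exact path_congr h hi
      refine ⟨fun i hi => h2 i (Nat.lt_succ_iff.1 hi), fun i hi => ?_⟩
      rw [← h2 i hi.le]
      exact congrArg Letter.mark (h i hi)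
    · intro i hi
      have e1 : (letters w i).dir = (ξ i).dir := by
        apply Dir.vec_injective
        have e2 := path_succ (letters w) i
        rw [hw, h.1 (i + 1) (Nat.succ_lt_succ hi), h.1 i (by omega), path_succ] at e2
        exact (add_left_cancel e2).symm
      have e2 : (letters w i).mark = (ξ i).mark := by
        rw [← h.2 i hi, ← h.1 i (by omega)]; rfl
      have : ∀ a b : Letter d, a.dir = b.dir → a.mark = b.mark → a = b := by
        rintro ⟨a1, a2⟩ ⟨b1, b2⟩ rfl rfl; rfl
      exact this _ _ e1 e2
  classical
  have h2 : ∀ w : Env d × Coins d, coinQuenched κ 0 w (Prod.mk w ⁻¹' E) =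
      ∏ i ∈ Finset.range n, ((if w.2 (i, path ξ i) = (ξ i).mark then 1 else 0) *
        ENNReal.ofReal (coinSite κ (w.1 (path ξ i)) (w.2 (i, path ξ i)) (ξ i).dir)) := by
    intro w
    by_cases hw : ∀ i < n, w.2 (i, path ξ i) = (ξ i).mark
    · have h3 : Prod.mk w ⁻¹' E = cyl (n + 1) (path ξ) := by
        ext X; exact ⟨fun h => h.1, fun h => ⟨h, hw⟩⟩
      rw [h3]
      refine (pathLaw_cyl 0 (coinEnv κ w) n (path ξ)).trans ?_
      rw [if_pos (path_zero ξ).symm]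
      refine Finset.prod_congr rfl fun i hi => ?_
      rw [if_pos (hw i (Finset.mem_range.1 hi)), one_mul, path_succ, stepLaw_singleton]
      rfl
    · have h3 : Prod.mk w ⁻¹' E = ∅ := by
        ext X; exact ⟨fun h => hw h.2, fun h => h.elim⟩
      rw [h3, measure_empty]
      push Not at hw
      obtain ⟨i, hi, hi2⟩ := hw
      exact (Finset.prod_eq_zero (Finset.mem_range.2 hi) (by rw [if_neg hi2, zero_mul])).symm
  rw [h1, tripleLaw, Measure.compProd_apply hEm]
  simp only [h2]
  rw [lintegral_prod]
  · refine lintegral_congr_ae ?_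
    filter_upwards [hell.ae_forall hstat] with ω hω
    refine (lintegral_coinLaw_prod κ n (path ξ) fun i b => (if b = (ξ i).mark then 1 else 0) *
      ENNReal.ofReal (coinSite κ (ω (path ξ i)) b (ξ i).dir)).trans ?_
    refine Finset.prod_congr rfl fun i _ => ?_
    rw [Finset.sum_eq_single (ξ i).mark, if_pos rfl, one_mul, coinWeight_mul κ (hω _)]
    · intro b _ hb
      rw [if_neg hb, zero_mul, mul_zero]
    · simp
  · simp only [← h2]
    exact (Kernel.measurable_kernel_prodMk_left hEm).aemeasurable

/-- The walk has the same law with and without coins. -/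
lemma annealed_map_snd {P : Measure (Env d)} [IsProbabilityMeasure P] {κ : EllipticityConst d}
    (hell : IsUniformlyElliptic P κ) (hstat : IsShiftInvariant P) :
    (annealed P).map Prod.snd = (tripleLaw P κ).map Prod.snd := by
  have : IsProbabilityMeasure (annealed P) := by unfold annealed; infer_instance
  have i1 : IsProbabilityMeasure ((annealed P).map Prod.snd) :=
    Measure.isProbabilityMeasure_map measurable_snd.aemeasurable
  have i2 : IsProbabilityMeasure ((tripleLaw P κ).map Prod.snd) :=
    Measure.isProbabilityMeasure_map measurable_snd.aemeasurable
  have key : ∀ n (y : WalkPath d),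
      (annealed P).map Prod.snd (cyl n y) = (tripleLaw P κ).map Prod.snd (cyl n y) := by
    intro n y
    cases n with
    | zero =>
      have : cyl 0 y = Set.univ := by ext; simp [cyl]
      rw [this, measure_univ, measure_univ]
    | succ n =>
      have hc : MeasurableSet (cyl (n + 1) y) := measurableSet_cyl _ _
      rw [Measure.map_apply measurable_snd hc, Measure.map_apply measurable_snd hc, annealed,
        tripleLaw, Measure.compProd_apply (measurable_snd hc),
        Measure.compProd_apply (measurable_snd hc), lintegral_prod]
      · refine lintegral_congr_ae ?_
        filter_upwards [hell.ae_forall hstat] with ω hω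
        refine (pathLaw_cyl 0 (fun _ => ω) n y).trans ?_
        have h1 : ∀ ε : Coins d, coinQuenched κ 0 (ω, ε) (Prod.mk (ω, ε) ⁻¹'
            (Prod.snd ⁻¹' cyl (n + 1) y)) = _ := fun ε => pathLaw_cyl 0 (coinEnv κ (ω, ε)) n y
        rw [lintegral_congr h1]
        split_ifs
        · refine Eq.trans ?_ (lintegral_coinLaw_prod κ n y fun i b =>
            stepLaw (coinSite κ (ω (y i)) b) (y i) {y (i + 1)}).symm
          exact Finset.prod_congr rfl fun i _ =>
            (sum_coinWeight_mul_stepLaw κ (hω _) _ _).symm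
        · simp
      · exact (Kernel.measurable_kernel_prodMk_left (measurable_snd hc)).aemeasurable
  exact le_antisymm (measure_le_of_cyl fun n y => (key n y).le)
    (measure_le_of_cyl fun n y => (key n y).ge)

end Bridge

end RWRE

namespace RWRE

section Mixing

variable {d : ℕ} [NeZero d]

/-! ### Exponential sums over the lattice -/

lemma summable_exp_natAbs {β : ℝ} (hβ : 0 < β) : Summable fun z : ℤ => Real.exp (-β * z.natAbs) := by
  have h : Summable fun n : ℕ => Real.exp (-β * n) := by
    simpa using Real.summable_pow_mul_exp_neg_nat_mul 0 hβ
  exact Summable.of_nat_of_neg (by simpa using h) (by simpa using h)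

/-- The exponential of an ℓ¹-distance factorises over the coordinates; enlarging s to a box gives a
product of one-dimensional sums. -/
lemma sum_exp_dist1_le {β : ℝ} (hβ : 0 < β) (s : Finset (Site d)) (y : Site d) :
    ∑ x ∈ s, Real.exp (-β * dist1 x y) ≤ (∑' z : ℤ, Real.exp (-β * z.natAbs)) ^ d := by
  classical
  set T : Fin d → Finset ℤ := fun i => s.image fun x => x i - y i with hT
  have h1 : ∀ x, Real.exp (-β * dist1 x y) =
      ∏ i, Real.exp (-β * (x i - y i).natAbs) := by
    intro x
    rw [← Real.exp_sum, dist1, Nat.cast_sum, Finset.mul_sum]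
  calc ∑ x ∈ s, Real.exp (-β * dist1 x y)
      = ∑ x ∈ s.map (Equiv.subRight y).toEmbedding, ∏ i, Real.exp (-β * (x i).natAbs) := by
        rw [Finset.sum_map]
        exact Finset.sum_congr rfl fun x _ => h1 x
    _ ≤ ∑ x ∈ Fintype.piFinset T, ∏ i, Real.exp (-β * (x i).natAbs) := by
        refine Finset.sum_le_sum_of_subset_of_nonneg ?_ fun _ _ _ => by positivity
        intro x hx
        obtain ⟨z, hz, rfl⟩ := Finset.mem_map.1 hx
        exact Fintype.mem_piFinset.2 fun i => Finset.mem_image.2 ⟨z, hz, rfl⟩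
    _ = ∏ i, ∑ z ∈ T i, Real.exp (-β * z.natAbs) :=
        (Finset.prod_univ_sum T fun _ z => Real.exp (-β * z.natAbs)).symm
    _ ≤ ∏ _i : Fin d, ∑' z : ℤ, Real.exp (-β * z.natAbs) := by
        refine Finset.prod_le_prod (fun _ _ => by positivity) fun i _ => ?_
        exact (summable_exp_natAbs hβ).sum_le_tsum _ fun _ _ => by positivity
    _ = _ := by simp

/-- Half of the exponent pays for the distance N, the other half for summability. -/
lemma tsum_exp_dist1_le {γ : ℝ} (hγ : 0 < γ) (A : Set (Site d)) (y : Site d) (N : ℝ)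
    (hA : ∀ x ∈ A, N ≤ dist1 x y) :
    ∑' x : A, Real.exp (-γ * dist1 (x : Site d) y) ≤
      (∑' z : ℤ, Real.exp (-(γ / 2) * z.natAbs)) ^ d * Real.exp (-(γ / 2) * N) := by
  refine Real.tsum_le_of_sum_le (fun _ => by positivity) fun s => ?_
  calc ∑ x ∈ s, Real.exp (-γ * dist1 (x : Site d) y)
      ≤ ∑ x ∈ s, Real.exp (-(γ / 2) * dist1 (x : Site d) y) * Real.exp (-(γ / 2) * N) := by
        refine Finset.sum_le_sum fun x _ => ?_
        rw [← Real.exp_add]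
        refine Real.exp_le_exp.2 ?_
        nlinarith [hA x x.2]
    _ = (∑ x ∈ s.map (Function.Embedding.subtype _), Real.exp (-(γ / 2) * dist1 x y)) *
          Real.exp (-(γ / 2) * N) := by
        rw [Finset.sum_map, Finset.sum_mul]
        rfl
    _ ≤ _ := mul_le_mul_of_nonneg_right (sum_exp_dist1_le (half_pos hγ) _ y) (by positivity)

lemma summable_sq_mul_exp {β : ℝ} (hβ : 0 < β) :
    Summable fun j : ℕ => ((j : ℝ) + 1) ^ 2 * Real.exp (-β * j) := by
  have h := ((summable_nat_add_iff 1).2 (Real.summable_pow_mul_exp_neg_nat_mul 2 hβ)).mul_right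
    (Real.exp β)
  refine h.congr fun j => ?_
  rw [mul_assoc, ← Real.exp_add]
  push_cast
  ring_nf

/-- This is the role of the crowding part of R: quadratically many visits per level are summable
against exponential decay, uniformly in the number m of steps. -/
lemma sum_exp_le_of_crowd {β c : ℝ} (hβ : 0 < β) (hc : 0 ≤ c) (m : ℕ) (h : ℕ → ℕ)
    (hh : ∀ j : ℕ, (((Finset.range m).filter fun i => h i = j).card : ℝ) ≤ c * ((j : ℝ) + 1) ^ 2) :
    ∑ i ∈ Finset.range m, Real.exp (-β * h i) ≤
      c * ∑' j : ℕ, ((j : ℝ) + 1) ^ 2 * Real.exp (-β * j) := by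
  rw [← Finset.sum_fiberwise_of_maps_to (t := (Finset.range m).image h) (g := h)
    fun i hi => Finset.mem_image_of_mem h hi]
  calc ∑ j ∈ (Finset.range m).image h, ∑ i ∈ Finset.range m with h i = j, Real.exp (-β * h i)
      ≤ ∑ j ∈ (Finset.range m).image h, c * (((j : ℝ) + 1) ^ 2 * Real.exp (-β * j)) := by
        refine Finset.sum_le_sum fun j _ => ?_
        rw [Finset.sum_congr rfl fun i hi => by rw [(Finset.mem_filter.1 hi).2],
          Finset.sum_const, nsmul_eq_mul, ← mul_assoc]
        exact mul_le_mul_of_nonneg_right (hh j) (by positivity)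
    _ = c * ∑ j ∈ (Finset.range m).image h, ((j : ℝ) + 1) ^ 2 * Real.exp (-β * j) :=
        Finset.mul_sum _ _ _ |>.symm
    _ ≤ _ := mul_le_mul_of_nonneg_left
        ((summable_sq_mul_exp hβ).sum_le_tsum _ fun _ _ => by positivity) hc

/-! ### Decoupling of functions of the environment -/

/-- The function `Φ` depends on the environment in `Λ` only. -/
def DependsOnSites (Λ : Set (Site d)) (Φ : Env d → ℝ≥0∞) : Prop :=
  ∀ ω ω', (∀ x ∈ Λ, ω x = ω' x) → Φ ω = Φ ω'

lemma measurable_restr (Λ : Set (Site d)) : Measurable (restr Λ : Env d → Λ → SiteLaw d) :=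
  measurable_pi_lambda _ fun x => measurable_pi_apply (x : Site d)

lemma DependsOnSites.exists_eq {Λ : Set (Site d)} {Φ : Env d → ℝ≥0∞} (h : DependsOnSites Λ Φ)
    (hm : Measurable Φ) : ∃ F : (Λ → SiteLaw d) → ℝ≥0∞, Measurable F ∧ ∀ ω, Φ ω = F (restr Λ ω) := by
  classical
  refine ⟨fun η => Φ fun x => if hx : x ∈ Λ then η ⟨x, hx⟩ else uniformLaw d,
    hm.comp (measurable_pi_lambda _ fun x => ?_), fun ω => h _ _ fun x hx => ?_⟩
  · by_cases hx : x ∈ Λ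
    · simp only [hx, dif_pos]; exact measurable_pi_apply _
    · simp only [hx, dif_neg, not_false_eq_true]; exact measurable_const
  · simp [hx, restr]

/-- With A the whole complement of V, any two configurations in the set of full measure are
comparable. So the conditional mean g of Ψ given the environment off V satisfies g ω ≤ K g ω' almost
surely, and averaging over one argument compares g with the mean of Ψ in both directions. -/
lemma MixesWith.lintegral_mul {P : Measure (Env d)} [IsProbabilityMeasure P] {r : ℕ} {γ C : ℝ}
    (hmix : MixesWith P r γ C) {Δ V : Finset (Site d)} (hΔ : Δ ⊆ V)
    (hr : ∀ x ∈ Δ, ∀ y ∉ V, r ≤ dist1 x y) {K : ℝ≥0∞}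
    (hK : ENNReal.ofReal (Real.exp (C * ∑ y ∈ Δ, ∑' x : ((V : Set (Site d))ᶜ : Set (Site d)),
      Real.exp (-γ * dist1 (x : Site d) y))) ≤ K) {Φ Ψ : Env d → ℝ≥0∞}
    (hΦ : Measurable Φ) (hΨ : Measurable Ψ) (hΦV : DependsOnSites (V : Set (Site d))ᶜ Φ)
    (hΨΔ : DependsOnSites (Δ : Set (Site d)) Ψ) :
    ∫⁻ ω, Φ ω * Ψ ω ∂P ≤ K * ((∫⁻ ω, Φ ω ∂P) * ∫⁻ ω, Ψ ω ∂P) ∧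
      (∫⁻ ω, Φ ω ∂P) * ∫⁻ ω, Ψ ω ∂P ≤ K * ∫⁻ ω, Φ ω * Ψ ω ∂P := by
  obtain ⟨F, hF, hFe⟩ := hΦV.exists_eq hΦ
  obtain ⟨G, hG, hGe⟩ := hΨΔ.exists_eq hΨ
  obtain ⟨S, hS, hSle⟩ := hmix Δ V hΔ hr _ subset_rfl
  set g : Env d → ℝ≥0∞ := fun ω => ∫⁻ η, G η 
    ∂(condLaw P (Δ : Set (Site d)) (V : Set (Site d))ᶜ (restr (V : Set (Site d))ᶜ ω)) with hg
  have : IsMarkovKernel (condLaw P (Δ : Set (Site d)) (V : Set (Site d))ᶜ) := by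
    unfold condLaw; infer_instance
  have hgm : Measurable g := hG.lintegral_kernel.comp (measurable_restr (V : Set (Site d))ᶜ)
  have hint : ∀ f : (↥(V : Set (Site d))ᶜ → SiteLaw d) → ℝ≥0∞, Measurable f →
      ∫⁻ ω, f (restr (V : Set (Site d))ᶜ ω) * G (restr (Δ : Set (Site d)) ω) ∂P =
        ∫⁻ ω, f (restr (V : Set (Site d))ᶜ ω) * g ω ∂P := by
    intro f hf
    have h1 := compProd_map_condDistrib (mβ := MeasurableSpace.pi) (μ := P)
      (X := restr (V : Set (Site d))ᶜ)
      (measurable_restr (Δ : Set (Site d))).aemeasurable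
    have hm : Measurable fun p : (↥(V : Set (Site d))ᶜ → SiteLaw d) ×
        (↥(Δ : Set (Site d)) → SiteLaw d) =>
      f p.1 * G p.2 := (hf.comp measurable_fst).mul (hG.comp measurable_snd)
    have h2 := congrArg (fun ν => ∫⁻ p, f p.1 * G p.2 ∂ν) h1
    rw [Measure.lintegral_compProd hm,
      lintegral_map hm ((measurable_restr (V : Set (Site d))ᶜ).prodMk (measurable_restr _)),
      lintegral_map hm.lintegral_kernel_prod_right (measurable_restr (V : Set (Site d))ᶜ)] at h2
    rw [← h2]
    refine lintegral_congr fun ω => ?_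
    exact lintegral_const_mul (f (restr (V : Set (Site d))ᶜ ω)) hG
  have hΨg : ∫⁻ ω, Ψ ω ∂P = ∫⁻ ω, g ω ∂P := by
    have h := hint (fun _ => 1) measurable_const
    simp only [one_mul] at h
    rw [← h]
    exact lintegral_congr hGe
  have hΦΨ : ∫⁻ ω, Φ ω * Ψ ω ∂P = ∫⁻ ω, Φ ω * g ω ∂P := by
    have h := hint F hF
    simp only [← hFe, ← hGe] at h
    exact h
  have hgg : ∀ ω ω', restr (V : Set (Site d))ᶜ ω ∈ S → restr (V : Set (Site d))ᶜ ω' ∈ S → g ω ≤ K * g ω' := by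
    intro ω ω' h h'
    refine (lintegral_mono' (hSle _ h _ h' fun x hx => absurd x.2 hx) le_rfl).trans ?_
    rw [lintegral_smul_measure]
    exact mul_le_mul_left hK _
  have h1 : ∀ᵐ ω ∂P, g ω ≤ K * ∫⁻ ω', g ω' ∂P := by
    filter_upwards [hS] with ω hω
    rw [← lintegral_const_mul _ hgm]
    have h : ∫⁻ _, g ω ∂P = g ω := by simp
    rw [← h]
    refine lintegral_mono_ae ?_
    filter_upwards [hS] with ω' hω'
    exact hgg ω ω' hω hω'
  have h2 : ∀ᵐ ω ∂P, ∫⁻ ω', g ω' ∂P ≤ K * g ω := by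
    filter_upwards [hS] with ω hω
    have h : ∫⁻ _, K * g ω ∂P = K * g ω := by simp
    rw [← h]
    refine lintegral_mono_ae ?_
    filter_upwards [hS] with ω' hω'
    exact hgg ω' ω hω' hω
  rw [hΦΨ, hΨg]
  constructor
  · rw [mul_comm (∫⁻ ω, Φ ω ∂P), ← mul_assoc, ← lintegral_const_mul _ hΦ]
    refine lintegral_mono_ae ?_
    filter_upwards [h1] with ω hω
    rw [mul_comm]
    exact mul_le_mul_left hω _
  · rw [← lintegral_mul_const _ hΦ, ← lintegral_const_mul K (f := fun ω => Φ ω * g ω) (hΦ.mul hgm)]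
    refine lintegral_mono_ae ?_
    filter_upwards [h2] with ω hω
    rw [mul_left_comm]
    exact mul_le_mul_right hω _

/-! ### Words in the environment -/

/-- The product of the weights of the first `n` letters of `ξ` along the path from `x`. -/
noncomputable def wordWeight (κ : EllipticityConst d) (x : Site d) (n : ℕ) (ξ : ℕ → Letter d)
    (ω : Env d) : ℝ≥0∞ :=
  ∏ i ∈ Finset.range n, letterWeight κ (ω (x + path ξ i)) (ξ i)

/-- The averaged weight of a word. -/
noncomputable def meanWeight (P : Measure (Env d)) (κ : EllipticityConst d) (n : ℕ)
    (ξ : ℕ → Letter d) : ℝ≥0∞ := ∫⁻ ω, wordWeight κ 0 n ξ ω ∂P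

lemma measurable_wordWeight (κ : EllipticityConst d) (x : Site d) (n : ℕ) (ξ : ℕ → Letter d) :
    Measurable (wordWeight κ x n ξ) :=
  Finset.measurable_prod _ fun i _ =>
    (measurable_letterWeight κ (ξ i)).comp (measurable_pi_apply _)

lemma wordWeight_le_one (κ : EllipticityConst d) (x : Site d) (n : ℕ) (ξ : ℕ → Letter d)
    (ω : Env d) : wordWeight κ x n ξ ω ≤ 1 :=
  Finset.prod_le_one' fun _ _ => letterWeight_le_one κ _ _

lemma wordWeight_add (κ : EllipticityConst d) (x : Site d) (n m : ℕ) (ξ : ℕ → Letter d)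
    (ω : Env d) : wordWeight κ x (n + m) ξ ω =
      wordWeight κ x n ξ ω * wordWeight κ (x + path ξ n) m (shiftSeq n ξ) ω := by
  simp only [wordWeight, Finset.prod_range_add, path_add, add_assoc]
  rfl

lemma wordWeight_of_marked (κ : EllipticityConst d) (x : Site d) (n : ℕ) (ξ : ℕ → Letter d)
    (ω : Env d) (h : ∀ i < n, (ξ i).mark = true) :
    wordWeight κ x n ξ ω = ENNReal.ofReal (κ / 2) ^ n := by
  rw [wordWeight, Finset.prod_congr rfl fun i hi => by
    rw [letterWeight, if_pos (h i (Finset.mem_range.1 hi))], Finset.prod_const, Finset.card_range]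

lemma lintegral_wordWeight {P : Measure (Env d)} (hstat : IsShiftInvariant P)
    (κ : EllipticityConst d) (x : Site d) (n : ℕ) (ξ : ℕ → Letter d) :
    ∫⁻ ω, wordWeight κ x n ξ ω ∂P = meanWeight P κ n ξ := by
  have hm : Measurable (shiftEnv x : Env d → Env d) :=
    measurable_pi_lambda _ fun z => measurable_pi_apply (z + x)
  rw [meanWeight]
  conv_rhs => rw [← hstat x, lintegral_map (measurable_wordWeight κ 0 n ξ) hm]
  refine lintegral_congr fun ω => ?_
  simp only [wordWeight, shiftEnv, zero_add, add_comm x]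

lemma dist1_self (x : Site d) : dist1 x x = 0 := by simp [dist1]

lemma abs_level_sub_le (x y : Site d) : |level x - level y| ≤ dist1 x y := by
  have h : (x 0 - y 0).natAbs ≤ dist1 x y :=
    Finset.single_le_sum (f := fun i => (x i - y i).natAbs) (fun _ _ => Nat.zero_le _)
      (Finset.mem_univ 0)
  rw [Int.abs_eq_natAbs]
  exact_mod_cast h

lemma finite_dist1_le (y : Site d) (N : ℤ) : {x : Site d | (dist1 x y : ℤ) ≤ N}.Finite := by
  refine (Set.finite_Icc (fun i => y i - N) (fun i => y i + N)).subset fun x hx => ?_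
  have h : ∀ i, |x i - y i| ≤ N := fun i => by
    have h1 : (x i - y i).natAbs ≤ dist1 x y :=
      Finset.single_le_sum (f := fun i => (x i - y i).natAbs) (fun _ _ => Nat.zero_le _)
        (Finset.mem_univ i)
    have h2 : (dist1 x y : ℤ) ≤ N := hx
    rw [Int.abs_eq_natAbs]
    exact le_trans (by exact_mod_cast h1) h2
  exact ⟨fun i => by linarith [(abs_le.1 (h i)).1], fun i => by linarith [(abs_le.1 (h i)).2]⟩

/-- Two words separated by a gap in the direction `±e_1` decouple. -/
theorem MixesWith.exists_decoupling {P : Measure (Env d)} [IsProbabilityMeasure P]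
    (hstat : IsShiftInvariant P) (κ : EllipticityConst d) {r : ℕ} {γ C : ℝ} (hγ : 0 < γ)
    (hmix : MixesWith P r γ C) {c : ℝ} (hc : 0 ≤ c) :
    ∃ D : ℕ → ℝ, (∀ l, 1 < D l) ∧ Tendsto D atTop (𝓝 1) ∧
      ∀ u : Site d → ℤ, (∀ x y, u x - u y ≤ dist1 x y) → ∀ l : ℕ, r ≤ l →
      ∀ (ξ ξ' : ℕ → Letter d) (z : Site d) (n m : ℕ) (a : ℤ),
      (∀ i < n, u (path ξ i) < a) → (h : ℕ → ℕ) →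
      (∀ i < m, a + l + h i ≤ u (z + path ξ' i)) →
      (∀ j : ℕ, (((Finset.range m).filter fun i => h i = j).card : ℝ) ≤ c * ((j : ℝ) + 1) ^ 2) →
      ∫⁻ ω, wordWeight κ 0 n ξ ω * wordWeight κ z m ξ' ω ∂P ≤
          ENNReal.ofReal (D l) * (meanWeight P κ n ξ * meanWeight P κ m ξ') ∧
        meanWeight P κ n ξ * meanWeight P κ m ξ' ≤
          ENNReal.ofReal (D l) * ∫⁻ ω, wordWeight κ 0 n ξ ω * wordWeight κ z m ξ' ω ∂P := by
  classical
  set K₁ : ℝ := (∑' z : ℤ, Real.exp (-(γ / 2) * z.natAbs)) ^ d with hK₁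
  set K₂ : ℝ := ∑' j : ℕ, ((j : ℝ) + 1) ^ 2 * Real.exp (-(γ / 2) * j) with hK₂
  have hK₁0 : 0 ≤ K₁ := pow_nonneg (tsum_nonneg fun _ => by positivity) _
  have hK₂0 : 0 ≤ K₂ := tsum_nonneg fun _ => by positivity
  set B : ℝ := |C| * (K₁ * (c * K₂)) with hB
  have hB0 : 0 ≤ B := by positivity
  -- The summand 1/(l + 1) only makes the rate strictly larger than 1.
  refine ⟨fun l => Real.exp (B * Real.exp (-(γ / 2) * l)) + 1 / ((l : ℝ) + 1), fun l => ?_, ?_, ?_⟩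
  · have h1 : 1 ≤ Real.exp (B * Real.exp (-(γ / 2) * l)) := Real.one_le_exp (by positivity)
    have h2 : (0 : ℝ) < 1 / ((l : ℝ) + 1) := by positivity
    linarith
  · have h1 : Tendsto (fun l : ℕ => -(γ / 2) * (l : ℝ)) atTop atBot :=
      tendsto_natCast_atTop_atTop.const_mul_atTop_of_neg (by linarith)
    have h2 := Real.tendsto_exp_atBot.comp h1
    have h3 : Tendsto (fun l : ℕ => Real.exp (B * Real.exp (-(γ / 2) * l))) atTop (𝓝 1) := by
      have h4 := (Real.continuous_exp.tendsto _).comp (h2.const_mul B)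
      simpa [Function.comp_def] using h4
    simpa using h3.add tendsto_one_div_add_atTop_nhds_zero_nat
  intro u hu l hl ξ ξ' z n m a hn h hm hcr
  set Δ : Finset (Site d) := (Finset.range m).image fun i => z + path ξ' i with hΔ
  -- V consists of the sites whose distance to some y in Δ is at most u y − a. As u is 1-Lipschitz,
  -- every site with u < a lies outside V, hence the whole past does; and a site off V has distance
  -- more than l + h i from the i-th site of the future.
  have hfin : {x : Site d | ∃ y ∈ Δ, (dist1 x y : ℤ) ≤ u y - a}.Finite := by
    have h1 : {x : Site d | ∃ y ∈ Δ, (dist1 x y : ℤ) ≤ u y - a} =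
        ⋃ y ∈ Δ, {x : Site d | (dist1 x y : ℤ) ≤ u y - a} := by ext x; simp
    rw [h1]
    exact Δ.finite_toSet.biUnion fun y _ => finite_dist1_le y _
  set V : Finset (Site d) := hfin.toFinset with hV
  have hmV : ∀ x, x ∈ V ↔ ∃ y ∈ Δ, (dist1 x y : ℤ) ≤ u y - a := fun x => by
    rw [hV, Set.Finite.mem_toFinset, Set.mem_ofPred]
  have hlow : ∀ y ∈ Δ, a + l ≤ u y := by
    intro y hy
    obtain ⟨i, hi, rfl⟩ := Finset.mem_image.1 hy
    have := hm i (Finset.mem_range.1 hi)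
    omega
  have hΔV : Δ ⊆ V := fun y hy => (hmV y).2 ⟨y, hy, by rw [dist1_self]; have := hlow y hy; omega⟩
  have hfar : ∀ y ∈ Δ, ∀ x, x ∉ V → u y - a < dist1 x y := by
    intro y hy x hx
    by_contra hlt
    exact hx ((hmV x).2 ⟨y, hy, not_lt.1 hlt⟩)
  have dist_comm : ∀ x y : Site d, dist1 x y = dist1 y x := fun x y =>
    Finset.sum_congr rfl fun i _ => by omega
  have hr : ∀ x ∈ Δ, ∀ y ∉ V, r ≤ dist1 x y := by
    intro x hx y hy
    have h1 := hfar x hx y hy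
    have h2 := hlow x hx
    rw [dist_comm]
    omega
  have hsum : ∑ y ∈ Δ, ∑' x : ((V : Set (Site d))ᶜ : Set (Site d)),
      Real.exp (-γ * dist1 (x : Site d) y) ≤ K₁ * (c * K₂) * Real.exp (-(γ / 2) * l) := by
    -- The sum over the sites visited is at most the sum over the times, which the crowding bound
    -- controls.
    refine (Finset.sum_image_le_of_nonneg fun y _ => tsum_nonneg fun _ => by positivity).trans ?_
    calc _ ≤ ∑ i ∈ Finset.range m, K₁ * Real.exp (-(γ / 2) * ((l : ℝ) + h i)) := by
          refine Finset.sum_le_sum fun i hi => tsum_exp_dist1_le hγ _ _ _ fun x hx => ?_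
          have h1 := hfar _ (Finset.mem_image_of_mem _ hi) x hx
          have h2 := hm i (Finset.mem_range.1 hi)
          have h3 : ((l : ℤ) + h i : ℤ) ≤ dist1 x (z + path ξ' i) := by omega
          exact_mod_cast h3
      _ = K₁ * Real.exp (-(γ / 2) * l) * ∑ i ∈ Finset.range m, Real.exp (-(γ / 2) * h i) := by
          rw [Finset.mul_sum]
          refine Finset.sum_congr rfl fun i _ => ?_
          rw [mul_add, Real.exp_add, mul_assoc]
      _ ≤ K₁ * Real.exp (-(γ / 2) * l) * (c * K₂) :=
          mul_le_mul_of_nonneg_left (sum_exp_le_of_crowd (half_pos hγ) hc m h hcr) (by positivity)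
      _ = _ := by ring
  have hK : ENNReal.ofReal (Real.exp (C * ∑ y ∈ Δ, ∑' x : ((V : Set (Site d))ᶜ : Set (Site d)),
      Real.exp (-γ * dist1 (x : Site d) y))) ≤
      ENNReal.ofReal (Real.exp (B * Real.exp (-(γ / 2) * l)) + 1 / ((l : ℝ) + 1)) := by
    refine ENNReal.ofReal_le_ofReal (le_add_of_le_of_nonneg (Real.exp_le_exp.2 ?_) (by positivity))
    have h0 : 0 ≤ ∑ y ∈ Δ, ∑' x : ((V : Set (Site d))ᶜ : Set (Site d)),
      Real.exp (-γ * dist1 (x : Site d) y) :=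
        Finset.sum_nonneg fun _ _ => tsum_nonneg fun _ => by positivity
    refine (mul_le_mul_of_nonneg_right (le_abs_self C) h0).trans ?_
    rw [hB, mul_assoc]
    exact mul_le_mul_of_nonneg_left hsum (abs_nonneg C)
  have hdep1 : DependsOnSites (V : Set (Site d))ᶜ (wordWeight κ 0 n ξ) := by
    intro ω ω' hω
    refine Finset.prod_congr rfl fun i hi => ?_
    rw [hω (0 + path ξ i)]
    rw [zero_add]
    intro hiV
    obtain ⟨y, hy, hyd⟩ := (hmV _).1 hiV
    have h1 := hu y (path ξ i)
    rw [dist_comm] at h1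
    have h2 := hn i (Finset.mem_range.1 hi)
    omega
  have hdep2 : DependsOnSites (Δ : Set (Site d)) (wordWeight κ z m ξ') := by
    intro ω ω' hω
    refine Finset.prod_congr rfl fun i hi => ?_
    rw [hω _ (Finset.mem_coe.2 (Finset.mem_image_of_mem _ hi))]
  have key := hmix.lintegral_mul hΔV hr hK (measurable_wordWeight κ 0 n ξ)
    (measurable_wordWeight κ z m ξ') hdep1 hdep2
  rwa [lintegral_wordWeight hstat, lintegral_wordWeight hstat] at key

end Mixing

end RWRE

namespace RWRE

section Assembly

variable {d : ℕ} [NeZero d]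

/-! ### The law of the letters is a mixing walk -/

/-- The relabelling f and the sign s treat the walk and its reflection together, with s · level as
the Lipschitz function in the decoupling. Dropping the middle weights, which are at most 1, gives
the one-sided bound; for marked letters these weights are the constant (κ/2) ^ t, which factors out
of all integrals and gives the two-sided bounds. -/
theorem isMixingWalk_of_cyl {P : Measure (Env d)} [IsProbabilityMeasure P]
    (hstat : IsShiftInvariant P) (κ : EllipticityConst d) (hmix : IsStrongMixing P)
    {μ : Measure (ℕ → Letter d)} [IsProbabilityMeasure μ] (f : Letter d → Letter d)
    (hf : ∀ a, (f a).mark = a.mark) (s : ℤ) (hs : |s| ≤ 1)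
    (hfs : ∀ (ξ : ℕ → Letter d) (n : ℕ), s * level (path (f ∘ ξ) n) = height ξ n)
    (hμ : ∀ (n : ℕ) (ξ : ℕ → Letter d), μ (cyl n ξ) = meanWeight P κ n (f ∘ ξ)) :
    IsMixingWalk (ENNReal.ofReal (κ / 2)) μ := by
  obtain ⟨r, -, -, γ, hγ, C, hC⟩ := hmix
  refine ⟨inferInstance, ENNReal.ofReal_pos.2 (half_pos κ.2.1), ?_, fun ξ n hn => ?_,
    fun c hc => ?_⟩
  · rw [ENNReal.ofReal_lt_one]
    have hd : (1 : ℝ) ≤ d := Nat.one_le_cast.2 (NeZero.pos d)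
    nlinarith [κ.mul_mem.2, κ.2.1]
  · rw [hμ, hμ, meanWeight, meanWeight, ← lintegral_const_mul _ (measurable_wordWeight _ _ _ _)]
    refine lintegral_congr fun ω => ?_
    rw [wordWeight, Finset.prod_range_succ, mul_comm, ← wordWeight, letterWeight,
      if_pos (show ((f ∘ ξ) n).mark = true from (hf _).trans hn)]
  obtain ⟨D, hD1, hD, hdec⟩ := hC.exists_decoupling hstat κ hγ (c := c) (by linarith)
  refine ⟨D, r, hD1, hD, fun l hl ξ n t m a hn ha hm => ?_⟩
  have hu : ∀ x y : Site d, s * level x - s * level y ≤ dist1 x y := fun x y => by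
    rw [← mul_sub]
    refine (le_abs_self _).trans ?_
    rw [abs_mul]
    exact (mul_le_of_le_one_left (abs_nonneg _) hs).trans (abs_level_sub_le x y)
  have hshift : f ∘ shiftSeq (n + t) ξ = shiftSeq (n + t) (f ∘ ξ) := rfl
  have hpos : ∀ i < m, 0 ≤ height (shiftSeq (n + t) ξ) i := by
    intro i hi
    rcases Nat.eq_zero_or_pos i with rfl | h1
    · simp
    · exact (height_pos_of_le_stopTime hm hi h1).le
  have hlev : ∀ i, s * level (path (f ∘ ξ) (n + t) + path (shiftSeq (n + t) (f ∘ ξ)) i) =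
      height ξ (n + t) + height (shiftSeq (n + t) ξ) i := fun i => by
    rw [← path_add, hfs, height_shift]; ring
  have hcr : ∀ j : ℕ, (((Finset.range m).filter fun i =>
      (height (shiftSeq (n + t) ξ) i).toNat = j).card : ℝ) ≤ c * ((j : ℝ) + 1) ^ 2 := by
    intro j
    have hc0 : 0 ≤ c := by linarith
    rcases Nat.eq_zero_or_pos m with rfl | h1
    · simp; positivity
    · have h2 := le_stopTime_iff.1 hm (m - 1) (by omega)
      have h3 : ¬ c * ((j : ℝ) + 1) ^ 2 < _ := fun h => h2 (Or.inl ⟨j, h⟩)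
      rw [Nat.sub_add_cancel h1, not_lt] at h3
      refine le_trans ?_ h3
      refine Nat.cast_le.2 (Finset.card_le_card fun i hi => ?_)
      rw [Finset.mem_filter] at hi ⊢
      have h4 := hpos i (Finset.mem_range.1 hi.1)
      exact ⟨hi.1, by rw [← hi.2, Int.toNat_of_nonneg h4]⟩
  have key := hdec (fun x => s * level x) hu l hl (f ∘ ξ) (shiftSeq (n + t) (f ∘ ξ))
    (path (f ∘ ξ) (n + t)) n m a (fun i hi => by simpa only [hfs] using hn i hi)
    (fun i => (height (shiftSeq (n + t) ξ) i).toNat)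
    (fun i hi => by
      simp only [hlev]
      have := hpos i hi
      omega) hcr
  set I := ∫⁻ ω, wordWeight κ 0 n (f ∘ ξ) ω *
    wordWeight κ (path (f ∘ ξ) (n + t)) m (shiftSeq (n + t) (f ∘ ξ)) ω ∂P with hI
  have hsplit : ∀ ω, wordWeight κ 0 (n + t + m) (f ∘ ξ) ω = wordWeight κ 0 n (f ∘ ξ) ω *
      wordWeight κ (0 + path (f ∘ ξ) n) t (shiftSeq n (f ∘ ξ)) ω *
      wordWeight κ (path (f ∘ ξ) (n + t)) m (shiftSeq (n + t) (f ∘ ξ)) ω := fun ω => by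
    rw [wordWeight_add κ 0 (n + t), wordWeight_add κ 0 n t, zero_add (path (f ∘ ξ) (n + t))]
  simp only [hμ, hshift]
  refine ⟨le_trans (lintegral_mono fun ω => ?_) key.1, fun hmark => ?_⟩
  · rw [hsplit]
    exact mul_le_mul' (mul_le_of_le_one_right' (wordWeight_le_one _ _ _ _ _)) le_rfl
  set w : ℝ≥0∞ := ENNReal.ofReal (κ / 2) ^ t with hw
  have hconst : ∀ ω, wordWeight κ (0 + path (f ∘ ξ) n) t (shiftSeq n (f ∘ ξ)) ω = w := fun ω =>
    wordWeight_of_marked _ _ _ _ _ fun i hi =>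
      (hf _).trans (hmark (n + i) (by omega) (by omega))
  have h1 : meanWeight P κ (n + t + m) (f ∘ ξ) = w * I := by
    have hm : Measurable fun ω : Env d => wordWeight κ 0 n (f ∘ ξ) ω *
        wordWeight κ (path (f ∘ ξ) (n + t)) m (shiftSeq (n + t) (f ∘ ξ)) ω :=
      (measurable_wordWeight _ _ _ _).mul (measurable_wordWeight _ _ _ _)
    rw [meanWeight, hI, ← lintegral_const_mul _ hm]
    refine lintegral_congr fun ω => ?_
    rw [hsplit, hconst, mul_comm _ w, mul_assoc]
  have h2 : meanWeight P κ (n + t) (f ∘ ξ) = w * meanWeight P κ n (f ∘ ξ) := by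
    rw [meanWeight, meanWeight, ← lintegral_const_mul _ (measurable_wordWeight _ _ _ _)]
    refine lintegral_congr fun ω => ?_
    rw [wordWeight_add, hconst, mul_comm]
  rw [h1, h2, mul_assoc, mul_left_comm _ w, mul_left_comm _ w]
  exact ⟨mul_le_mul_right key.1 w, mul_le_mul_right key.2 w⟩

lemma letterLaw_cyl_eq_meanWeight {P : Measure (Env d)} [IsProbabilityMeasure P]
    {κ : EllipticityConst d} (hell : IsUniformlyElliptic P κ) (hstat : IsShiftInvariant P)
    (n : ℕ) (ξ : ℕ → Letter d) : letterLaw P κ (cyl n ξ) = meanWeight P κ n ξ := by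
  simp only [letterLaw_cyl hell hstat, meanWeight, wordWeight, zero_add]

theorem isMixingWalk_letterLaw {P : Measure (Env d)} [IsProbabilityMeasure P]
    {κ : EllipticityConst d} (hell : IsUniformlyElliptic P κ) (hstat : IsShiftInvariant P)
    (hmix : IsStrongMixing P) : IsMixingWalk (ENNReal.ofReal (κ / 2)) (letterLaw P κ) :=
  isMixingWalk_of_cyl hstat κ hmix id (fun _ => rfl) 1 (by simp) (fun ξ n => one_mul _)
    (letterLaw_cyl_eq_meanWeight hell hstat)

/-- The reflection of a letter, which exchanges the directions `e_1` and `-e_1`. -/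
def flipLetter (a : Letter d) : Letter d :=
  ⟨(a.dir.1, if a.dir.1 = 0 then -a.dir.2 else a.dir.2), a.mark⟩

/-- The reflection of a sequence of letters. -/
def flipSeq (ξ : ℕ → Letter d) : ℕ → Letter d := flipLetter ∘ ξ

lemma flipLetter_flipLetter (a : Letter d) : flipLetter (flipLetter a) = a := by
  obtain ⟨⟨i, s⟩, b⟩ := a
  by_cases h : i = 0 <;> simp [flipLetter, h]

lemma level_flipLetter (a : Letter d) : level (flipLetter a).dir.vec = -level a.dir.vec := by
  obtain ⟨⟨i, s⟩, b⟩ := a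
  by_cases h : i = 0
  · subst h; simp [flipLetter, level, Dir.vec]
  · simp [flipLetter, level, Dir.vec, h]

lemma height_flipSeq (ξ : ℕ → Letter d) (n : ℕ) : height (flipSeq ξ) n = -height ξ n := by
  induction n with
  | zero => simp
  | succ n ih => rw [height_succ, height_succ, ih, flipSeq, Function.comp, level_flipLetter]; ring

lemma measurable_flipSeq : Measurable (flipSeq : (ℕ → Letter d) → ℕ → Letter d) :=
  measurable_pi_lambda _ fun i => Measurable.of_discrete.comp (measurable_pi_apply i)

theorem isMixingWalk_map_flipSeq {P : Measure (Env d)} [IsProbabilityMeasure P]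
    {κ : EllipticityConst d} (hell : IsUniformlyElliptic P κ) (hstat : IsShiftInvariant P)
    (hmix : IsStrongMixing P) :
    IsMixingWalk (ENNReal.ofReal (κ / 2)) ((letterLaw P κ).map flipSeq) := by
  have := Measure.isProbabilityMeasure_map (μ := letterLaw P κ) measurable_flipSeq.aemeasurable
  refine isMixingWalk_of_cyl hstat κ hmix flipLetter (fun _ => rfl) (-1) (by simp)
    (fun ξ n => ?_) fun n ξ => ?_
  · have h := height_flipSeq ξ n
    rw [show level (path (flipLetter ∘ ξ) n) = height (flipSeq ξ) n from rfl, h]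
    ring
  · rw [Measure.map_apply measurable_flipSeq (measurableSet_cyl n ξ),
      ← letterLaw_cyl_eq_meanWeight hell hstat]
    congr 1
    ext η
    refine forall₂_congr fun i _ => ⟨fun h => ?_, fun h => ?_⟩
    · rw [Function.comp, ← h]; exact (flipLetter_flipLetter _).symm
    · rw [flipSeq, Function.comp, h]; exact flipLetter_flipLetter _

/-! ### The speed of a mixing walk -/

lemma tendsto_div_zero_of_eventually_le {x : ℕ → ℤ}
    (h1 : ∀ A : ℕ, 1 ≤ A → ∀ᶠ n : ℕ in atTop, (A : ℤ) * x n ≤ n)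
    (h2 : ∀ A : ℕ, 1 ≤ A → ∀ᶠ n : ℕ in atTop, (A : ℤ) * -x n ≤ n) :
    Tendsto (fun n : ℕ => (x n : ℝ) / n) atTop (𝓝 0) := by
  rw [Metric.tendsto_atTop']
  intro ε hε
  obtain ⟨A, hA⟩ := exists_nat_gt (1 / ε)
  have hA0 : (0 : ℝ) < A := (by positivity : 0 < 1 / ε).trans hA
  have hA1 : 1 ≤ A := Nat.cast_pos.1 hA0
  obtain ⟨N, hN⟩ := eventually_atTop.1 ((h1 A hA1).and (h2 A hA1))
  refine ⟨N, fun n hn => ?_⟩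
  obtain ⟨h3, h4⟩ := hN n hn.le
  have h5 : (A : ℝ) * x n ≤ n := by exact_mod_cast h3
  have h6 : (A : ℝ) * -x n ≤ n := by exact_mod_cast h4
  have hn0 : (0 : ℝ) < n := Nat.cast_pos.2 (by omega)
  have h7 : |(x n : ℝ)| * A ≤ n := by
    rcases abs_cases (x n : ℝ) with h | h <;> rw [h.1] <;> linarith
  rw [Real.dist_eq, sub_zero, abs_div, abs_of_pos hn0, div_lt_iff₀ hn0]
  have h8 : 1 < A * ε := by rwa [div_lt_iff₀ hε] at hA
  have h9 : |(x n : ℝ)| * A < ε * n * A := by nlinarith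
  exact lt_of_mul_lt_mul_right h9 hA0.le

lemma IsMixingWalk.ae_forall_eventually_height_le_div {q : ℝ≥0∞} {μ : Measure (ℕ → Letter d)}
    (h : IsMixingWalk q μ) (h0 : ∀ c : ℝ, μ (noStop c) = 0) :
    ∀ᵐ ξ ∂μ, ∀ A : ℕ, 1 ≤ A → ∀ᶠ n : ℕ in atTop, (A : ℤ) * height ξ n ≤ n :=
  ae_all_iff.2 fun A => by
    by_cases h1 : 1 ≤ A
    · filter_upwards [h.ae_eventually_height_le_div h0 h1] with ξ hξ _ using hξ
    · exact ae_of_all _ fun ξ h2 => absurd h2 h1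

/-- If R = ∞ has positive probability for some c, the walk escapes upwards with positive
probability, and there the speeds for all such c are limits of the same sequence, so one v serves
every c. If not, the walk has no positive upward speed and v = 0. -/
theorem IsMixingWalk.exists_velocity {q : ℝ≥0∞} {μ : Measure (ℕ → Letter d)}
    (h : IsMixingWalk q μ) : ∃ v : ℝ, 0 ≤ v ∧
      (∀ᵐ ξ ∂μ, Tendsto (height ξ) atTop atTop →
        Tendsto (fun n : ℕ => (height ξ n : ℝ) / n) atTop (𝓝 v)) ∧
      (μ {ξ | Tendsto (height ξ) atTop atTop} = 0 → v = 0) ∧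
      (0 < v → (∃ c, μ (noStop c) ≠ 0) ∧ ∀ c, μ (noStop c) ≠ 0 → ∃ L₀, ∀ L ≥ L₀,
        ∫⁻ ξ, (regen c L ξ : ℝ≥0∞) ∂(ProbabilityTheory.cond μ (noStop c)) < ⊤) := by
  by_cases hex : ∃ c, μ (noStop c) ≠ 0
  · obtain ⟨c₀, hc₀⟩ := hex
    have hesc : μ {ξ | Tendsto (height ξ) atTop atTop} ≠ 0 := fun h0 =>
      hc₀ (measure_mono_null (fun ξ hξ => tendsto_height_of_noStop hξ) h0)
    obtain ⟨v, hv0, hv, -⟩ := h.exists_speed hc₀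
    refine ⟨v, hv0, hv, fun h0 => absurd h0 hesc, fun hpos => ⟨⟨c₀, hc₀⟩, fun c hc => ?_⟩⟩
    obtain ⟨v', -, hv', hreg⟩ := h.exists_speed hc
    have heq : v = v' := by
      by_contra hne
      refine hesc (measure_mono_null (fun ξ hξ => ?_)
        (ae_iff.1 (hv.and hv')))
      exact fun hand => hne (tendsto_nhds_unique (hand.1 hξ) (hand.2 hξ))
    exact hreg (heq ▸ hpos)
  · push Not at hex
    refine ⟨0, le_rfl, ?_, fun _ => rfl, fun h0 => absurd h0 (lt_irrefl _)⟩
    filter_upwards [h.ae_forall_eventually_height_le_div hex] with ξ hξ htop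
    refine tendsto_div_zero_of_eventually_le hξ fun A _ => ?_
    filter_upwards [htop.eventually_ge_atTop 0] with n hn
    nlinarith

/-! ### From letters to paths -/

lemma measurable_path : Measurable (path : (ℕ → Letter d) → WalkPath d) :=
  measurable_pi_lambda _ fun _ => Finset.measurable_sum _ fun i _ =>
    (Measurable.of_discrete (f := fun a : Letter d => a.dir.vec)).comp (measurable_pi_apply i)

lemma measurable_level (n : ℕ) : Measurable fun X : WalkPath d => level (X n) :=
  (measurable_pi_apply (0 : Fin d)).comp (measurable_pi_apply n)

lemma measurableSet_escapesUp : MeasurableSet (escapesUp d) :=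
  measurableSet_tendsto atTop measurable_level

lemma measurableSet_escapesDown : MeasurableSet (escapesDown d) :=
  measurableSet_tendsto atTop fun n => (measurable_level n).neg

lemma measurableSet_stopR_eq_top (c : ℝ) : MeasurableSet {X : WalkPath d | stopR c X = ⊤} := by
  have h : {X : WalkPath d | stopR c X = ⊤} = ⋂ n : ℕ, {X | ¬ ((∃ j : ℕ, c * ((j : ℝ) + 1) ^ 2 <
      (((Finset.range (n + 1)).filter fun i => level (X i) = level (X 0) + j).card : ℝ)) ∨
        1 ≤ n ∧ level (X n) ≤ level (X 0))} := by
    ext X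
    rw [Set.mem_ofPred, stopR, crowdTime, backtrackTime, min_firstTime, firstTime_eq_top_iff,
      Set.mem_iInter]
    rfl
  rw [h]
  refine MeasurableSet.iInter fun n => Determined.measurableSet (n := n + 1) fun X hX Y hY => ?_
  have h0 := hY 0 n.succ_pos
  have h1 : ∀ j : ℕ, ((Finset.range (n + 1)).filter fun i => level (Y i) = level (X 0) + j) =
      (Finset.range (n + 1)).filter fun i => level (X i) = level (X 0) + j := fun j =>
    Finset.filter_congr fun i hi => by rw [hY i (Finset.mem_range.1 hi)]
  rw [Set.mem_ofPred] at hX ⊢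
  simpa only [h1, h0, hY n n.lt_succ_self] using hX

lemma annealed_map_snd_eq {P : Measure (Env d)} [IsProbabilityMeasure P] {κ : EllipticityConst d}
    (hell : IsUniformlyElliptic P κ) (hstat : IsShiftInvariant P) :
    (annealed P).map Prod.snd = (letterLaw P κ).map path := by
  rw [annealed_map_snd hell hstat, letterLaw, Measure.map_map measurable_path measurable_letters]
  refine Measure.map_congr ?_
  filter_upwards [ae_path_letters P κ] with w hw using hw.symm

lemma annealed_apply {P : Measure (Env d)} [IsProbabilityMeasure P] {κ : EllipticityConst d}
    (hell : IsUniformlyElliptic P κ) (hstat : IsShiftInvariant P) {S : Set (WalkPath d)}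
    (hS : MeasurableSet S) : annealed P {w | w.2 ∈ S} = letterLaw P κ {ξ | path ξ ∈ S} := by
  have h := congrArg (fun ν => ν S) (annealed_map_snd_eq hell hstat)
  rw [Measure.map_apply measurable_snd hS, Measure.map_apply measurable_path hS] at h
  exact h

/-- The regeneration time reads only the coins along the path, so it is a function of the letters
almost surely. -/
lemma lintegral_regenTime {P : Measure (Env d)} [IsProbabilityMeasure P] (κ : EllipticityConst d)
    (c : ℝ) (L : ℕ) : ∫⁻ w, (regenTime c L w.1.2 w.2 : ℝ≥0∞) ∂(regenLaw P κ c) =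
      ∫⁻ ξ, (regen c L ξ : ℝ≥0∞) ∂(ProbabilityTheory.cond (letterLaw P κ) (noStop c)) := by
  have hset : ({w | stopR c w.2 = ⊤} : Set ((Env d × Coins d) × WalkPath d)) =ᵐ[tripleLaw P κ]
      letters ⁻¹' noStop c := by
    filter_upwards [ae_path_letters P κ] with w hw
    refine propext (Iff.of_eq (congrArg (fun X => stopR c X = ⊤) hw.symm))
  have hm : Measurable fun ξ : ℕ → Letter d => (regen c L ξ : ℝ≥0∞) :=
    Measurable.of_discrete.comp (measurable_regen c L)
  rw [regenLaw, ProbabilityTheory.cond, ProbabilityTheory.cond, measure_congr hset,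
    Measure.restrict_congr_set hset, letterLaw,
    Measure.map_apply measurable_letters (measurableSet_noStop c), lintegral_smul_measure,
    lintegral_smul_measure, setLIntegral_map (measurableSet_noStop c) hm measurable_letters]
  congr 1
  refine lintegral_congr_ae (ae_restrict_of_ae ?_)
  filter_upwards [ae_path_letters P κ] with w hw
  rw [← regenTime_eq_regen (ε := w.1.2) c (fun n => by rw [hw]; rfl), hw]

end Assembly

end RWRE

/-! ### The law of large numbers -/

theorem mainTheorem3 (d : ℕ) [NeZero d] (hd : 2 ≤ d)
    (P : Measure (Env d)) [IsProbabilityMeasure P]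
    (hstat : IsShiftInvariant P) (κ : EllipticityConst d) (hell : IsUniformlyElliptic P κ)
    (hmix : IsStrongMixing P) :
    ∃ vplus vminus : ℝ, 0 ≤ vplus ∧ 0 ≤ vminus ∧
      (annealed P {w | w.2 ∈ escapesUp d} = 0 → vplus = 0) ∧
      (annealed P {w | w.2 ∈ escapesDown d} = 0 → vminus = 0) ∧
      (∀ᵐ w ∂(annealed P), Tendsto (fun n : ℕ => (level (w.2 n) : ℝ) / n) atTop
        (𝓝 (vplus * (escapesUp d).indicator (fun _ => (1 : ℝ)) w.2 -
          vminus * (escapesDown d).indicator (fun _ => (1 : ℝ)) w.2))) ∧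
      (0 < vplus →
        (∃ c : ℝ, 0 < annealed P {w | stopR c w.2 = ⊤}) ∧
        (∀ c : ℝ, 0 < annealed P {w | stopR c w.2 = ⊤} →
          ∃ L₀ : ℕ, ∀ L ≥ L₀,
            ∫⁻ w, (regenTime c L w.1.2 w.2 : ℝ≥0∞) ∂(regenLaw P κ c) < ∞) ∧
        annealed P {w | w.2 ∈ escapesUp d ∪ escapesDown d} = 1) := by
  set μ := letterLaw P κ with hμ
  have hW := isMixingWalk_letterLaw hell hstat hmix
  -- The reflected walk supplies the speed in direction −e₁.
  have hW' := isMixingWalk_map_flipSeq hell hstat hmix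
  obtain ⟨v, hv0, hv, hvz, hvp⟩ := hW.exists_velocity
  obtain ⟨v', hv0', hv', hvz', hvp'⟩ := hW'.exists_velocity
  have hflip : ∀ {p : (ℕ → Letter d) → Prop}, (∀ᵐ ξ ∂(μ.map flipSeq), p ξ) →
      ∀ᵐ ξ ∂μ, p (flipSeq ξ) := fun h => ae_of_ae_map measurable_flipSeq.aemeasurable h
  have hneg : ∀ ξ : ℕ → Letter d, height (flipSeq ξ) = fun n => -height ξ n :=
    fun ξ => funext (height_flipSeq ξ)
  have hcross : ∀ ξ : ℕ → Letter d, Tendsto (height ξ) atTop atTop →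
      ¬ Tendsto (fun n => -height ξ n) atTop atTop := fun ξ h h' => by
    obtain ⟨n, h1, h2⟩ := ((h.eventually_gt_atTop 0).and (h'.eventually_gt_atTop 0)).exists
    omega
  have hnoStop : ∀ c : ℝ, annealed P {w | stopR c w.2 = ⊤} = μ (noStop c) := fun c =>
    annealed_apply hell hstat (measurableSet_stopR_eq_top c)
  have hdich : (∃ c, μ (noStop c) ≠ 0) → ∀ᵐ ξ ∂μ, Tendsto (height ξ) atTop atTop ∨
      Tendsto (fun n => -height ξ n) atTop atTop := fun ⟨c, hc⟩ => hW.ae_tendsto_or_tendsto hc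
  have hdich' : (∃ c, μ.map flipSeq (noStop c) ≠ 0) → ∀ᵐ ξ ∂μ, Tendsto (height ξ) atTop atTop ∨
      Tendsto (fun n => -height ξ n) atTop atTop := fun ⟨c, hc⟩ => by
    filter_upwards [hflip (hW'.ae_tendsto_or_tendsto hc)] with ξ hξ
    simp only [hneg, neg_neg] at hξ
    exact hξ.symm
  have hlim : ∀ᵐ ξ ∂μ, Tendsto (fun n : ℕ => (level (path ξ n) : ℝ) / n) atTop
      (𝓝 (v * (escapesUp d).indicator (fun _ => (1 : ℝ)) (path ξ) -
        v' * (escapesDown d).indicator (fun _ => (1 : ℝ)) (path ξ))) := by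
    -- If R = ∞ is possible in one direction, the walk tends to ∞ or −∞ almost surely, and the
    -- matching speed applies. Otherwise both speeds vanish, and the two one-sided slowness bounds
    -- give the limit 0 without any information on escape.
    by_cases hcase : (∃ c, μ (noStop c) ≠ 0) ∨ ∃ c, μ.map flipSeq (noStop c) ≠ 0
    · filter_upwards [hcase.elim hdich hdich', hv, hflip hv'] with ξ h1 h2 h3
      rcases h1 with h1 | h1
      · rw [Set.indicator_of_mem (show path ξ ∈ escapesUp d from h1),
          Set.indicator_of_notMem (show path ξ ∉ escapesDown d from hcross ξ h1)]
        simpa [height] using h2 h1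
      · rw [Set.indicator_of_notMem (show path ξ ∉ escapesUp d from fun h => hcross ξ h h1),
          Set.indicator_of_mem (show path ξ ∈ escapesDown d from h1)]
        rw [hneg] at h3
        have h4 := (h3 h1).neg
        simp only [Int.cast_neg, neg_div, neg_neg] at h4
        simpa [height] using h4
    · push Not at hcase
      have e1 : v = 0 := by
        by_contra hne
        exact (hvp (lt_of_le_of_ne hv0 (Ne.symm hne))).1.elim fun c hc => hc (hcase.1 c)
      have e2 : v' = 0 := by
        by_contra hne
        exact (hvp' (lt_of_le_of_ne hv0' (Ne.symm hne))).1.elim fun c hc => hc (hcase.2 c)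
      filter_upwards [hW.ae_forall_eventually_height_le_div hcase.1,
        hflip (hW'.ae_forall_eventually_height_le_div hcase.2)] with ξ h1 h2
      rw [e1, e2, zero_mul, zero_mul, sub_zero]
      simp only [hneg] at h2
      exact tendsto_div_zero_of_eventually_le h1 h2
  refine ⟨v, v', hv0, hv0', fun h => hvz ?_, fun h => hvz' ?_, ?_, fun hpos => ⟨?_, ?_, ?_⟩⟩
  · rwa [annealed_apply hell hstat measurableSet_escapesUp] at h
  · rw [annealed_apply hell hstat measurableSet_escapesDown] at h
    have hm : MeasurableSet {ξ : ℕ → Letter d | Tendsto (height ξ) atTop atTop} :=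
      measurable_path measurableSet_escapesUp
    rw [Measure.map_apply measurable_flipSeq hm]
    convert h using 2
    ext ξ
    simp only [Set.mem_preimage, Set.mem_ofPred, hneg]
    rfl
  · have hm : MeasurableSet {X : WalkPath d | Tendsto (fun n : ℕ => (level (X n) : ℝ) / n) atTop
        (𝓝 (v * (escapesUp d).indicator (fun _ => (1 : ℝ)) X -
          v' * (escapesDown d).indicator (fun _ => (1 : ℝ)) X))} :=
      measurableSet_tendsto_fun
        (fun n => (Measurable.of_discrete.comp (measurable_level n)).div_const _)
        (((measurable_const.indicator measurableSet_escapesUp).const_mul v).sub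
          ((measurable_const.indicator measurableSet_escapesDown).const_mul v'))
    refine ae_of_ae_map measurable_snd.aemeasurable (p := fun X : WalkPath d =>
      Tendsto (fun n : ℕ => (level (X n) : ℝ) / n) atTop
        (𝓝 (v * (escapesUp d).indicator (fun _ => (1 : ℝ)) X -
          v' * (escapesDown d).indicator (fun _ => (1 : ℝ)) X))) ?_
    rw [annealed_map_snd_eq hell hstat]
    exact (ae_map_iff measurable_path.aemeasurable hm).2 hlim
  · obtain ⟨c, hc⟩ := (hvp hpos).1
    exact ⟨c, by rw [hnoStop]; exact pos_iff_ne_zero.2 hc⟩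
  · intro c hc
    rw [hnoStop] at hc
    obtain ⟨L₀, hL₀⟩ := (hvp hpos).2 c hc.ne'
    exact ⟨L₀, fun L hL => by rw [lintegral_regenTime]; exact hL₀ L hL⟩
  · rw [annealed_apply hell hstat (measurableSet_escapesUp.union measurableSet_escapesDown)]
    have : IsProbabilityMeasure μ := hW.isProbabilityMeasure
    refine (measure_congr (ae_eq_univ.2 (ae_iff.1 (hdich (hvp hpos).1)))).trans measure_univ
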